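/- Let $\mathbb{R}_+=(0,\infty)$, $\lambda>0$ and $0<\sigma<1$. For $x,y,t>0$ let $$W_t^\lambda(x,y)=\frac{\sqrt{xy}}{2t}\,I_{\lambda-1/2}\Big(\frac{xy}{2t}\Big)e^{-(x^2+y^2)/(4t)},\qquad W_t^\lambda 1(x)=\int_0^\infty W_t^\lambda(x,y)\,dy,$$ where $I_\nu$ is the modified Bessel function of the first kind, and set $$K_\sigma^\lambda(x,y)=\frac{1}{-\Gamma(-\sigma)}\int_0^\infty W_t^\lambda(x,y)\,\frac{dt}{t^{1+\sigma}}\quad(x\ne y),\qquad B_\sigma^\lambda(x)=\frac{1}{\Gamma(-\sigma)}\int_0^\infty\big(W_t^\lambda1(x)-1\big)\frac{dt}{t^{1+\sigma}} .$$ Let $\mathcal{S}_\lambda$ be the space of smooth functions $\phi$ on $\mathbb{R}_+$ such that $\sup_{x>0}(1+x)^m\big|\big(\tfrac1x\tfrac{d}{dx}\big)^k(x^{-\lambda}\phi(x))\big|<\infty$ for all integers $m,k\ge0$. Let $h_\lambda \phi(x)=\int_0^\infty\sqrt{xy}\,J_{\lambda-1/2}(xy)\,\phi(y)\,dy$ be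 the Hankel transform, and for $\phi\in\mathcal{S}_\lambda$ put $\Delta_\lambda^\sigma\phi=h_\lambda\big(y^{2\sigma}h_\lambda\phi\big)$. Let $L_\sigma$ be the space of measurable $u:\mathbb{R}_+\to\mathbb{R}$ with $\int_0^\infty |u(x)|(1+x)^{-1-2\sigma}dx<\infty$. For $u\in L_\sigma$, $\Delta_\lambda^\sigma u$ is the functional on $\mathcal{S}_\lambda$ given by $(\Delta_\lambda^\sigma u)(\phi)=\int_0^\infty u\,\Delta_\lambda^\sigma\phi\,dx$; it is said to be the function $g$ on $\mathbb{R}_+$ if, for every $\phi\in\mathcal{S}_\lambda$, $\int_0^\infty u\,\Delta_\lambda^\sigma\phi\,dx=\int_0^\infty g\,\phi\,dx$ with both integrals absolutely convergent. For $0<\alpha\le1$ let $C^\alpha_+$ (also written $\mathrm{Lip}_+$ when $\alpha=1$) be the space of continuous $f$ on $\mathbb{R}_+$ with $$\sup_{x\ne y}\frac{|f(x)-f(y)|}{|x-y|^\alpha}+\sup_{x>0}x^{-\alpha}|f(x)|<\infty .$$ Then, for all $\lambda>0$ and $0<\sigma<1$, the integrals defining $K_\sigma^\lambda(x,y)$ for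 $x\neq y$, and $W_t^\lambda 1(x)$ and $B_\sigma^\lambda(x)$ for all $x,t>0$, are absolutely convergent, and there is a constant $C>0$ depending only on $\lambda$ and $\sigma$ such that $$0\le K_\sigma^\lambda(x,y)\le\frac{C}{|x-y|^{1+2\sigma}}\quad(x,y>0,\ x\ne y),\qquad |B_\sigma^\lambda(x)|\le\frac{C}{x^{2\sigma}}\quad(x>0).$$ Moreover: (1) If $0<\sigma<1/2$, $\lambda\ge1$, $2\sigma<\alpha\le1$ and $u\in C^\alpha_+\cap L_\sigma$, then $\Delta_\lambda^\sigma u$ is a continuous function on $\mathbb{R}_+$, given for every $x>0$ by $$\Delta_\lambda^\sigma u(x)=\int_0^\infty\big(u(x)-u(y)\big)K_\sigma^\lambda(x,y)\,dy+u(x)B_\sigma^\lambda(x),$$ where the integral is absolutely convergent. (2) If $1/2\le\sigma<1$, $\lambda\ge2$, $2\sigma-1<\alpha\le1$, and $u\in L_\sigma$ is continuous on $[0,\infty)$ and differentiable on $\mathbb{R}_+$ with $u'\in C^\alpha_+$, then $\Delta_\lambda^\sigma u$ is a continuous function on $\mathbb{R}_+$, given for every $x>0$ by $$\Delta_\lambda^\sigma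 u(x)=\lim_{\varepsilon\to0^+}\int_{\{y>0,\ |x-y|>\varepsilon\}}\big(u(x)-u(y)\big)K_\sigma^\lambda(x,y)\,dy+u(x)B_\sigma^\lambda(x),$$ where the integrals over $\{y>0,\ |x-y|>\varepsilon\}$ are absolutely convergent and the limit exists. -/

import Mathlib

open Set Filter Topology MeasureTheory

noncomputable section

namespace Bessel

/-- The Bessel function of the first kind `J_ν(z)`, for `z > 0` and `ν > -1`. -/
def besselJ (ν z : ℝ) : ℝ :=
  (z / 2) ^ ν *
    ∑' k : ℕ, (-1) ^ k * (z / 2) ^ (2 * k) / ((k.factorial : ℝ) * Real.Gamma ((k : ℝ) + ν + 1))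

/-- The modified Bessel function of the first kind `I_ν(z)`, for `z > 0` and `ν > -1`. -/
def besselI (ν z : ℝ) : ℝ :=
  (z / 2) ^ ν *
    ∑' k : ℕ, (z / 2) ^ (2 * k) / ((k.factorial : ℝ) * Real.Gamma ((k : ℝ) + ν + 1))

/-- The Bessel heat kernel `W_t^λ(x, y)`, for `x, y, t > 0`. -/
def heatKernel (lam t x y : ℝ) : ℝ :=
  Real.sqrt (x * y) / (2 * t) * besselI (lam - 1 / 2) (x * y / (2 * t)) *
    Real.exp (-(x ^ 2 + y ^ 2) / (4 * t))

/-- `W_t^λ 1(x)`. -/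
def heatOne (lam t x : ℝ) : ℝ := ∫ y in Ioi (0 : ℝ), heatKernel lam t x y

/-- The kernel `K_σ^λ(x, y)`, for `x ≠ y`. -/
def fracKernel (lam σ x y : ℝ) : ℝ :=
  1 / (-Real.Gamma (-σ)) * ∫ t in Ioi (0 : ℝ), heatKernel lam t x y / t ^ (1 + σ)

/-- The function `B_σ^λ(x)`. -/
def fracB (lam σ x : ℝ) : ℝ :=
  1 / Real.Gamma (-σ) * ∫ t in Ioi (0 : ℝ), (heatOne lam t x - 1) / t ^ (1 + σ)

/-- The Hankel transform `h_λ u(x) = ∫₀^∞ √(xy) J_{λ-1/2}(xy) u(y) dy`. -/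
def hankel (lam : ℝ) (u : ℝ → ℝ) (x : ℝ) : ℝ :=
  ∫ y in Ioi (0 : ℝ), Real.sqrt (x * y) * besselJ (lam - 1 / 2) (x * y) * u y

/-- The operator `(1/x) d/dx`. -/
def invDeriv (f : ℝ → ℝ) (x : ℝ) : ℝ := x⁻¹ * deriv f x

/-- The space `𝒮_λ`: functions `φ`, smooth on `(0, ∞)`, all of whose seminorms
`sup_{x > 0} (1+x)^m |((1/x) d/dx)^k (x^{-λ} φ(x))|` are finite.
Only the values of `φ` on `(0, ∞)` matter. -/
def testSpace (lam : ℝ) : Set (ℝ → ℝ) :=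
  {φ | ContDiffOn ℝ ((⊤ : ℕ∞) : WithTop ℕ∞) φ (Ioi 0) ∧
    ∀ m k : ℕ, ∃ C : ℝ, ∀ x : ℝ, 0 < x →
      (1 + x) ^ m * |(invDeriv^[k] (fun z => z ^ (-lam) * φ z)) x| ≤ C}

/-- `Δ_λ^σ φ = h_λ (y^{2σ} h_λ φ)`, for test functions `φ ∈ 𝒮_λ`. -/
def fracBesselTest (lam σ : ℝ) (φ : ℝ → ℝ) : ℝ → ℝ :=
  hankel lam (fun y => y ^ (2 * σ) * hankel lam φ y)

/-- The functional `Δ_λ^σ u` on `𝒮_λ`, defined by transposition: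
`(Δ_λ^σ u)(φ) = ∫₀^∞ u Δ_λ^σ φ`. -/
def fracBessel (lam σ : ℝ) (u : ℝ → ℝ) (φ : testSpace lam) : ℝ :=
  ∫ x in Ioi (0 : ℝ), u x * fracBesselTest lam σ φ.1 x

/-- The functional `Δ_λ^σ u` on `𝒮_λ` is the function `g` on `(0, ∞)`. The integrals that define
`(Δ_λ^σ u)(φ)` and the functional `φ ↦ ∫₀^∞ g φ` of `g` are required to converge absolutely. -/
def FracBesselIs (lam σ : ℝ) (u g : ℝ → ℝ) : Prop :=
  ∀ φ : testSpace lam,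
    IntegrableOn (fun x => u x * fracBesselTest lam σ φ.1 x) (Ioi 0) ∧
    IntegrableOn (fun x => g x * φ.1 x) (Ioi 0) ∧
    fracBessel lam σ u φ = ∫ x in Ioi (0 : ℝ), g x * φ.1 x

/-- The space `L_ρ`. -/
def MemL (ρ : ℝ) (u : ℝ → ℝ) : Prop :=
  IntegrableOn (fun x => u x / (1 + x) ^ (1 + 2 * ρ)) (Ioi 0)

/-- The space `C^α_+`, `0 < α < 1`; for `α = 1` it is `Lip_+`. -/
def MemHolderPlus (α : ℝ) (f : ℝ → ℝ) : Prop :=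
  ContinuousOn f (Ioi 0) ∧
    (∃ C : ℝ, ∀ x y : ℝ, 0 < x → 0 < y → |f x - f y| ≤ C * |x - y| ^ α) ∧
    (∃ C : ℝ, ∀ x : ℝ, 0 < x → x ^ (-α) * |f x| ≤ C)

end Bessel

end

noncomputable section

namespace Bessel

/-! The multiplier `ξ^(2σ)` is a superposition of heat multipliers: `Γ(-σ) s^σ = ∫₀^∞ (e^(-ts) - 1)
t^(-1-σ) dt` with `s = ξ²`. Weber's second exponential integral identifies the Hankel multiplier
`e^(-tξ²)` with the kernel `W_t`. Hence `Δ_λ^σ φ(x) = Γ(-σ)⁻¹ ∫₀^∞ (W_t φ(x) - φ(x)) t^(-1-σ) dt` on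
test functions (`fracBesselTest_eq`). Since `W_t` is symmetric, Fubini moves the increment from `φ`
to `u` (`fracBesselIs_of_time_integral`), so `Δ_λ^σ u` is the function given by the same time
integral of `W_t u(x) - u(x)`. It remains to bound this integral, to express it by the two kernels,
and to show that it is continuous in `x`.

The size estimates rest on the factorization `W_t(x,y) = G_t(x-y) ρ(xy/(2t))` (`heatKernel_eq`),
where `G_t` is the Gauss–Weierstrass kernel and `ρ` is nonnegative and bounded with `|ρ(z) - 1| ≤
C/z` (`rho_bounds`, from Poisson's integral). Boundedness of `ρ` gives the bound for `K`. The rate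
at infinity gives `|W_t 1(x) - 1| ≤ C min(1, t/x²)`, hence the bound for `B`. It also gives `K =
c|x-y|^(-1-2σ) + R` with `R = O((xy)^(-σ)|x-y|⁻¹)`.

Both ranges of `σ` are treated at once. From `u(y)` one subtracts `u(x)` and, for `|y-x| < x/2`, a
linear term `p(y-x)`, so that the error is `O(|x-y|^β)` with `β > 2σ`. For Hölder `u` one takes `p =
0` and `β = α`; for differentiable `u`, `p = u'(x)` and `β = 1+α`. The linear term is odd about `x`,
so it integrates to zero against `G_t` and meets only `W_t - G_t`, that is `R`, where it converges
absolutely (`heatSg_time_integral`). The same oddness removes the explicit part of `K` on symmetric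
truncations, which is why the principal value exists (`setIntegral_far_eq`, `tendsto_fracFun`).

The condition `λ > 2σ` makes `x^(-1-2σ) φ(x)` integrable at the origin, which the decay of `Δ_λ^σ φ`
and the second use of Fubini both need. Continuity follows from the substitution `y = xs`, which
fixes the singularity at `s = 1`, and dominated convergence (`continuousOn_integral_nearDev`). -/

/-! ### The entire function behind `J` and `I`: recurrence, derivative, decay on the negative axis
-/

/-- The entire function `∑ w ^ k / (k! Γ(k + c))`. -/
def besselE (c w : ℝ) : ℝ := ∑' k : ℕ, w ^ k / ((k.factorial : ℝ) * Real.Gamma ((k : ℝ) + c))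

/-- From `c + 1` on, each step of the functional equation multiplies by a factor at least `1`, so
only `Γ(c)` itself can lie below `Γ(c + 1)`. -/
theorem exists_le_Gamma_nat_add {c : ℝ} (hc : 0 < c) :
    ∃ m : ℝ, 0 < m ∧ ∀ k : ℕ, m ≤ Real.Gamma ((k : ℝ) + c) := by
  have h1 : ∀ k : ℕ, Real.Gamma (c + 1) ≤ Real.Gamma ((k : ℝ) + (c + 1)) := by
    intro k
    induction k with
    | zero => simp
    | succ k ih =>
      have h : ((k + 1 : ℕ) : ℝ) + (c + 1) = ((k : ℝ) + (c + 1)) + 1 := by push_cast; ring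
      have hk : (0 : ℝ) ≤ k := k.cast_nonneg
      have h2 := Real.Gamma_add_one (s := (k : ℝ) + (c + 1)) (by positivity)
      have := Real.Gamma_pos_of_pos (show 0 < (k : ℝ) + (c + 1) by positivity)
      rw [h, h2]
      nlinarith
  refine ⟨min (Real.Gamma c) (Real.Gamma (c + 1)),
    lt_min (Real.Gamma_pos_of_pos hc) (Real.Gamma_pos_of_pos (by linarith)), fun k => ?_⟩
  cases k with
  | zero => simp
  | succ k =>
    refine (min_le_right _ _).trans ((h1 k).trans (le_of_eq ?_))
    push_cast; ring_nf

theorem summable_besselE {c : ℝ} (hc : 0 < c) (w : ℝ) :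
    Summable fun k : ℕ => w ^ k / ((k.factorial : ℝ) * Real.Gamma ((k : ℝ) + c)) := by
  obtain ⟨m, hm, h⟩ := exists_le_Gamma_nat_add hc
  refine Summable.of_norm_bounded (g := fun k : ℕ => m⁻¹ * (|w| ^ k / (k.factorial : ℝ)))
    ((Real.summable_pow_div_factorial |w|).mul_left _) fun k => ?_
  have hk := h k
  have hG : 0 < Real.Gamma ((k : ℝ) + c) := hm.trans_le hk
  have hf : (0 : ℝ) < k.factorial := by positivity
  rw [Real.norm_eq_abs, abs_div, abs_pow, abs_of_pos (mul_pos hf hG), inv_mul_eq_div, div_div]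
  gcongr

theorem hasSum_besselE {c : ℝ} (hc : 0 < c) (w : ℝ) :
    HasSum (fun k : ℕ => w ^ k / ((k.factorial : ℝ) * Real.Gamma ((k : ℝ) + c))) (besselE c w) :=
  (summable_besselE hc w).hasSum

theorem besselE_zero (c : ℝ) : besselE c 0 = (Real.Gamma c)⁻¹ := by
  rw [besselE, tsum_eq_single 0]
  · simp
  · intro k hk
    simp [hk]

/-- Writing `1/Γ(k+c) = (k+c)/Γ(k+c+1)` splits each coefficient into a `c`-part and a `k`-part; the
factor `k` cancels against `k!` and shifts the index. This is the three-term recurrence of Bessel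
functions. It yields the bounds below and the integration by parts for the Hankel transform. -/
theorem besselE_contiguous {c : ℝ} (hc : 0 < c) (w : ℝ) :
    besselE c w = c * besselE (c + 1) w + w * besselE (c + 2) w := by
  have h1 := (hasSum_besselE (c := c + 1) (by linarith) w).mul_left c
  have h2 := (hasSum_besselE (c := c + 2) (by linarith) w).mul_left w
  have h3 : HasSum (fun k : ℕ => (k : ℝ) * (w ^ k /
      ((k.factorial : ℝ) * Real.Gamma ((k : ℝ) + (c + 1))))) (w * besselE (c + 2) w) := by
    rw [← hasSum_nat_add_iff' 1]
    simp only [Finset.range_one, Finset.sum_singleton, Nat.cast_zero, zero_mul, sub_zero]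
    refine h2.congr_fun fun k => ?_
    have hG := Real.Gamma_pos_of_pos (show 0 < (k : ℝ) + (c + 2) by positivity)
    rw [Nat.factorial_succ, show ((k + 1 : ℕ) : ℝ) + (c + 1) = k + (c + 2) by push_cast; ring]
    push_cast
    field_simp
    ring
  refine (hasSum_besselE hc w).unique ((h1.add h3).congr_fun fun k => ?_)
  have hk : (0 : ℝ) < (k : ℝ) + c := by positivity
  have hG := Real.Gamma_pos_of_pos hk
  rw [show (k : ℝ) + (c + 1) = (k + c) + 1 by ring, Real.Gamma_add_one hk.ne']
  field_simp
  ring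

theorem hasDerivAt_besselE {c : ℝ} (hc : 0 < c) (w : ℝ) :
    HasDerivAt (besselE c) (besselE (c + 1) w) w := by
  obtain ⟨m, hm, h⟩ := exists_le_Gamma_nat_add hc
  set R := |w| + 1 with hR
  have hR0 : 0 < R := by positivity
  have key := hasDerivAt_tsum_of_isPreconnected
    (u := fun k : ℕ => m⁻¹ * ((k : ℝ) * (R ^ (k - 1) / (k.factorial : ℝ))))
    (g := fun (k : ℕ) (z : ℝ) => z ^ k / ((k.factorial : ℝ) * Real.Gamma ((k : ℝ) + c)))
    (g' := fun (k : ℕ) (z : ℝ) => (k * z ^ (k - 1)) / ((k.factorial : ℝ) * Real.Gamma ((k : ℝ) + c)))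
    (t := Metric.ball 0 R) (y₀ := 0) (y := w) ?_ Metric.isOpen_ball
    (convex_ball 0 R).isPreconnected ?_ ?_ (by simpa using hR0) (summable_besselE hc 0)
    (by simp [hR])
  · refine key.congr_deriv ?_
    refine HasSum.tsum_eq ?_
    rw [← hasSum_nat_add_iff' 1]
    simp only [Finset.range_one, Finset.sum_singleton, Nat.cast_zero, zero_mul, zero_div, sub_zero]
    refine (hasSum_besselE (c := c + 1) (by linarith) w).congr_fun fun k => ?_
    have hG := Real.Gamma_pos_of_pos (show 0 < (k : ℝ) + (c + 1) by positivity)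
    rw [Nat.factorial_succ, show ((k + 1 : ℕ) : ℝ) + c = k + (c + 1) by push_cast; ring]
    push_cast
    field_simp
  · refine Summable.mul_left _ ?_
    rw [← summable_nat_add_iff 1]
    refine (Real.summable_pow_div_factorial R).congr fun k => ?_
    rw [Nat.factorial_succ]
    push_cast
    field_simp
  · intro k y _
    exact (hasDerivAt_pow k y).div_const _
  · intro k y hy
    have hk := h k
    have hG : 0 < Real.Gamma ((k : ℝ) + c) := hm.trans_le hk
    have hf : (0 : ℝ) < k.factorial := by positivity
    have hy' : |y| ≤ R := by simpa using (Metric.mem_ball.mp hy).le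
    rw [Real.norm_eq_abs, abs_div, abs_mul, abs_pow, abs_of_pos (mul_pos hf hG), inv_mul_eq_div,
      Nat.abs_cast, ← mul_div_assoc, div_div]
    gcongr

theorem continuous_besselE {c : ℝ} (hc : 0 < c) : Continuous (besselE c) :=
  continuous_iff_continuousAt.mpr fun w => (hasDerivAt_besselE hc w).continuousAt

theorem hasDerivAt_besselE_neg_sq {c : ℝ} (hc : 0 < c) (z : ℝ) :
    HasDerivAt (fun z => besselE c (-(z ^ 2 / 4))) (-(z / 2) * besselE (c + 1) (-(z ^ 2 / 4))) z := by
  have h1 : HasDerivAt (fun z : ℝ => -(z ^ 2 / 4)) (-(z / 2)) z := by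
    refine (((hasDerivAt_pow 2 z).div_const 4).neg).congr_deriv ?_
    norm_num; ring
  refine ((hasDerivAt_besselE hc (-(z ^ 2 / 4))).comp z h1).congr_deriv (mul_comm _ _)

/-- With `v(z) = E_c(-z²/4)` the quantity `F` is the energy `v² + v'²` of a damped oscillator. By
the recurrence its derivative is `z E_{c+1}² (1/2 - c)`, nonpositive because `c ≥ 1/2`, so `F` is
largest at the origin. -/
theorem abs_besselE_neg_sq_le {c z : ℝ} (hc : 1 / 2 ≤ c) (hz : 0 ≤ z) :
    |besselE c (-(z ^ 2 / 4))| ≤ (Real.Gamma c)⁻¹ := by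
  have hc0 : 0 < c := by linarith
  have hG := Real.Gamma_pos_of_pos hc0
  let F : ℝ → ℝ := fun z =>
    besselE c (-(z ^ 2 / 4)) ^ 2 + z ^ 2 / 4 * besselE (c + 1) (-(z ^ 2 / 4)) ^ 2
  have hF : ∀ x, HasDerivAt F (x * besselE (c + 1) (-(x ^ 2 / 4)) ^ 2 * (1 / 2 - c)) x := by
    intro x
    have h1 := (hasDerivAt_besselE_neg_sq hc0 x).pow 2
    have h2 := (hasDerivAt_besselE_neg_sq (c := c + 1) (by linarith) x).pow 2
    have h3 := ((hasDerivAt_pow 2 x).div_const 4).mul h2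
    refine (h1.add h3).congr_deriv ?_
    have h4 := besselE_contiguous hc0 (-(x ^ 2 / 4))
    rw [show c + 1 + 1 = c + 2 by ring, h4]
    norm_num
    ring
  have hanti : AntitoneOn F (Ici 0) := by
    refine antitoneOn_of_deriv_nonpos (convex_Ici 0)
      (fun x _ => (hF x).continuousAt.continuousWithinAt)
      (fun x _ => (hF x).differentiableAt.differentiableWithinAt) fun x hx => ?_
    rw [(hF x).deriv]
    rw [interior_Ici] at hx
    have hx' : 0 < x := hx
    exact mul_nonpos_of_nonneg_of_nonpos (by positivity) (by linarith)
  have h := hanti (mem_Ici.mpr le_rfl) (mem_Ici.mpr hz) hz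
  have h0 : F 0 = ((Real.Gamma c)⁻¹) ^ 2 := by simp [F, besselE_zero]
  rw [h0] at h
  refine abs_le_of_sq_le_sq ?_ (by positivity)
  refine le_trans ?_ h
  simp only [F]
  have : 0 ≤ z ^ 2 / 4 * besselE (c + 1) (-(z ^ 2 / 4)) ^ 2 := by positivity
  linarith

/-- Solved for the top term, the recurrence reads `z² E_{c+2} = 4(c E_{c+1} - E_c)` at `-z²/4`.
Raising the parameter by two therefore pays for a factor `z²`, and the uniform bound starts the
induction. -/
theorem besselE_neg_sq_decay {c : ℝ} (hc : 1 / 2 ≤ c) (m : ℕ) :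
    ∃ C : ℝ, ∀ z : ℝ, 0 ≤ z → z ^ (2 * m) * |besselE (c + 2 * m) (-(z ^ 2 / 4))| ≤ C := by
  have step : ∀ c : ℝ, 0 < c → ∀ z : ℝ, z ^ 2 * |besselE (c + 2) (-(z ^ 2 / 4))| ≤
      4 * (c * |besselE (c + 1) (-(z ^ 2 / 4))| + |besselE c (-(z ^ 2 / 4))|) := by
    intro c hc0 z
    have h4 := besselE_contiguous hc0 (-(z ^ 2 / 4))
    have h5 : z ^ 2 * besselE (c + 2) (-(z ^ 2 / 4)) =
        4 * (c * besselE (c + 1) (-(z ^ 2 / 4)) - besselE c (-(z ^ 2 / 4))) := by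
      linear_combination 4 * h4
    rw [← abs_of_nonneg (sq_nonneg z), ← abs_mul, abs_of_nonneg (sq_nonneg z), h5, abs_mul,
      abs_of_pos (show (0 : ℝ) < 4 by norm_num)]
    gcongr
    refine (abs_sub _ _).trans (le_of_eq ?_)
    rw [abs_mul, abs_of_pos hc0]
  induction m generalizing c with
  | zero => exact ⟨(Real.Gamma c)⁻¹, fun z hz => by simpa using abs_besselE_neg_sq_le hc hz⟩
  | succ m ih =>
    obtain ⟨C, hC⟩ := ih hc
    obtain ⟨C', hC'⟩ := ih (c := c + 1) (by linarith)
    have hm : (0 : ℝ) ≤ m := m.cast_nonneg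
    refine ⟨4 * ((c + 2 * m) * C' + C), fun z hz => ?_⟩
    have h := mul_le_mul_of_nonneg_left (step (c + 2 * m) (by linarith) z) (pow_nonneg hz (2 * m))
    have h2 := mul_le_mul_of_nonneg_left (hC' z hz) (show 0 ≤ c + 2 * m by linarith)
    have h3 := hC z hz
    rw [show c + 1 + 2 * (m : ℝ) = c + 2 * m + 1 by ring] at h2
    rw [show c + 2 * ((m + 1 : ℕ) : ℝ) = c + 2 * m + 2 by push_cast; ring]
    calc _ = z ^ (2 * m) * (z ^ 2 * |besselE (c + 2 * m + 2) (-(z ^ 2 / 4))|) := by ring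
      _ ≤ _ := h
      _ ≤ _ := by linarith

/-! ### Beta integrals and Poisson's integral -/

/-- Both claims are read off from the fact that the beta density has total mass one. -/
theorem integrableOn_beta {α β : ℝ} (hα : 0 < α) (hβ : 0 < β) :
    IntegrableOn (fun x : ℝ => x ^ (α - 1) * (1 - x) ^ (β - 1)) (Ioo 0 1) ∧
      ∫ x in Ioo (0 : ℝ) 1, x ^ (α - 1) * (1 - x) ^ (β - 1) =
        Real.Gamma α * Real.Gamma β / Real.Gamma (α + β) := by
  have hb := ProbabilityTheory.beta_pos hα hβ
  have h := ProbabilityTheory.lintegral_betaPDF_eq_one hα hβ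
  rw [ProbabilityTheory.lintegral_betaPDF] at h
  have hm : Measurable fun x : ℝ =>
      1 / ProbabilityTheory.beta α β * x ^ (α - 1) * (1 - x) ^ (β - 1) := by fun_prop
  have h0 : 0 ≤ᵐ[volume.restrict (Ioo (0 : ℝ) 1)] fun x : ℝ =>
      1 / ProbabilityTheory.beta α β * x ^ (α - 1) * (1 - x) ^ (β - 1) := by
    refine ae_restrict_of_forall_mem measurableSet_Ioo fun x hx => ?_
    have h1 := Real.rpow_nonneg hx.1.le (α - 1)
    have h2 := Real.rpow_nonneg (sub_pos.mpr hx.2).le (β - 1)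
    simp only [Pi.zero_apply]
    positivity
  have hint : IntegrableOn (fun x : ℝ =>
      1 / ProbabilityTheory.beta α β * x ^ (α - 1) * (1 - x) ^ (β - 1)) (Ioo 0 1) := by
    refine ⟨hm.aestronglyMeasurable, ?_⟩
    rw [hasFiniteIntegral_iff_ofReal h0, h]
    exact ENNReal.one_lt_top
  have hval : ∫ x in Ioo (0 : ℝ) 1,
      1 / ProbabilityTheory.beta α β * x ^ (α - 1) * (1 - x) ^ (β - 1) = 1 := by
    rw [integral_eq_lintegral_of_nonneg_ae h0 hm.aestronglyMeasurable, h]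
    rfl
  simp_rw [mul_assoc] at hint hval
  constructor
  · refine IntegrableOn.congr_fun (hint.const_mul (ProbabilityTheory.beta α β)) (fun x _ => ?_) measurableSet_Ioo
    rw [← mul_assoc, mul_one_div_cancel hb.ne', one_mul]
  · rw [integral_const_mul, one_div_mul_eq_div, div_eq_one_iff_eq hb.ne'] at hval
    exact hval

theorem integrableOn_one_sub_sq_moment {a : ℝ} (ha : 0 < a) (k : ℕ) :
    IntegrableOn (fun s : ℝ => (1 - s ^ 2) ^ (a - 1) * s ^ (2 * k)) (Ioo 0 1) ∧
      ∫ s in Ioo (0 : ℝ) 1, (1 - s ^ 2) ^ (a - 1) * s ^ (2 * k) =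
        Real.Gamma (k + 1 / 2) * Real.Gamma a / (2 * Real.Gamma (k + 1 / 2 + a)) := by
  obtain ⟨h1, h2⟩ := integrableOn_beta (α := k + 1 / 2) (by positivity) ha
  -- The substitution `x = s²` is made on the whole half-line; the indicator carries the restriction
  -- to `(0, 1)`, which squaring preserves.
  let g : ℝ → ℝ := (Ioo (0 : ℝ) 1).indicator
    fun x => x ^ ((k : ℝ) + 1 / 2 - 1) * (1 - x) ^ (a - 1)
  have hg : IntegrableOn g (Ioi 0) := ((integrable_indicator_iff measurableSet_Ioo).mpr h1).integrableOn
  have hgi : ∫ x in Ioi 0, g x = ∫ x in Ioo (0 : ℝ) 1, x ^ ((k : ℝ) + 1 / 2 - 1) * (1 - x) ^ (a - 1) := by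
    rw [setIntegral_indicator measurableSet_Ioo, inter_eq_self_of_subset_right Ioo_subset_Ioi_self]
  have hcongr : ∀ s ∈ Ioi (0 : ℝ), (|(2 : ℝ)| * s ^ ((2 : ℝ) - 1)) • g (s ^ (2 : ℝ)) =
      (Ioo (0 : ℝ) 1).indicator (fun s => 2 * ((1 - s ^ 2) ^ (a - 1) * s ^ (2 * k))) s := by
    intro s hs
    have hs' : 0 < s := hs
    have hmem : s ^ (2 : ℝ) ∈ Ioo (0 : ℝ) 1 ↔ s ∈ Ioo (0 : ℝ) 1 := by
      simp only [mem_Ioo, Real.rpow_two, sq_lt_one_iff₀ hs'.le, hs', pow_pos hs' 2]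
    by_cases h : s ∈ Ioo (0 : ℝ) 1
    · simp only [g]
      rw [indicator_of_mem (hmem.mpr h), indicator_of_mem h, abs_of_pos two_pos, smul_eq_mul]
      have e1 : (s ^ (2 : ℝ)) ^ ((k : ℝ) + 1 / 2 - 1) = s ^ (2 * k) * s⁻¹ := by
        rw [← Real.rpow_mul hs'.le, ← Real.rpow_natCast, ← Real.rpow_neg_one, ← Real.rpow_add hs']
        congr 1; push_cast; ring
      rw [e1, Real.rpow_two, show (2 : ℝ) - 1 = 1 by norm_num, Real.rpow_one]
      field_simp
    · simp only [g]
      rw [indicator_of_notMem (fun h' => h (hmem.mp h')), indicator_of_notMem h, smul_zero]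
  have h3 := (integrableOn_Ioi_comp_rpow_iff g two_ne_zero).mpr hg
  have h4 := integral_comp_rpow_Ioi g (two_ne_zero (α := ℝ))
  rw [integrableOn_congr_fun hcongr measurableSet_Ioi] at h3
  rw [setIntegral_congr_fun measurableSet_Ioi hcongr, hgi, h2,
    setIntegral_indicator measurableSet_Ioo, inter_eq_self_of_subset_right Ioo_subset_Ioi_self,
    integral_const_mul] at h4
  constructor
  · have h5 : IntegrableOn (fun s : ℝ => 2 * ((1 - s ^ 2) ^ (a - 1) * s ^ (2 * k))) (Ioo 0 1) := by
      rw [IntegrableOn, integrable_indicator_iff measurableSet_Ioo, IntegrableOn,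
        Measure.restrict_restrict measurableSet_Ioo,
        inter_eq_self_of_subset_left Ioo_subset_Ioi_self] at h3
      exact h3
    refine IntegrableOn.congr_fun (h5.const_mul (1 / 2)) (fun x _ => ?_) measurableSet_Ioo
    ring
  · have hG := Real.Gamma_pos_of_pos (show 0 < (k : ℝ) + 1 / 2 + a by positivity)
    rw [eq_div_iff (by positivity)]
    rw [eq_div_iff hG.ne'] at h4
    linarith

/-- This is the duplication formula at half-integers, which matches the coefficients of `cosh` with
those of the Bessel series. -/
theorem factorial_two_mul_mul_sqrt_pi (k : ℕ) :
    ((2 * k).factorial : ℝ) * √Real.pi = 4 ^ k * (k.factorial : ℝ) * Real.Gamma (k + 1 / 2) := by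
  induction k with
  | zero => simp [Real.Gamma_one_half_eq, -one_div]
  | succ k ih =>
    have h : ((k + 1 : ℕ) : ℝ) + 1 / 2 = ((k : ℝ) + 1 / 2) + 1 := by push_cast; ring
    rw [h, Real.Gamma_add_one (by positivity), show 2 * (k + 1) = 2 * k + 1 + 1 by ring,
      Nat.factorial_succ, Nat.factorial_succ, Nat.factorial_succ]
    push_cast
    linear_combination (2 * (k : ℝ) + 1 + 1) * (2 * k + 1) * ih

/-- Poisson's integral for the modified Bessel function. -/
theorem besselE_poisson {lam : ℝ} (hlam : 0 < lam) {z : ℝ} (hz : 0 ≤ z) :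
    besselE (lam + 1 / 2) (z ^ 2 / 4) = 2 / (√Real.pi * Real.Gamma lam) *
      ∫ s in Ioo (0 : ℝ) 1, (1 - s ^ 2) ^ (lam - 1) * Real.cosh (z * s) := by
  have hG := Real.Gamma_pos_of_pos hlam
  have hpi : 0 < √Real.pi := Real.sqrt_pos.mpr Real.pi_pos
  set c := 2 / (√Real.pi * Real.Gamma lam) with hc
  have hc0 : 0 < c := by positivity
  -- The series of `cosh` is integrated term by term. All terms are nonnegative on `(0, 1)`, so
  -- summability of the norms is that of the Bessel series itself.
  let F : ℕ → ℝ → ℝ := fun k s =>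
    z ^ (2 * k) / ((2 * k).factorial : ℝ) * ((1 - s ^ 2) ^ (lam - 1) * s ^ (2 * k))
  have hF : ∀ k, IntegrableOn (F k) (Ioo 0 1) := fun k =>
    (integrableOn_one_sub_sq_moment hlam k).1.const_mul _
  have hFi : ∀ k, c * ∫ s in Ioo (0 : ℝ) 1, F k s =
      (z ^ 2 / 4) ^ k / ((k.factorial : ℝ) * Real.Gamma ((k : ℝ) + (lam + 1 / 2))) := by
    intro k
    simp only [F]
    rw [integral_const_mul, (integrableOn_one_sub_sq_moment hlam k).2, hc,
      show (k : ℝ) + (lam + 1 / 2) = k + 1 / 2 + lam by ring]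
    have h1 := Real.Gamma_pos_of_pos (show 0 < (k : ℝ) + 1 / 2 + lam by positivity)
    have h2 := Real.Gamma_pos_of_pos (show 0 < (k : ℝ) + 1 / 2 by positivity)
    have h3 := factorial_two_mul_mul_sqrt_pi k
    have h4 : ((2 * k).factorial : ℝ) = 4 ^ k * (k.factorial : ℝ) * Real.Gamma (k + 1 / 2) / √Real.pi := by
      rw [← h3]; field_simp
    rw [h4, div_pow, ← pow_mul]
    field_simp
  have hnorm : ∀ k, ∫ s in Ioo (0 : ℝ) 1, ‖F k s‖ = ∫ s in Ioo (0 : ℝ) 1, F k s := by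
    intro k
    refine setIntegral_congr_fun measurableSet_Ioo fun s hs => ?_
    have h1 : 0 ≤ 1 - s ^ 2 := by nlinarith [hs.1, hs.2]
    have h2 := Real.rpow_nonneg h1 (lam - 1)
    have h3 := hs.1
    exact Real.norm_of_nonneg (by simp only [F]; positivity)
  have hsum : Summable fun k => ∫ s in Ioo (0 : ℝ) 1, ‖F k s‖ := by
    have h := (summable_besselE (c := lam + 1 / 2) (by positivity) (z ^ 2 / 4)).mul_left c⁻¹
    refine h.congr fun k => ?_
    rw [hnorm, ← hFi, inv_mul_cancel_left₀ hc0.ne']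
  have h := (hasSum_integral_of_summable_integral_norm hF hsum).mul_left c
  simp only [hFi] at h
  rw [besselE, h.tsum_eq]
  congr 1
  refine setIntegral_congr_fun measurableSet_Ioo fun s _ => ?_
  have h1 := ((Real.hasSum_cosh (z * s)).mul_left ((1 - s ^ 2) ^ (lam - 1))).tsum_eq
  rw [← h1]
  refine tsum_congr fun k => ?_
  simp only [F]
  rw [mul_pow]
  ring

theorem besselI_eq {lam z : ℝ} :
    besselI (lam - 1 / 2) z = (z / 2) ^ (lam - 1 / 2) * besselE (lam + 1 / 2) (z ^ 2 / 4) := by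
  rw [besselI, besselE]
  congr 1
  refine tsum_congr fun k => ?_
  rw [pow_mul, div_pow, show (k : ℝ) + (lam - 1 / 2) + 1 = k + (lam + 1 / 2) by ring]
  norm_num

theorem besselJ_eq {lam z : ℝ} :
    besselJ (lam - 1 / 2) z = (z / 2) ^ (lam - 1 / 2) * besselE (lam + 1 / 2) (-(z ^ 2 / 4)) := by
  rw [besselJ, besselE]
  congr 1
  refine tsum_congr fun k => ?_
  rw [pow_mul, div_pow, show (k : ℝ) + (lam - 1 / 2) + 1 = k + (lam + 1 / 2) by ring,
    neg_pow (z ^ 2 / 4)]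
  norm_num

/-! ### The normalized Bessel function `rho` and its rate of convergence to one -/

/-- `√(2πz) e^{-z} I_{λ-1/2}(z)`, which tends to `1` at infinity. -/
def rho (lam z : ℝ) : ℝ := √(2 * Real.pi * z) * Real.exp (-z) * besselI (lam - 1 / 2) z

/-- The density in the Laplace-type representation of `rho`. -/
def rhoDensity (lam z r : ℝ) : ℝ :=
  r ^ (lam - 1) * (1 - r / 2) ^ (lam - 1) * (Real.exp (-(z * r)) + Real.exp (-(z * (2 - r))))

/-- In Poisson's integral put `s = 1 - r`, so that `1 - s² = 2r(1 - r/2)`. The factor `e^(-z)`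
cancels the growth of `cosh(z(1-r))` and leaves a Laplace integral concentrated at `r = 0`. -/
theorem rho_eq {lam z : ℝ} (hlam : 0 < lam) (hz : 0 < z) :
    rho lam z = z ^ lam / Real.Gamma lam * ∫ r in Ioo (0 : ℝ) 1, rhoDensity lam z r := by
  have hG := Real.Gamma_pos_of_pos hlam
  have hpi : 0 < √Real.pi := Real.sqrt_pos.mpr Real.pi_pos
  rw [rho, besselI_eq, besselE_poisson hlam hz.le]
  have h1 : ∫ s in Ioo (0 : ℝ) 1, (1 - s ^ 2) ^ (lam - 1) * Real.cosh (z * s) =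
      ∫ r in Ioo (0 : ℝ) 1, 2 ^ (lam - 1) * 2⁻¹ * Real.exp z * rhoDensity lam z r := by
    rw [← integral_Ioc_eq_integral_Ioo, ← integral_Ioc_eq_integral_Ioo,
      ← intervalIntegral.integral_of_le zero_le_one, ← intervalIntegral.integral_of_le zero_le_one]
    have h := intervalIntegral.integral_comp_sub_left (a := 0) (b := 1)
      (fun s : ℝ => (1 - s ^ 2) ^ (lam - 1) * Real.cosh (z * s)) 1
    simp only [sub_self, sub_zero] at h
    rw [← h]
    refine intervalIntegral.integral_congr fun r hr => ?_
    rw [uIcc_of_le zero_le_one] at hr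
    simp only [rhoDensity]
    rw [show 1 - (1 - r) ^ 2 = 2 * (r * (1 - r / 2)) by ring,
      Real.mul_rpow two_pos.le (mul_nonneg hr.1 (by linarith [hr.2])),
      Real.mul_rpow hr.1 (by linarith [hr.2]), Real.cosh_eq,
      show z * (1 - r) = z + -(z * r) by ring, show -(z + -(z * r)) = z + -(z * (2 - r)) by ring,
      Real.exp_add, Real.exp_add]
    ring
  rw [h1, integral_const_mul]
  have h2 : √(2 * Real.pi * z) = 2 ^ (1 / 2 : ℝ) * √Real.pi * z ^ (1 / 2 : ℝ) := by
    rw [Real.sqrt_mul (by positivity), Real.sqrt_mul (by positivity), Real.sqrt_eq_rpow 2,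
      Real.sqrt_eq_rpow z]
  have h3 : (z / 2) ^ (lam - 1 / 2) = z ^ lam * (z ^ (1 / 2 : ℝ))⁻¹ * (2 ^ (lam - 1 / 2))⁻¹ := by
    rw [Real.div_rpow hz.le two_pos.le, Real.rpow_sub hz]
    rfl
  have h4 : (2 : ℝ) ^ (lam - 1 / 2) = 2 ^ (lam - 1) * 2 ^ (1 / 2 : ℝ) := by
    rw [← Real.rpow_add two_pos]; congr 1; ring
  rw [h2, h3, h4, Real.exp_neg]
  have hz2 : 0 < z ^ (1 / 2 : ℝ) := Real.rpow_pos_of_pos hz _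
  have h5 : (0 : ℝ) < 2 ^ (1 / 2 : ℝ) := by positivity
  have h6 : (0 : ℝ) < 2 ^ (lam - 1) := by positivity
  field_simp

theorem rpow_le_two_rpow_abs {x : ℝ} (p : ℝ) (h1 : 1 / 2 ≤ x) (h2 : x ≤ 1) :
    x ^ p ≤ 2 ^ |p| := by
  have hx : 0 < x := by linarith
  calc x ^ p ≤ x ^ (-|p|) := Real.rpow_le_rpow_of_exponent_ge hx h2 (neg_abs_le p)
    _ = (x⁻¹) ^ |p| := by rw [Real.rpow_neg hx.le, Real.inv_rpow hx.le]
    _ ≤ 2 ^ |p| := by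
      refine Real.rpow_le_rpow (by positivity) ?_ (abs_nonneg p)
      rw [inv_le_comm₀ hx two_pos]
      linarith

/-- The base `1 - r/2` stays in `[1/2, 1]`, away from the singularity of the power; the last bound
is the mean value inequality from the point `1`. -/
theorem exists_one_sub_half_rpow_bound (a : ℝ) :
    ∃ M : ℝ, 1 ≤ M ∧ ∀ r ∈ Ioo (0 : ℝ) 1, 0 ≤ (1 - r / 2) ^ a ∧ (1 - r / 2) ^ a ≤ M ∧
      |(1 - r / 2) ^ a - 1| ≤ M * r := by
  refine ⟨max (max 1 (2 ^ |a|)) (|a| * 2 ^ |a - 1|), (le_max_left _ _).trans (le_max_left _ _),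
    fun r hr => ⟨Real.rpow_nonneg (by linarith [hr.2]) _, ?_, ?_⟩⟩
  · exact (rpow_le_two_rpow_abs a (by linarith [hr.2]) (by linarith [hr.1])).trans
      ((le_max_right _ _).trans (le_max_left _ _))
  · have h := (convex_Icc (1 / 2 : ℝ) 1).norm_image_sub_le_of_norm_hasDerivWithin_le
      (f := fun x : ℝ => x ^ a) (f' := fun x => a * x ^ (a - 1)) (C := |a| * 2 ^ |a - 1|)
      (x := 1) (y := 1 - r / 2) (fun x hx => ?_) (fun x hx => ?_) (by norm_num)
      ⟨by linarith [hr.2], by linarith [hr.1]⟩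
    · rw [Real.one_rpow, Real.norm_eq_abs, Real.norm_eq_abs,
        show |1 - r / 2 - 1| = r / 2 by rw [show 1 - r / 2 - 1 = -(r / 2) by ring, abs_neg,
          abs_of_pos (by linarith [hr.1])]] at h
      refine h.trans ?_
      have h0 : 0 ≤ |a| * 2 ^ |a - 1| := by positivity
      have := hr.1
      calc |a| * 2 ^ |a - 1| * (r / 2) ≤ |a| * 2 ^ |a - 1| * r := by gcongr; linarith
        _ ≤ _ := by gcongr; exact le_max_right _ _
    · exact (Real.hasDerivAt_rpow_const (Or.inl (by linarith [hx.1]))).hasDerivWithinAt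
    · have hx0 : 0 ≤ x := by linarith [hx.1]
      rw [Real.norm_eq_abs, abs_mul, abs_of_nonneg (Real.rpow_nonneg hx0 _)]
      gcongr
      exact rpow_le_two_rpow_abs _ hx.1 hx.2

theorem integrableOn_rpow_mul_exp {a z : ℝ} (ha : 0 < a) (hz : 0 < z) :
    IntegrableOn (fun r : ℝ => r ^ (a - 1) * Real.exp (-(z * r))) (Ioi 0) := by
  have h := integrableOn_rpow_mul_exp_neg_mul_rpow (p := 1) (s := a - 1) (b := z) (by linarith)
    one_pos hz
  simpa only [Real.rpow_one, neg_mul] using h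

/-- The comparison density is `r^(λ-1) e^(-zr)`, whose integral over the half-line is `z^(-λ) Γ(λ)`
and cancels the prefactor exactly. The error has three sources, each smaller by a factor `1/z`: the
`O(r)` deviation of `(1 - r/2)^(λ-1)` from one, the reflected exponential, and the part `r ≥ 1`
missing from the integral. -/
theorem rho_bounds {lam : ℝ} (hlam : 0 < lam) :
    ∃ C : ℝ, 1 ≤ C ∧ ∀ z : ℝ, 0 < z → 0 ≤ rho lam z ∧ rho lam z ≤ C ∧ |rho lam z - 1| ≤ C ∧
      |rho lam z - 1| ≤ C / z := by
  obtain ⟨M, hM1, hM⟩ := exists_one_sub_half_rpow_bound (lam - 1)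
  have hG := Real.Gamma_pos_of_pos hlam
  have hnn : ∀ z r : ℝ, r ∈ Ioo (0 : ℝ) 1 → 0 ≤ rhoDensity lam z r := by
    intro z r hr
    have h1 := (hM r hr).1
    have h2 := Real.rpow_nonneg hr.1.le (lam - 1)
    rw [rhoDensity]
    positivity
  have hle : ∀ z r : ℝ, 0 < z → r ∈ Ioo (0 : ℝ) 1 →
      rhoDensity lam z r ≤ 2 * M * (r ^ (lam - 1) * Real.exp (-(z * r))) := by
    intro z r hz hr
    obtain ⟨h0, h1, -⟩ := hM r hr
    have h2 := Real.rpow_nonneg hr.1.le (lam - 1)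
    have h3 : Real.exp (-(z * (2 - r))) ≤ Real.exp (-(z * r)) := by
      apply Real.exp_le_exp.mpr
      nlinarith [hr.2]
    rw [rhoDensity]
    calc r ^ (lam - 1) * (1 - r / 2) ^ (lam - 1) * (Real.exp (-(z * r)) + Real.exp (-(z * (2 - r))))
        ≤ r ^ (lam - 1) * M * (Real.exp (-(z * r)) + Real.exp (-(z * r))) := by gcongr
      _ = _ := by ring
  have hmeas : ∀ z, Measurable (rhoDensity lam z) := by
    intro z; unfold rhoDensity; fun_prop
  have hintg : ∀ z : ℝ, 0 < z → IntegrableOn (rhoDensity lam z) (Ioo 0 1) := by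
    intro z hz
    refine Integrable.mono' (((integrableOn_rpow_mul_exp hlam hz).mono_set
      Ioo_subset_Ioi_self).const_mul (2 * M)) (hmeas z).aestronglyMeasurable ?_
    refine ae_restrict_of_forall_mem measurableSet_Ioo fun r hr => ?_
    rw [Real.norm_of_nonneg (hnn z r hr)]
    exact hle z r hz hr
  have hpow : ∀ z : ℝ, 0 < z → z ^ lam * (1 / z) ^ lam = 1 := by
    intro z hz
    rw [← Real.mul_rpow hz.le (by positivity), mul_one_div_cancel hz.ne', Real.one_rpow]
  have h_nonneg : ∀ z : ℝ, 0 < z → 0 ≤ rho lam z := by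
    intro z hz
    rw [rho_eq hlam hz]
    have := setIntegral_nonneg (μ := volume) measurableSet_Ioo (hnn z)
    positivity
  have h_le : ∀ z : ℝ, 0 < z → rho lam z ≤ 2 * M := by
    intro z hz
    rw [rho_eq hlam hz]
    have h1 : ∫ r in Ioo (0 : ℝ) 1, rhoDensity lam z r ≤
        2 * M * ((1 / z) ^ lam * Real.Gamma lam) := by
      rw [← Real.integral_rpow_mul_exp_neg_mul_Ioi hlam hz, ← integral_const_mul]
      have hi := (integrableOn_rpow_mul_exp hlam hz).const_mul (2 * M)
      refine (setIntegral_mono_on (hintg z hz) (hi.mono_measure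
        (Measure.restrict_mono Ioo_subset_Ioi_self le_rfl)) measurableSet_Ioo
        fun r hr => hle z r hz hr).trans ?_
      refine setIntegral_mono_set hi ?_ Ioo_subset_Ioi_self.eventuallyLE
      refine ae_restrict_of_forall_mem measurableSet_Ioi fun r hr => ?_
      have := Real.rpow_nonneg (le_of_lt hr) (lam - 1)
      simp only [Pi.zero_apply]
      positivity
    calc z ^ lam / Real.Gamma lam * ∫ r in Ioo (0 : ℝ) 1, rhoDensity lam z r
        ≤ z ^ lam / Real.Gamma lam * (2 * M * ((1 / z) ^ lam * Real.Gamma lam)) := by gcongr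
      _ = 2 * M * (z ^ lam * (1 / z) ^ lam) := by field_simp
      _ = 2 * M := by rw [hpow z hz, mul_one]
  have h_asymp : ∀ z : ℝ, 0 < z → |rho lam z - 1| ≤ M * (lam + 2 * 2 ^ lam) / z := by
    intro z hz
    have hz2 : 0 < z / 2 := by positivity
    have e1 : rho lam z - 1 = z ^ lam / Real.Gamma lam * ∫ r in Ioi (0 : ℝ),
        ((Ioo (0 : ℝ) 1).indicator (rhoDensity lam z) r - r ^ (lam - 1) * Real.exp (-(z * r))) := by
      rw [integral_sub ((integrable_indicator_iff measurableSet_Ioo).mpr (hintg z hz)).integrableOn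
        (integrableOn_rpow_mul_exp hlam hz), setIntegral_indicator measurableSet_Ioo,
        inter_eq_self_of_subset_right Ioo_subset_Ioi_self,
        Real.integral_rpow_mul_exp_neg_mul_Ioi hlam hz, mul_sub, ← rho_eq hlam hz,
        show z ^ lam / Real.Gamma lam * ((1 / z) ^ lam * Real.Gamma lam) =
          z ^ lam * (1 / z) ^ lam by field_simp, hpow z hz]
    have hi1 := (integrableOn_rpow_mul_exp (a := lam + 1) (by linarith) hz).const_mul M
    have hi2 := (integrableOn_rpow_mul_exp hlam hz2).const_mul (M * (2 / z))
    have hb : ‖∫ r in Ioi (0 : ℝ), ((Ioo (0 : ℝ) 1).indicator (rhoDensity lam z) r -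
        r ^ (lam - 1) * Real.exp (-(z * r)))‖ ≤
        ∫ r in Ioi (0 : ℝ), (M * (r ^ (lam + 1 - 1) * Real.exp (-(z * r))) +
          M * (2 / z) * (r ^ (lam - 1) * Real.exp (-(z / 2 * r)))) := by
      refine norm_integral_le_of_norm_le (hi1.add hi2) ?_
      refine ae_restrict_of_forall_mem measurableSet_Ioi fun r hr => ?_
      have hr0 : 0 < r := hr
      have hp := Real.rpow_nonneg hr0.le (lam - 1)
      have hs : r ^ (lam + 1 - 1) = r ^ (lam - 1) * r := by
        rw [← Real.rpow_add_one hr0.ne']; congr 1; ring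
      rw [hs, Real.norm_eq_abs]
      by_cases hr1 : r ∈ Ioo (0 : ℝ) 1
      · obtain ⟨h0, h1, h2⟩ := hM r hr1
        rw [indicator_of_mem hr1, rhoDensity]
        -- For `r < 1` one has `2 - r ≥ (1 + r)/2`; half of this bound supplies `e^(-z/2) ≤ 2/z`,
        -- and the other half keeps decay in `r`.
        have h3 : Real.exp (-(z * (2 - r))) ≤ 2 / z * Real.exp (-(z / 2 * r)) := by
          have h4 : Real.exp (-(z * (2 - r))) ≤ Real.exp (-(z / 2)) * Real.exp (-(z / 2 * r)) := by
            rw [← Real.exp_add]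
            apply Real.exp_le_exp.mpr
            nlinarith [hr1.2]
          refine h4.trans ?_
          gcongr
          rw [Real.exp_neg, inv_le_comm₀ (Real.exp_pos _) (by positivity), inv_div]
          linarith [Real.add_one_le_exp (z / 2)]
        rw [show r ^ (lam - 1) * (1 - r / 2) ^ (lam - 1) * (Real.exp (-(z * r)) +
          Real.exp (-(z * (2 - r)))) - r ^ (lam - 1) * Real.exp (-(z * r)) =
          r ^ (lam - 1) * ((1 - r / 2) ^ (lam - 1) - 1) * Real.exp (-(z * r)) +
          r ^ (lam - 1) * (1 - r / 2) ^ (lam - 1) * Real.exp (-(z * (2 - r))) by ring]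
        refine (abs_add_le _ _).trans (add_le_add ?_ ?_)
        · rw [abs_mul, abs_mul, abs_of_nonneg hp, Real.abs_exp]
          calc r ^ (lam - 1) * |(1 - r / 2) ^ (lam - 1) - 1| * Real.exp (-(z * r))
              ≤ r ^ (lam - 1) * (M * r) * Real.exp (-(z * r)) := by gcongr
            _ = _ := by ring
        · rw [abs_of_nonneg (by positivity)]
          calc r ^ (lam - 1) * (1 - r / 2) ^ (lam - 1) * Real.exp (-(z * (2 - r)))
              ≤ r ^ (lam - 1) * M * (2 / z * Real.exp (-(z / 2 * r))) := by gcongr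
            _ = _ := by ring
      -- Here only the comparison density is present. Since `M r ≥ 1`, the first term of the
      -- majorant already covers it.
      · have hr2 : 1 ≤ r := by
          by_contra h
          exact hr1 ⟨hr0, not_le.mp h⟩
        rw [indicator_of_notMem hr1, zero_sub, abs_neg, abs_of_nonneg (by positivity)]
        have h3 : 1 ≤ M * r := by nlinarith
        have h4 : 0 ≤ M * (2 / z) * (r ^ (lam - 1) * Real.exp (-(z / 2 * r))) := by positivity
        have h5 : 0 ≤ r ^ (lam - 1) * Real.exp (-(z * r)) := by positivity
        nlinarith
    rw [integral_add hi1 hi2, integral_const_mul, integral_const_mul,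
      Real.integral_rpow_mul_exp_neg_mul_Ioi (by linarith) hz,
      Real.integral_rpow_mul_exp_neg_mul_Ioi hlam hz2, Real.Gamma_add_one hlam.ne',
      Real.norm_eq_abs] at hb
    rw [e1, abs_mul, abs_of_nonneg (by positivity)]
    have e2 : (1 / (z / 2)) ^ lam = 2 ^ lam * (1 / z) ^ lam := by
      rw [← Real.mul_rpow (by positivity) (by positivity)]; congr 1; field_simp
    have e3 : (1 / z) ^ (lam + 1) = (1 / z) ^ lam * (1 / z) :=
      Real.rpow_add_one (by positivity) _
    calc z ^ lam / Real.Gamma lam * |∫ r in Ioi (0 : ℝ),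
          ((Ioo (0 : ℝ) 1).indicator (rhoDensity lam z) r - r ^ (lam - 1) * Real.exp (-(z * r)))|
        ≤ z ^ lam / Real.Gamma lam * (M * ((1 / z) ^ (lam + 1) * (lam * Real.Gamma lam)) +
          M * (2 / z) * ((1 / (z / 2)) ^ lam * Real.Gamma lam)) := by gcongr
      _ = M * (lam + 2 * 2 ^ lam) / z * (z ^ lam * (1 / z) ^ lam) := by
        rw [e2, e3]; field_simp
      _ = _ := by rw [hpow z hz, mul_one]
  refine ⟨max (2 * M) (M * (lam + 2 * 2 ^ lam)), le_trans (by linarith) (le_max_left _ _),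
    fun z hz => ⟨h_nonneg z hz, (h_le z hz).trans (le_max_left _ _), ?_, ?_⟩⟩
  · refine le_trans ?_ (le_max_left _ _)
    rw [abs_le]
    constructor <;> linarith [h_nonneg z hz, h_le z hz]
  · refine (h_asymp z hz).trans ?_
    gcongr
    exact le_max_right _ _

/-! ### Comparison of the heat kernel with the Gauss–Weierstrass kernel -/

/-- The Gauss–Weierstrass kernel on the line. -/
def gaussKer (t s : ℝ) : ℝ := Real.exp (-(s ^ 2 / (4 * t))) / √(4 * Real.pi * t)

theorem gaussKer_nonneg (t s : ℝ) : 0 ≤ gaussKer t s := by unfold gaussKer; positivity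

theorem gaussKer_neg (t s : ℝ) : gaussKer t (-s) = gaussKer t s := by simp [gaussKer]

theorem integrable_gaussKer {t : ℝ} (ht : 0 < t) (x : ℝ) :
    Integrable fun y => gaussKer t (x - y) := by
  have h := ((integrable_exp_neg_mul_sq (b := 1 / (4 * t)) (by positivity)).comp_sub_left x).div_const
    √(4 * Real.pi * t)
  refine h.congr (Eventually.of_forall fun y => ?_)
  simp only [gaussKer]
  congr 2; ring

theorem integral_gaussKer {t : ℝ} (ht : 0 < t) (x : ℝ) : ∫ y, gaussKer t (x - y) = 1 := by
  rw [integral_sub_left_eq_self (gaussKer t)]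
  simp only [gaussKer]
  rw [integral_div, div_eq_one_iff_eq (by positivity)]
  have h := integral_gaussian (1 / (4 * t))
  rw [show Real.pi / (1 / (4 * t)) = 4 * Real.pi * t by field_simp] at h
  rw [← h]
  congr 1; ext s; congr 1; ring

/-- Half of the Gaussian exponent absorbs `s²` through `u e^(-u) ≤ 1`, where `u = s²/(8t)`; the
other half is a Gaussian at time `2t`. -/
theorem sq_mul_gaussKer_le {t : ℝ} (ht : 0 < t) (s : ℝ) :
    s ^ 2 * gaussKer t s ≤ 16 * t * gaussKer (2 * t) s := by
  have h1 : √(4 * Real.pi * (2 * t)) = √2 * √(4 * Real.pi * t) := by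
    rw [← Real.sqrt_mul (by norm_num)]; congr 1; ring
  have h2 : √2 ≤ 2 := by rw [Real.sqrt_le_left] <;> norm_num
  have h3 : 0 < √(4 * Real.pi * t) := by positivity
  simp only [gaussKer]
  rw [h1]
  obtain ⟨u, hu⟩ : ∃ u, u = s ^ 2 / (8 * t) := ⟨_, rfl⟩
  have hs : s ^ 2 = 8 * t * u := by rw [hu]; field_simp
  have e1 : -(s ^ 2 / (4 * t)) = -u + -u := by rw [hu]; field_simp; ring
  have e2 : -(s ^ 2 / (4 * (2 * t))) = -u := by rw [hu]; field_simp; ring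
  rw [e1, e2, Real.exp_add, hs]
  have h4 : u * Real.exp (-u) ≤ 1 := by
    have := Real.add_one_le_exp u
    rw [Real.exp_neg, ← div_eq_mul_inv, div_le_one (Real.exp_pos _)]
    linarith
  have h5 := Real.exp_pos (-u)
  have h6 : 0 < √2 := by positivity
  rw [mul_div_assoc', mul_div_assoc', div_le_div_iff₀ h3 (by positivity)]
  calc 8 * t * u * (Real.exp (-u) * Real.exp (-u)) * (√2 * √(4 * Real.pi * t))
      = (u * Real.exp (-u)) * √2 * (8 * t * Real.exp (-u) * √(4 * Real.pi * t)) := by ring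
    _ ≤ 1 * 2 * (8 * t * Real.exp (-u) * √(4 * Real.pi * t)) := by gcongr
    _ = _ := by ring

/-- The factor `e^(-z)` in `rho`, at `z = xy/(2t)`, is exactly what is left over when the square in
the exponent is completed. -/
theorem heatKernel_eq (lam : ℝ) {t x y : ℝ} (ht : 0 < t) (hx : 0 < x) (hy : 0 < y) :
    heatKernel lam t x y = gaussKer t (x - y) * rho lam (x * y / (2 * t)) := by
  have hxy : 0 < x * y := by positivity
  rw [heatKernel, gaussKer, rho]
  have h1 : √(2 * Real.pi * (x * y / (2 * t))) = √(4 * Real.pi * t) * √(x * y) / (2 * t) := by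
    rw [show 2 * Real.pi * (x * y / (2 * t)) = (4 * Real.pi * t) * (x * y) / (2 * t) ^ 2 by
      field_simp; ring, Real.sqrt_div (by positivity), Real.sqrt_sq (by positivity),
      Real.sqrt_mul (by positivity)]
  have h2 : Real.exp (-(x ^ 2 + y ^ 2) / (4 * t)) =
      Real.exp (-((x - y) ^ 2 / (4 * t))) * Real.exp (-(x * y / (2 * t))) := by
    rw [← Real.exp_add]; congr 1; field_simp; ring
  rw [h1, h2]
  have h3 : 0 < √(4 * Real.pi * t) := by positivity
  field_simp

theorem heatKernel_nonneg {lam t x y : ℝ} (hlam : 0 < lam) (ht : 0 < t) (hx : 0 < x) (hy : 0 < y) :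
    0 ≤ heatKernel lam t x y := by
  obtain ⟨C, -, hC⟩ := rho_bounds hlam
  rw [heatKernel_eq lam ht hx hy]
  exact mul_nonneg (gaussKer_nonneg _ _) (hC _ (by positivity)).1

theorem heatKernel_symm (lam t x y : ℝ) : heatKernel lam t x y = heatKernel lam t y x := by
  rw [heatKernel, heatKernel, mul_comm x y, add_comm (x ^ 2)]

theorem heatKernel_le {lam : ℝ} (hlam : 0 < lam) :
    ∃ C : ℝ, 1 ≤ C ∧ ∀ t x y : ℝ, 0 < t → 0 < x → 0 < y →
      heatKernel lam t x y ≤ C * gaussKer t (x - y) := by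
  obtain ⟨C, hC1, hC⟩ := rho_bounds hlam
  refine ⟨C, hC1, fun t x y ht hx hy => ?_⟩
  rw [heatKernel_eq lam ht hx hy, mul_comm C]
  exact mul_le_mul_of_nonneg_left (hC _ (by positivity)).2.1 (gaussKer_nonneg _ _)

theorem measurable_besselI {lam : ℝ} (hlam : 0 < lam) : Measurable (besselI (lam - 1 / 2)) := by
  have h : besselI (lam - 1 / 2) =
      fun z => (z / 2) ^ (lam - 1 / 2) * besselE (lam + 1 / 2) (z ^ 2 / 4) := by
    ext z; exact besselI_eq
  rw [h]
  have := (continuous_besselE (c := lam + 1 / 2) (by positivity)).measurable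
  fun_prop

theorem measurable_heatKernel {lam : ℝ} (hlam : 0 < lam) :
    Measurable fun p : (ℝ × ℝ) × ℝ => heatKernel lam p.1.1 p.1.2 p.2 := by
  have := measurable_besselI hlam
  unfold heatKernel
  fun_prop

theorem measurable_gaussKer : Measurable fun p : ℝ × ℝ => gaussKer p.1 p.2 := by
  unfold gaussKer
  fun_prop

/-! ### Integrals in time, and the size of `fracKernel` and of its non-Gaussian part -/

/-- The inversion `t ↦ 1/t` turns this into Euler's integral for `Γ(a)`. -/
theorem integrableOn_rpow_mul_exp_inv {a b : ℝ} (ha : 0 < a) (hb : 0 < b) :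
    IntegrableOn (fun t : ℝ => t ^ (-1 - a) * Real.exp (-(b / t))) (Ioi 0) ∧
      ∫ t in Ioi (0 : ℝ), t ^ (-1 - a) * Real.exp (-(b / t)) = b ^ (-a) * Real.Gamma a := by
  let g : ℝ → ℝ := fun y => y ^ (a - 1) * Real.exp (-(b * y))
  have hcongr : ∀ t ∈ Ioi (0 : ℝ), (|(-1 : ℝ)| * t ^ ((-1 : ℝ) - 1)) • g (t ^ (-1 : ℝ)) =
      t ^ (-1 - a) * Real.exp (-(b / t)) := by
    intro t ht
    have ht' : 0 < t := ht
    simp only [g, smul_eq_mul]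
    rw [← Real.rpow_mul ht'.le, abs_neg, abs_one, one_mul, ← mul_assoc, ← Real.rpow_add ht',
      Real.rpow_neg_one, div_eq_mul_inv]
    congr 2; ring
  have h1 := (integrableOn_Ioi_comp_rpow_iff g (p := -1) (by norm_num)).mpr
    (integrableOn_rpow_mul_exp ha hb)
  have h2 := integral_comp_rpow_Ioi g (p := -1) (by norm_num)
  rw [integrableOn_congr_fun hcongr measurableSet_Ioi] at h1
  rw [setIntegral_congr_fun measurableSet_Ioi hcongr,
    Real.integral_rpow_mul_exp_neg_mul_Ioi ha hb] at h2
  refine ⟨h1, h2.trans ?_⟩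
  rw [one_div, Real.inv_rpow hb.le, Real.rpow_neg hb.le]

/-- The constant in the time integral of the Gauss–Weierstrass kernel. -/
def gaussConst (a : ℝ) : ℝ := 4 ^ a * Real.Gamma a / √(4 * Real.pi)

theorem gaussConst_pos {a : ℝ} (ha : 0 < a) : 0 < gaussConst a := by
  have := Real.Gamma_pos_of_pos ha
  unfold gaussConst; positivity

/-- Two exponents matter later: `a = σ + 1/2` produces the singularity `|s|^(-1-2σ)` of the kernel,
and `a = 1/2` the milder `|s|⁻¹` of the remainder. -/
theorem integrableOn_gaussKer_mul_rpow {a s : ℝ} (ha : 0 < a) (hs : s ≠ 0) :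
    IntegrableOn (fun t : ℝ => gaussKer t s * t ^ (-1 / 2 - a)) (Ioi 0) ∧
      ∫ t in Ioi (0 : ℝ), gaussKer t s * t ^ (-1 / 2 - a) = gaussConst a * |s| ^ (-(2 * a)) := by
  have hb : 0 < s ^ 2 / 4 := by positivity
  obtain ⟨h1, h2⟩ := integrableOn_rpow_mul_exp_inv ha hb
  have hcongr : ∀ t ∈ Ioi (0 : ℝ), gaussKer t s * t ^ (-1 / 2 - a) =
      (√(4 * Real.pi))⁻¹ * (t ^ (-1 - a) * Real.exp (-(s ^ 2 / 4 / t))) := by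
    intro t ht
    have ht' : 0 < t := ht
    rw [gaussKer, Real.sqrt_mul (by positivity), show -1 / 2 - a = (-1 - a) + 1 / 2 by ring,
      Real.rpow_add ht', ← Real.sqrt_eq_rpow, div_div]
    have : 0 < √t := by positivity
    field_simp
  constructor
  · rw [integrableOn_congr_fun hcongr measurableSet_Ioi]
    exact h1.const_mul _
  · rw [setIntegral_congr_fun measurableSet_Ioi hcongr, integral_const_mul, h2, gaussConst,
      ← sq_abs, Real.div_rpow (by positivity) (by norm_num), ← Real.rpow_natCast,
      ← Real.rpow_mul (abs_nonneg _), Real.rpow_neg (show (0 : ℝ) ≤ 4 by norm_num)]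
    have : (0 : ℝ) < 4 ^ a := by positivity
    rw [show ((2 : ℕ) : ℝ) * -a = -(2 * a) by push_cast; ring]
    field_simp

theorem neg_Gamma_neg_pos {σ : ℝ} (hσ0 : 0 < σ) (hσ1 : σ < 1) : 0 < -Real.Gamma (-σ) := by
  have h1 := Real.Gamma_add_one (s := -σ) (by linarith)
  have h2 := Real.Gamma_pos_of_pos (show 0 < -σ + 1 by linarith)
  nlinarith

theorem integrableOn_min_div_rpow {σ a : ℝ} (hσ0 : 0 < σ) (hσ1 : σ < 1) (ha : 0 < a) :
    IntegrableOn (fun t : ℝ => min 1 (t / a) / t ^ (1 + σ)) (Ioi 0) ∧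
      ∫ t in Ioi (0 : ℝ), min 1 (t / a) / t ^ (1 + σ) = (1 / (1 - σ) + 1 / σ) * a ^ (-σ) := by
  have e1 : ∀ t ∈ Ioc 0 a, min 1 (t / a) / t ^ (1 + σ) = a⁻¹ * t ^ (-σ) := by
    intro t ht
    rw [min_eq_right ((div_le_one ha).mpr ht.2), Real.rpow_add ht.1, Real.rpow_one,
      Real.rpow_neg ht.1.le]
    have := ht.1
    have := Real.rpow_pos_of_pos ht.1 σ
    field_simp
  have e2 : ∀ t ∈ Ioi a, min 1 (t / a) / t ^ (1 + σ) = t ^ (-(1 + σ)) := by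
    intro t ht
    have ht' : a < t := ht
    rw [min_eq_left ((one_le_div ha).mpr ht'.le), Real.rpow_neg (ha.trans ht').le, one_div]
  have h1 : IntegrableOn (fun t : ℝ => min 1 (t / a) / t ^ (1 + σ)) (Ioc 0 a) := by
    rw [integrableOn_congr_fun e1 measurableSet_Ioc]
    refine Integrable.const_mul ?_ _
    rw [← IntegrableOn, ← intervalIntegrable_iff_integrableOn_Ioc_of_le ha.le]
    exact intervalIntegral.intervalIntegrable_rpow' (by linarith)
  have h2 : IntegrableOn (fun t : ℝ => min 1 (t / a) / t ^ (1 + σ)) (Ioi a) := by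
    rw [integrableOn_congr_fun e2 measurableSet_Ioi]
    exact integrableOn_Ioi_rpow_of_lt (by linarith) ha
  rw [← Ioc_union_Ioi_eq_Ioi ha.le]
  refine ⟨h1.union h2, ?_⟩
  rw [setIntegral_union (Ioc_disjoint_Ioi le_rfl) measurableSet_Ioi h1 h2,
    setIntegral_congr_fun measurableSet_Ioc e1, setIntegral_congr_fun measurableSet_Ioi e2,
    integral_const_mul, ← intervalIntegral.integral_of_le ha.le,
    integral_rpow (Or.inl (by linarith)), integral_Ioi_rpow_of_lt (by linarith) ha,
    Real.zero_rpow (by linarith), Real.rpow_add_one ha.ne', show -(1 + σ) + 1 = -σ by ring]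
  have h3 : -σ + 1 ≠ 0 := by linarith
  have h4 : 1 - σ ≠ 0 := by linarith
  field_simp
  ring

theorem gaussKer_div_rpow {t s σ : ℝ} (ht : 0 < t) :
    gaussKer t s / t ^ (1 + σ) = gaussKer t s * t ^ (-1 / 2 - (σ + 1 / 2)) := by
  rw [div_eq_mul_inv, ← Real.rpow_neg ht.le]; congr 2; ring

theorem measurable_heatKernel_time {lam : ℝ} (hlam : 0 < lam) (x y : ℝ) :
    Measurable fun t => heatKernel lam t x y :=
  (measurable_heatKernel hlam).comp (g := fun p : (ℝ × ℝ) × ℝ => heatKernel lam p.1.1 p.1.2 p.2)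
    (f := fun t : ℝ => ((t, x), y)) (by fun_prop)

theorem measurable_heatKernel_space {lam : ℝ} (hlam : 0 < lam) (t x : ℝ) :
    Measurable fun y => heatKernel lam t x y :=
  (measurable_heatKernel hlam).comp (g := fun p : (ℝ × ℝ) × ℝ => heatKernel lam p.1.1 p.1.2 p.2)
    (f := fun y : ℝ => ((t, x), y)) (by fun_prop)

theorem measurable_gaussKer_time (s : ℝ) : Measurable fun t => gaussKer t s :=
  measurable_gaussKer.comp (g := fun p : ℝ × ℝ => gaussKer p.1 p.2) (f := fun t : ℝ => (t, s))
    (by fun_prop)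

/-- Bounds for the time integral of the heat kernel against `t ^ (-1-σ)`. -/
theorem heatKernel_time_integral {lam σ : ℝ} (hlam : 0 < lam) (hσ0 : 0 < σ) :
    (∀ x y : ℝ, 0 < x → 0 < y → x ≠ y →
      IntegrableOn (fun t => heatKernel lam t x y / t ^ (1 + σ)) (Ioi 0)) ∧
    ∃ C : ℝ, 0 < C ∧ ∀ x y : ℝ, 0 < x → 0 < y → x ≠ y →
      ∫ t in Ioi (0 : ℝ), heatKernel lam t x y / t ^ (1 + σ) ≤ C * |x - y| ^ (-(1 + 2 * σ)) := by
  obtain ⟨C, hC1, hC⟩ := heatKernel_le hlam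
  have hle : ∀ x y : ℝ, 0 < x → 0 < y → ∀ t ∈ Ioi (0 : ℝ), heatKernel lam t x y / t ^ (1 + σ) ≤
      C * (gaussKer t (x - y) * t ^ (-1 / 2 - (σ + 1 / 2))) := by
    intro x y hx hy t ht
    rw [← gaussKer_div_rpow ht, ← mul_div_assoc]
    have := Real.rpow_pos_of_pos ht (1 + σ)
    gcongr
    exact hC t x y ht hx hy
  have hnn : ∀ x y : ℝ, 0 < x → 0 < y → ∀ t ∈ Ioi (0 : ℝ),
      0 ≤ heatKernel lam t x y / t ^ (1 + σ) := fun x y hx hy t ht =>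
    div_nonneg (heatKernel_nonneg hlam ht hx hy) (Real.rpow_nonneg (le_of_lt ht) _)
  have hi : ∀ x y : ℝ, 0 < x → 0 < y → x ≠ y →
      IntegrableOn (fun t => heatKernel lam t x y / t ^ (1 + σ)) (Ioi 0) := by
    intro x y hx hy hxy
    have h := integrableOn_gaussKer_mul_rpow (a := σ + 1 / 2) (by positivity) (sub_ne_zero.mpr hxy)
    refine Integrable.mono' (h.1.const_mul C) ?_ ?_
    · have := measurable_heatKernel_time hlam x y
      exact Measurable.aestronglyMeasurable (by fun_prop)
    · refine ae_restrict_of_forall_mem measurableSet_Ioi fun t ht => ?_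
      rw [Real.norm_of_nonneg (hnn x y hx hy t ht)]
      exact hle x y hx hy t ht
  refine ⟨hi, C * gaussConst (σ + 1 / 2), by have := gaussConst_pos (a := σ + 1 / 2) (by positivity); positivity,
    fun x y hx hy hxy => ?_⟩
  have h := integrableOn_gaussKer_mul_rpow (a := σ + 1 / 2) (by positivity) (sub_ne_zero.mpr hxy)
  calc _ ≤ ∫ t in Ioi (0 : ℝ), C * (gaussKer t (x - y) * t ^ (-1 / 2 - (σ + 1 / 2))) :=
        setIntegral_mono_on (hi x y hx hy hxy) (h.1.const_mul C) measurableSet_Ioi (hle x y hx hy)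
    _ = _ := by rw [integral_const_mul, h.2, show 2 * (σ + 1 / 2) = 1 + 2 * σ by ring, mul_assoc]

theorem fracKernel_nonneg {lam σ x y : ℝ} (hlam : 0 < lam) (hσ0 : 0 < σ) (hσ1 : σ < 1) (hx : 0 < x)
    (hy : 0 < y) : 0 ≤ fracKernel lam σ x y := by
  have := neg_Gamma_neg_pos hσ0 hσ1
  have h : 0 ≤ ∫ t in Ioi (0 : ℝ), heatKernel lam t x y / t ^ (1 + σ) :=
    setIntegral_nonneg measurableSet_Ioi fun t ht =>
      div_nonneg (heatKernel_nonneg hlam ht hx hy) (Real.rpow_nonneg (le_of_lt ht) _)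
  unfold fracKernel
  positivity

theorem exists_fracKernel_le {lam σ : ℝ} (hlam : 0 < lam) (hσ0 : 0 < σ) (hσ1 : σ < 1) :
    ∃ C : ℝ, 0 < C ∧ ∀ x y : ℝ, 0 < x → 0 < y → x ≠ y →
      fracKernel lam σ x y ≤ C * |x - y| ^ (-(1 + 2 * σ)) := by
  obtain ⟨-, C, hC0, hC⟩ := heatKernel_time_integral hlam hσ0
  have := neg_Gamma_neg_pos hσ0 hσ1
  refine ⟨1 / -Real.Gamma (-σ) * C, by positivity, fun x y hx hy hxy => ?_⟩
  rw [fracKernel, mul_assoc]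
  gcongr
  exact hC x y hx hy hxy

/-- The bounds `|ρ(z) - 1| ≤ C` and `|ρ(z) - 1| ≤ C/z` interpolate to `C z^(-σ)`, because `0 < σ <
1`. At `z = xy/(2t)` this supplies a factor `t^σ` that lowers the weight `t^(-1-σ)` to `t⁻¹`. -/
theorem exists_heatKernel_sub_gaussKer_le {lam σ : ℝ} (hlam : 0 < lam) (hσ0 : 0 < σ) (hσ1 : σ < 1) :
    ∃ C : ℝ, 0 < C ∧ ∀ t x y : ℝ, 0 < t → 0 < x → 0 < y →
      |heatKernel lam t x y - gaussKer t (x - y)| / t ^ (1 + σ) ≤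
        C * (x * y) ^ (-σ) * (gaussKer t (x - y) * t ^ (-1 / 2 - (1 / 2 : ℝ))) := by
  obtain ⟨C, hC1, hC⟩ := rho_bounds hlam
  refine ⟨C * 2 ^ σ, by positivity, fun t x y ht hx hy => ?_⟩
  have hxy : 0 < x * y := by positivity
  set z := x * y / (2 * t) with hz
  have hz0 : 0 < z := by positivity
  obtain ⟨-, -, h1, h2⟩ := hC z hz0
  have h3 : |rho lam z - 1| ≤ C * z ^ (-σ) := by
    rcases le_total z 1 with h | h
    · refine h1.trans (le_mul_of_one_le_right (by linarith) ?_)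
      exact Real.one_le_rpow_of_pos_of_le_one_of_nonpos hz0 h (by linarith)
    · refine h2.trans ?_
      rw [div_eq_mul_inv, ← Real.rpow_neg_one]
      gcongr
  have h4 : z ^ (-σ) = (x * y) ^ (-σ) * 2 ^ σ * t ^ σ := by
    rw [hz, Real.div_rpow hxy.le (by positivity), Real.mul_rpow two_pos.le ht.le,
      Real.rpow_neg two_pos.le, Real.rpow_neg ht.le]
    field_simp
  have h5 : t ^ (-1 / 2 - (1 / 2 : ℝ)) = t ^ σ / t ^ (1 + σ) := by
    rw [← Real.rpow_sub ht]; congr 1; ring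
  have h6 := Real.rpow_pos_of_pos ht (1 + σ)
  have hg := gaussKer_nonneg t (x - y)
  rw [heatKernel_eq lam ht hx hy, ← hz, show gaussKer t (x - y) * rho lam z - gaussKer t (x - y) =
    gaussKer t (x - y) * (rho lam z - 1) by ring, abs_mul, abs_of_nonneg hg, h5]
  calc gaussKer t (x - y) * |rho lam z - 1| / t ^ (1 + σ)
      ≤ gaussKer t (x - y) * (C * z ^ (-σ)) / t ^ (1 + σ) := by gcongr
    _ = _ := by rw [h4]; ring

theorem heatKernel_sub_gaussKer_time_integral {lam σ : ℝ} (hlam : 0 < lam) (hσ0 : 0 < σ)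
    (hσ1 : σ < 1) :
    (∀ x y : ℝ, 0 < x → 0 < y → x ≠ y →
      IntegrableOn (fun t => (heatKernel lam t x y - gaussKer t (x - y)) / t ^ (1 + σ)) (Ioi 0)) ∧
    ∃ C : ℝ, 0 < C ∧ ∀ x y : ℝ, 0 < x → 0 < y → x ≠ y →
      ∫ t in Ioi (0 : ℝ), |heatKernel lam t x y - gaussKer t (x - y)| / t ^ (1 + σ) ≤
        C * ((x * y) ^ (-σ) * |x - y|⁻¹) := by
  obtain ⟨C, hC1, hC⟩ := exists_heatKernel_sub_gaussKer_le hlam hσ0 hσ1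
  have hi : ∀ x y : ℝ, 0 < x → 0 < y → x ≠ y →
      IntegrableOn (fun t => (heatKernel lam t x y - gaussKer t (x - y)) / t ^ (1 + σ)) (Ioi 0) := by
    intro x y hx hy hxy
    have h := integrableOn_gaussKer_mul_rpow (a := 1 / 2) (by positivity) (sub_ne_zero.mpr hxy)
    refine Integrable.mono' (h.1.const_mul (C * (x * y) ^ (-σ))) ?_ ?_
    · have := measurable_heatKernel_time hlam x y
      have := measurable_gaussKer_time (x - y)
      exact Measurable.aestronglyMeasurable (by fun_prop)
    · refine ae_restrict_of_forall_mem measurableSet_Ioi fun t ht => ?_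
      rw [Real.norm_eq_abs, abs_div, abs_of_nonneg (Real.rpow_nonneg (le_of_lt ht) (1 + σ))]
      exact hC t x y ht hx hy
  refine ⟨hi, C * gaussConst (1 / 2), by have := gaussConst_pos (a := 1 / 2) (by positivity); positivity,
    fun x y hx hy hxy => ?_⟩
  have h := integrableOn_gaussKer_mul_rpow (a := 1 / 2) (by positivity) (sub_ne_zero.mpr hxy)
  have hi' : IntegrableOn (fun t => |heatKernel lam t x y - gaussKer t (x - y)| / t ^ (1 + σ)) (Ioi 0) := by
    refine IntegrableOn.congr_fun (hi x y hx hy hxy).abs (fun t ht => ?_) measurableSet_Ioi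
    rw [abs_div, abs_of_nonneg (Real.rpow_nonneg (le_of_lt ht) (1 + σ))]
  calc _ ≤ ∫ t in Ioi (0 : ℝ), C * (x * y) ^ (-σ) * (gaussKer t (x - y) * t ^ (-1 / 2 - (1 / 2 : ℝ))) :=
        setIntegral_mono_on hi' (h.1.const_mul _) measurableSet_Ioi fun t ht => hC t x y ht hx hy
    _ = _ := by
      rw [integral_const_mul, h.2, show -(2 * (1 / 2 : ℝ)) = -1 by ring, Real.rpow_neg_one]; ring

/-- The part of `fracKernel` that is left after the Gaussian part is removed. -/
def remKernel (lam σ x y : ℝ) : ℝ :=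
  1 / (-Real.Gamma (-σ)) *
    ∫ t in Ioi (0 : ℝ), (heatKernel lam t x y - gaussKer t (x - y)) / t ^ (1 + σ)

/-- The first summand depends on `|x - y|` only, so it drops out against functions odd about `x`;
this is how first-order terms become harmless. -/
theorem fracKernel_eq_add_remKernel {lam σ x y : ℝ} (hlam : 0 < lam) (hσ0 : 0 < σ) (hσ1 : σ < 1)
    (hx : 0 < x) (hy : 0 < y) (hxy : x ≠ y) :
    fracKernel lam σ x y = 1 / (-Real.Gamma (-σ)) * gaussConst (σ + 1 / 2) *
      |x - y| ^ (-(1 + 2 * σ)) + remKernel lam σ x y := by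
  have h := integrableOn_gaussKer_mul_rpow (a := σ + 1 / 2) (by positivity) (sub_ne_zero.mpr hxy)
  have hr := (heatKernel_sub_gaussKer_time_integral hlam hσ0 hσ1).1 x y hx hy hxy
  rw [fracKernel, remKernel, mul_assoc, ← mul_add]
  congr 1
  rw [show -(1 + 2 * σ) = -(2 * (σ + 1 / 2)) by ring, ← h.2, ← integral_add h.1 hr]
  refine setIntegral_congr_fun measurableSet_Ioi fun t ht => ?_
  rw [← gaussKer_div_rpow ht]
  ring

/-! ### The deviation of `W_t 1` from one, and the size of `fracB` -/

theorem integrableOn_heatKernel {lam t x : ℝ} (hlam : 0 < lam) (ht : 0 < t) (hx : 0 < x) :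
    IntegrableOn (fun y => heatKernel lam t x y) (Ioi 0) := by
  obtain ⟨C, -, hC⟩ := heatKernel_le hlam
  refine Integrable.mono' ((integrable_gaussKer ht x).integrableOn.const_mul C)
    (measurable_heatKernel_space hlam t x).aestronglyMeasurable ?_
  refine ae_restrict_of_forall_mem measurableSet_Ioi fun y hy => ?_
  rw [Real.norm_of_nonneg (heatKernel_nonneg hlam ht hx hy)]
  exact hC t x y ht hx hy

/-- One is the integral of the Gaussian over the whole line, so the defect is an integral over the
line of the kernel, extended by zero, minus the Gaussian. The constant bound uses that `ρ` is
bounded. The bound by `t/x²` uses the rate `|ρ - 1| ≤ C/z` for `y ≥ x/2` and Gaussian decay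
elsewhere. -/
theorem exists_abs_heatOne_sub_one_le {lam : ℝ} (hlam : 0 < lam) :
    ∃ C : ℝ, 0 < C ∧ ∀ t x : ℝ, 0 < t → 0 < x →
      |heatOne lam t x - 1| ≤ C * min 1 (t / x ^ 2) := by
  obtain ⟨C, hC1, hC⟩ := rho_bounds hlam
  -- The constant is `4C(1 + 16)`, the total mass of the majorant in `hb2` apart from the factor
  -- `t/x²`.
  refine ⟨68 * C, by positivity, fun t x ht hx => ?_⟩
  have e1 : heatOne lam t x - 1 = ∫ y, ((Ioi (0 : ℝ)).indicator (fun y => heatKernel lam t x y) y -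
      gaussKer t (x - y)) := by
    rw [integral_sub ((integrable_indicator_iff measurableSet_Ioi).mpr
      (integrableOn_heatKernel hlam ht hx)) (integrable_gaussKer ht x),
      integral_indicator measurableSet_Ioi, integral_gaussKer ht, heatOne]
  have hg := fun s => gaussKer_nonneg t s
  have hb1 : ∀ y : ℝ, |(Ioi (0 : ℝ)).indicator (fun y => heatKernel lam t x y) y -
      gaussKer t (x - y)| ≤ C * gaussKer t (x - y) := by
    intro y
    by_cases hy : y ∈ Ioi (0 : ℝ)
    · have hz : 0 < x * y / (2 * t) := by have : 0 < y := hy; positivity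
      rw [indicator_of_mem hy, heatKernel_eq lam ht hx hy,
        ← mul_sub_one, abs_mul, abs_of_nonneg (hg _), mul_comm]
      exact mul_le_mul_of_nonneg_right (hC _ hz).2.2.1 (hg _)
    · rw [indicator_of_notMem hy, zero_sub, abs_neg, abs_of_nonneg (hg _)]
      exact le_mul_of_one_le_left (hg _) hC1
  have hb2 : ∀ y : ℝ, |(Ioi (0 : ℝ)).indicator (fun y => heatKernel lam t x y) y -
      gaussKer t (x - y)| ≤ 4 * C / x ^ 2 * (t * gaussKer t (x - y) +
        16 * t * gaussKer (2 * t) (x - y)) := by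
    intro y
    have hs := sq_mul_gaussKer_le ht (x - y)
    -- This serves all `y < x/2`, negative `y` included, where the distance to `x` exceeds `x/2`.
    have hfar : x ^ 2 ≤ 4 * (x - y) ^ 2 → |(Ioi (0 : ℝ)).indicator (fun y => heatKernel lam t x y) y -
      gaussKer t (x - y)| ≤ 4 * C / x ^ 2 * (t * gaussKer t (x - y) +
        16 * t * gaussKer (2 * t) (x - y)) := by
      intro h
      refine (hb1 y).trans ?_
      rw [div_mul_eq_mul_div, le_div_iff₀ (by positivity)]
      have h1 : 0 ≤ t * gaussKer t (x - y) := mul_nonneg ht.le (hg _)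
      calc C * gaussKer t (x - y) * x ^ 2 ≤ C * gaussKer t (x - y) * (4 * (x - y) ^ 2) := by
            have := hg (x - y)
            gcongr
        _ = 4 * C * ((x - y) ^ 2 * gaussKer t (x - y)) := by ring
        _ ≤ 4 * C * (t * gaussKer t (x - y) + 16 * t * gaussKer (2 * t) (x - y)) := by
          gcongr; linarith
    by_cases hy : x / 2 ≤ y
    · have hy0 : 0 < y := by linarith
      have hz : 0 < x * y / (2 * t) := by positivity
      rw [indicator_of_mem (mem_Ioi.mpr hy0), heatKernel_eq lam ht hx hy0,
        ← mul_sub_one, abs_mul, abs_of_nonneg (hg _)]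
      have h1 : |rho lam (x * y / (2 * t)) - 1| ≤ 4 * C / x ^ 2 * t := by
        refine (hC _ hz).2.2.2.trans ?_
        rw [div_div_eq_mul_div, div_mul_eq_mul_div, div_le_div_iff₀ (by positivity) (by positivity)]
        have : x ^ 2 ≤ 2 * (x * y) := by nlinarith
        calc C * (2 * t) * x ^ 2 ≤ C * (2 * t) * (2 * (x * y)) := by gcongr
          _ = _ := by ring
      have h2 := gaussKer_nonneg (2 * t) (x - y)
      calc gaussKer t (x - y) * |rho lam (x * y / (2 * t)) - 1|
          ≤ gaussKer t (x - y) * (4 * C / x ^ 2 * t) := mul_le_mul_of_nonneg_left h1 (hg _)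
        _ = 4 * C / x ^ 2 * (t * gaussKer t (x - y) + 0) := by ring
        _ ≤ _ := by gcongr; positivity
    · exact hfar (by nlinarith)
  have i1 := integrable_gaussKer ht x
  have i2 := integrable_gaussKer (show 0 < 2 * t by positivity) x
  rw [mul_min_of_nonneg _ _ (by positivity : 0 ≤ 68 * C), mul_one, le_min_iff, e1, ← Real.norm_eq_abs]
  constructor
  · refine (norm_integral_le_of_norm_le (i1.const_mul C) (Eventually.of_forall hb1)).trans ?_
    rw [integral_const_mul, integral_gaussKer ht]
    linarith
  · refine (norm_integral_le_of_norm_le (((i1.const_mul t).add (i2.const_mul (16 * t))).const_mul _)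
      (Eventually.of_forall hb2)).trans ?_
    simp only [Pi.add_apply]
    rw [integral_const_mul, integral_add (i1.const_mul t) (i2.const_mul (16 * t)), integral_const_mul,
      integral_const_mul, integral_gaussKer ht, integral_gaussKer (by positivity)]
    apply le_of_eq; ring

theorem measurable_heatOne {lam : ℝ} (hlam : 0 < lam) :
    Measurable fun p : ℝ × ℝ => heatOne lam p.1 p.2 := by
  have h := (measurable_heatKernel hlam).stronglyMeasurable
  exact (h.integral_prod_right' (ν := volume.restrict (Ioi 0))).measurable

theorem heatOne_time_integral {lam σ : ℝ} (hlam : 0 < lam) (hσ0 : 0 < σ) (hσ1 : σ < 1) :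
    (∀ x : ℝ, 0 < x → IntegrableOn (fun t => (heatOne lam t x - 1) / t ^ (1 + σ)) (Ioi 0)) ∧
    ∃ C : ℝ, 0 < C ∧ ∀ x : ℝ, 0 < x →
      ∫ t in Ioi (0 : ℝ), |heatOne lam t x - 1| / t ^ (1 + σ) ≤ C * x ^ (-(2 * σ)) := by
  obtain ⟨C, hC0, hC⟩ := exists_abs_heatOne_sub_one_le hlam
  have hle : ∀ x : ℝ, 0 < x → ∀ t ∈ Ioi (0 : ℝ), |heatOne lam t x - 1| / t ^ (1 + σ) ≤
      C * (min 1 (t / x ^ 2) / t ^ (1 + σ)) := by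
    intro x hx t ht
    have := Real.rpow_pos_of_pos ht (1 + σ)
    rw [← mul_div_assoc]
    gcongr
    exact hC t x ht hx
  have hi : ∀ x : ℝ, 0 < x →
      IntegrableOn (fun t => (heatOne lam t x - 1) / t ^ (1 + σ)) (Ioi 0) := by
    intro x hx
    have h := integrableOn_min_div_rpow hσ0 hσ1 (pow_pos hx 2)
    refine Integrable.mono' (h.1.const_mul C) ?_ ?_
    · have : Measurable fun t => heatOne lam t x :=
        (measurable_heatOne hlam).comp (g := fun p : ℝ × ℝ => heatOne lam p.1 p.2)
          (f := fun t : ℝ => (t, x)) (by fun_prop)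
      exact Measurable.aestronglyMeasurable (by fun_prop)
    · refine ae_restrict_of_forall_mem measurableSet_Ioi fun t ht => ?_
      rw [Real.norm_eq_abs, abs_div, abs_of_nonneg (Real.rpow_nonneg (le_of_lt ht) (1 + σ))]
      exact hle x hx t ht
  have h1 : 0 < 1 - σ := by linarith
  refine ⟨hi, C * (1 / (1 - σ) + 1 / σ), by positivity, fun x hx => ?_⟩
  have h := integrableOn_min_div_rpow hσ0 hσ1 (pow_pos hx 2)
  have hi' : IntegrableOn (fun t => |heatOne lam t x - 1| / t ^ (1 + σ)) (Ioi 0) := by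
    refine IntegrableOn.congr_fun (hi x hx).abs (fun t ht => ?_) measurableSet_Ioi
    rw [abs_div, abs_of_nonneg (Real.rpow_nonneg (le_of_lt ht) (1 + σ))]
  calc _ ≤ ∫ t in Ioi (0 : ℝ), C * (min 1 (t / x ^ 2) / t ^ (1 + σ)) :=
        setIntegral_mono_on hi' (h.1.const_mul _) measurableSet_Ioi (hle x hx)
    _ = _ := by
      rw [integral_const_mul, h.2, ← Real.rpow_natCast, ← Real.rpow_mul hx.le, mul_assoc]
      congr 3; push_cast; ring

theorem exists_abs_fracB_le {lam σ : ℝ} (hlam : 0 < lam) (hσ0 : 0 < σ) (hσ1 : σ < 1) :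
    ∃ C : ℝ, 0 < C ∧ ∀ x : ℝ, 0 < x → |fracB lam σ x| ≤ C * x ^ (-(2 * σ)) := by
  obtain ⟨-, C, hC0, hC⟩ := heatOne_time_integral hlam hσ0 hσ1
  have hG := neg_Gamma_neg_pos hσ0 hσ1
  refine ⟨1 / -Real.Gamma (-σ) * C, by positivity, fun x hx => ?_⟩
  rw [fracB, abs_mul, abs_div, abs_one, abs_of_neg (by linarith : Real.Gamma (-σ) < 0), mul_assoc]
  gcongr
  refine (abs_integral_le_integral_abs).trans (le_trans (le_of_eq ?_) (hC x hx))
  refine setIntegral_congr_fun measurableSet_Ioi fun t ht => ?_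
  rw [abs_div, abs_of_nonneg (Real.rpow_nonneg (le_of_lt ht) (1 + σ))]

/-! ### Parabolic scaling and the homogeneity of the kernels -/

theorem heatKernel_scale {lam t x y r : ℝ} (hr : 0 < r) :
    heatKernel lam (r ^ 2 * t) (r * x) (r * y) = heatKernel lam t x y / r := by
  have h1 : √(r * x * (r * y)) = r * √(x * y) := by
    rw [show r * x * (r * y) = r ^ 2 * (x * y) by ring, Real.sqrt_mul (by positivity),
      Real.sqrt_sq hr.le]
  have h2 : r * x * (r * y) / (2 * (r ^ 2 * t)) = x * y / (2 * t) := by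
    rw [show r * x * (r * y) = r ^ 2 * (x * y) by ring,
      show 2 * (r ^ 2 * t) = r ^ 2 * (2 * t) by ring, mul_div_mul_left _ _ (by positivity)]
  have h3 : -((r * x) ^ 2 + (r * y) ^ 2) / (4 * (r ^ 2 * t)) = -(x ^ 2 + y ^ 2) / (4 * t) := by
    rw [show -((r * x) ^ 2 + (r * y) ^ 2) = r ^ 2 * -(x ^ 2 + y ^ 2) by ring,
      show 4 * (r ^ 2 * t) = r ^ 2 * (4 * t) by ring, mul_div_mul_left _ _ (by positivity)]
  rw [heatKernel, heatKernel, h1, h2, h3]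
  have h4 : r * √(x * y) / (2 * (r ^ 2 * t)) = √(x * y) / (2 * t) / r := by
    rw [div_div, show 2 * (r ^ 2 * t) = r * (2 * t * r) by ring, mul_div_mul_left _ _ hr.ne']
  rw [h4]; ring

theorem gaussKer_scale {t s r : ℝ} (hr : 0 < r) : gaussKer (r ^ 2 * t) (r * s) = gaussKer t s / r := by
  rw [gaussKer, gaussKer, show 4 * Real.pi * (r ^ 2 * t) = r ^ 2 * (4 * Real.pi * t) by ring,
    Real.sqrt_mul (by positivity), Real.sqrt_sq hr.le, show 4 * (r ^ 2 * t) = r ^ 2 * (4 * t) by ring,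
    mul_pow, mul_div_mul_left _ _ (by positivity), div_div, mul_comm r]

theorem heatOne_scale {lam t x r : ℝ} (hr : 0 < r) :
    heatOne lam (r ^ 2 * t) (r * x) = heatOne lam t x := by
  have h := integral_comp_mul_left_Ioi (fun y => heatKernel lam (r ^ 2 * t) (r * x) y) 0 hr
  simp only [heatKernel_scale hr, mul_zero, smul_eq_mul] at h
  rw [integral_div, div_eq_inv_mul] at h
  exact (mul_left_cancel₀ (inv_ne_zero hr.ne') h).symm

theorem time_integral_scale {σ r : ℝ} (hr : 0 < r) (F : ℝ → ℝ) :
    ∫ t in Ioi (0 : ℝ), F t / t ^ (1 + σ) =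
      r ^ (-(2 * σ)) * ∫ t in Ioi (0 : ℝ), F (r ^ 2 * t) / t ^ (1 + σ) := by
  have hr2 : 0 < r ^ 2 := by positivity
  have h := integral_comp_mul_left_Ioi (fun t => F t / t ^ (1 + σ)) 0 hr2
  rw [mul_zero, smul_eq_mul] at h
  have h1 : ∫ t in Ioi (0 : ℝ), F (r ^ 2 * t) / (r ^ 2 * t) ^ (1 + σ) =
      (r ^ 2 * r ^ (2 * σ))⁻¹ * ∫ t in Ioi (0 : ℝ), F (r ^ 2 * t) / t ^ (1 + σ) := by
    rw [← integral_const_mul]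
    refine setIntegral_congr_fun measurableSet_Ioi fun t ht => ?_
    have ht' : 0 < t := ht
    rw [Real.mul_rpow hr2.le ht'.le, ← Real.rpow_natCast r 2, ← Real.rpow_mul hr.le,
      ← Real.rpow_add hr, show (2 : ℕ) * (1 + σ) = (2 : ℕ) + 2 * σ by push_cast; ring,
      div_mul_eq_div_div_swap, div_eq_inv_mul]
  rw [h1] at h
  have h2 : r ^ (-(2 * σ)) = (r ^ (2 * σ))⁻¹ := Real.rpow_neg hr.le _
  have h3 := Real.rpow_pos_of_pos hr (2 * σ)
  rw [h2]
  field_simp at h ⊢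
  linarith

theorem fracB_scale {lam σ x r : ℝ} (hr : 0 < r) :
    fracB lam σ (r * x) = r ^ (-(2 * σ)) * fracB lam σ x := by
  rw [fracB, fracB, time_integral_scale hr]
  simp only [heatOne_scale hr]
  ring

theorem fracKernel_scale {lam σ x y r : ℝ} (hr : 0 < r) :
    fracKernel lam σ (r * x) (r * y) = r ^ (-(1 + 2 * σ)) * fracKernel lam σ x y := by
  rw [fracKernel, fracKernel, time_integral_scale hr]
  simp only [heatKernel_scale hr, div_right_comm _ r]
  rw [integral_div, show -(1 + 2 * σ) = -(2 * σ) - 1 by ring, Real.rpow_sub_one hr.ne']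
  ring

theorem remKernel_scale {lam σ x y r : ℝ} (hr : 0 < r) :
    remKernel lam σ (r * x) (r * y) = r ^ (-(1 + 2 * σ)) * remKernel lam σ x y := by
  rw [remKernel, remKernel, time_integral_scale hr]
  simp only [heatKernel_scale hr, ← mul_sub, gaussKer_scale hr, ← sub_div, div_right_comm _ r]
  rw [integral_div, show -(1 + 2 * σ) = -(2 * σ) - 1 by ring, Real.rpow_sub_one hr.ne']
  ring

/-! ### Weber's second exponential integral: the heat kernel as a Hankel multiplier -/

/-- This is the Chu–Vandermonde identity in Gamma form. Pascal's rule splits the sum for `k + 1`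
into the sum for `(k, l, c)` and `l` times the sum for `(k, l-1, c+1)`; hence the induction leaves
`l` and `c` free. -/
theorem sum_choose_descFactorial_div_Gamma (k l : ℕ) {c : ℝ} (hc : 0 < c) :
    ∑ m ∈ Finset.range (k + 1), (k.choose m : ℝ) * (l.descFactorial m : ℝ) / Real.Gamma (m + c) =
      Real.Gamma (k + l + c) / (Real.Gamma (k + c) * Real.Gamma (l + c)) := by
  induction k generalizing l c with
  | zero =>
    have h1 := Real.Gamma_pos_of_pos hc
    have h2 := Real.Gamma_pos_of_pos (show 0 < (l : ℝ) + c by positivity)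
    simp
    field_simp
  | succ k ih =>
    have hk : 0 < (k : ℝ) + c := by positivity
    have h1 := Real.Gamma_pos_of_pos hk
    have h2 := Real.Gamma_pos_of_pos (show 0 < (l : ℝ) + c by positivity)
    have h3 := Real.Gamma_pos_of_pos (show 0 < (k : ℝ) + l + c by positivity)
    have e1 : ((k + 1 : ℕ) : ℝ) + c = (k + c) + 1 := by push_cast; ring
    have e2 : ((k + 1 : ℕ) : ℝ) + l + c = (k + l + c) + 1 := by push_cast; ring
    rw [e1, e2, Real.Gamma_add_one hk.ne', Real.Gamma_add_one (by positivity)]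
    have e3 : ∑ m ∈ Finset.range (k + 1 + 1), ((k + 1).choose m : ℝ) * (l.descFactorial m : ℝ) /
        Real.Gamma (m + c) =
        ∑ m ∈ Finset.range (k + 1), (k.choose m : ℝ) * (l.descFactorial m : ℝ) / Real.Gamma (m + c) +
        ∑ m ∈ Finset.range (k + 1), (k.choose m : ℝ) * (l.descFactorial (m + 1) : ℝ) /
          Real.Gamma (m + (c + 1)) := by
      have e4 : ∑ m ∈ Finset.range (k + 1), (k.choose m : ℝ) * (l.descFactorial m : ℝ) /
          Real.Gamma (m + c) = ∑ m ∈ Finset.range (k + 1 + 1),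
          (k.choose m : ℝ) * (l.descFactorial m : ℝ) / Real.Gamma (m + c) := by
        rw [Finset.sum_range_succ _ (k + 1), Nat.choose_succ_self]
        simp
      rw [e4, Finset.sum_range_succ' _ (k + 1), Finset.sum_range_succ' _ (k + 1),
        add_right_comm, ← Finset.sum_add_distrib]
      congr 1
      · refine Finset.sum_congr rfl fun m _ => ?_
        rw [Nat.choose_succ_succ, show (m : ℝ) + (c + 1) = ((m + 1 : ℕ) : ℝ) + c by push_cast; ring]
        push_cast; ring
      · simp
    rw [e3, ih l hc]
    cases l with
    | zero =>
      simp
      field_simp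
    | succ l =>
      have e5 : ∑ m ∈ Finset.range (k + 1), (k.choose m : ℝ) * ((l + 1).descFactorial (m + 1) : ℝ) /
          Real.Gamma (m + (c + 1)) = (l + 1) * ∑ m ∈ Finset.range (k + 1), (k.choose m : ℝ) *
          (l.descFactorial m : ℝ) / Real.Gamma (m + (c + 1)) := by
        rw [Finset.mul_sum]
        refine Finset.sum_congr rfl fun m _ => ?_
        rw [Nat.succ_descFactorial_succ]
        push_cast; ring
      rw [e5, ih l (by linarith : 0 < c + 1),
        show (k : ℝ) + l + (c + 1) = k + ((l + 1 : ℕ) : ℝ) + c by push_cast; ring,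
        show (k : ℝ) + (c + 1) = k + c + 1 by ring,
        show (l : ℝ) + (c + 1) = ((l + 1 : ℕ) : ℝ) + c by push_cast; ring,
        Real.Gamma_add_one hk.ne']
      push_cast at h2 h3 ⊢
      field_simp
      ring

/-- The coefficients in the double series of Weber's second exponential integral. -/
def weberCoeff (c : ℝ) (k l : ℕ) : ℝ :=
  Real.Gamma (k + l + c) / ((k.factorial : ℝ) * l.factorial * (Real.Gamma (k + c) * Real.Gamma (l + c)))

/-- Expand the three factors over indices `(m, i, j)` and regroup by `k = m + i`, `l = m + j`. For
fixed `(k, l)` the sum over `m` is the Chu–Vandermonde sum. The term `H` is indexed by `(m, (k, l))`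
and vanishes by itself when `m > k` or `m > l`, that is outside the image of the reindexing. -/
theorem hasSum_weberCoeff {c : ℝ} (hc : 0 < c) (A B : ℝ) :
    HasSum (fun p : ℕ × ℕ => A ^ p.1 * B ^ p.2 * weberCoeff c p.1 p.2)
      (besselE c (A * B) * (Real.exp A * Real.exp B)) := by
  let H : ℕ × (ℕ × ℕ) → ℝ := fun q => A ^ q.2.1 * B ^ q.2.2 / (q.2.1.factorial * q.2.2.factorial) *
    ((q.2.1.choose q.1 : ℝ) * (q.2.2.descFactorial q.1 : ℝ) / Real.Gamma (q.1 + c))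
  let ι : ℕ × (ℕ × ℕ) → ℕ × (ℕ × ℕ) := fun q => (q.1, (q.1 + q.2.1, q.1 + q.2.2))
  have hι : Function.Injective ι := by
    rintro ⟨m, i, j⟩ ⟨m', i', j'⟩ h
    simp only [ι, Prod.mk.injEq] at h
    obtain ⟨rfl, h1, h2⟩ := h
    simp_all
  have hexp : ∀ A : ℝ, HasSum (fun n : ℕ => A ^ n / n.factorial) (Real.exp A) := by
    intro A
    rw [Real.exp_eq_exp_ℝ]
    exact NormedSpace.expSeries_div_hasSum_exp A
  have hH : HasSum H (besselE c (A * B) * (Real.exp A * Real.exp B)) := by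
    rw [← hι.hasSum_iff]
    · have s1 := summable_mul_of_summable_norm (hexp A).summable.norm (hexp B).summable.norm
      have s2 := (hexp A).mul (hexp B) s1
      have s3 := summable_mul_of_summable_norm (hasSum_besselE hc (A * B)).summable.norm s1.norm
      refine ((hasSum_besselE hc (A * B)).mul s2 s3).congr_fun fun q => ?_
      obtain ⟨m, i, j⟩ := q
      simp only [H, ι, Function.comp_apply]
      have hG := Real.Gamma_pos_of_pos (show 0 < (m : ℝ) + c by positivity)
      have h1 : ((m + i).choose m : ℝ) * (m.factorial * i.factorial) = (m + i).factorial := by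
        have := Nat.add_choose_mul_factorial_mul_factorial m i
        rw [← this, Nat.choose_symm_add]; push_cast; ring
      have h2 : (i.factorial : ℝ) ≠ 0 := by positivity
      have h3 : ((m + j).descFactorial m : ℝ) * j.factorial = (m + j).factorial := by
        have := Nat.factorial_mul_descFactorial (Nat.le_add_right m j)
        rw [Nat.add_sub_cancel_left] at this
        rw [← this]; push_cast; ring
      rw [← h1, ← h3, pow_add, pow_add, mul_pow]
      have h4 : ((m + i).choose m : ℝ) ≠ 0 := by
        exact_mod_cast (Nat.choose_pos (Nat.le_add_right m i)).ne'
      have h5 : ((m + j).descFactorial m : ℝ) ≠ 0 := by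
        have : (m + j).descFactorial m ≠ 0 := by
          rw [Ne, Nat.descFactorial_eq_zero_iff_lt]; omega
        exact_mod_cast this
      field_simp
    · rintro ⟨m, k, l⟩ h
      simp only [H]
      by_cases h1 : k < m
      · simp [Nat.choose_eq_zero_of_lt h1]
      by_cases h2 : l < m
      · simp [Nat.descFactorial_eq_zero_iff_lt.mpr h2]
      refine absurd ⟨(m, (k - m, l - m)), ?_⟩ h
      simp only [ι]
      rw [Nat.add_sub_cancel' (not_lt.mp h1), Nat.add_sub_cancel' (not_lt.mp h2)]
  have hH' : HasSum (fun q : (ℕ × ℕ) × ℕ => H (q.2, q.1)) (besselE c (A * B) * (Real.exp A * Real.exp B)) :=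
    (Equiv.prodComm (ℕ × ℕ) ℕ).hasSum_iff.mpr hH
  refine hH'.prod_fiberwise fun p => ?_
  have h0 : ∀ m ∉ Finset.range (p.1 + 1), H (m, p) = 0 := by
    intro m hm
    have : p.1 < m := by simpa using hm
    simp [H, Nat.choose_eq_zero_of_lt this]
  have h := hasSum_sum_of_ne_finset_zero (L := SummationFilter.unconditional ℕ) h0
  convert h using 1
  simp only [H]
  rw [← Finset.mul_sum, sum_choose_descFactorial_div_Gamma _ _ hc, weberCoeff]
  have h1 := Real.Gamma_pos_of_pos (show 0 < (p.1 : ℝ) + c by positivity)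
  have h2 := Real.Gamma_pos_of_pos (show 0 < (p.2 : ℝ) + c by positivity)
  field_simp

theorem integrableOn_rpow_mul_gaussian {a t : ℝ} (ha : 0 < a) (ht : 0 < t) :
    IntegrableOn (fun ξ : ℝ => ξ ^ (2 * a - 1) * Real.exp (-t * ξ ^ 2)) (Ioi 0) ∧
      ∫ ξ in Ioi (0 : ℝ), ξ ^ (2 * a - 1) * Real.exp (-t * ξ ^ 2) = 1 / 2 * t ^ (-a) * Real.Gamma a := by
  refine ⟨integrableOn_rpow_mul_exp_neg_mul_sq ht (by linarith), ?_⟩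
  have h := integral_rpow_mul_exp_neg_mul_rpow (p := 2) (q := 2 * a - 1) (b := t) two_pos
    (by linarith) ht
  simp only [Real.rpow_two] at h
  rw [h, show -(2 * a - 1 + 1) / 2 = -a by ring, show (2 * a - 1 + 1) / 2 = a by ring]
  ring

/-- Weber's second exponential integral. -/
theorem integral_besselE_mul_besselE_gaussian {c t : ℝ} (hc : 0 < c) (ht : 0 < t) (x y : ℝ) :
    ∫ ξ in Ioi (0 : ℝ), ξ ^ (2 * c - 1) * Real.exp (-t * ξ ^ 2) *
      (besselE c (-((x * ξ) ^ 2 / 4)) * besselE c (-((y * ξ) ^ 2 / 4))) =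
    1 / 2 * t ^ (-c) * (Real.exp (-(x ^ 2 / (4 * t))) * Real.exp (-(y ^ 2 / (4 * t)))) *
      besselE c ((x * y / (4 * t)) ^ 2) := by
  let a : ℕ × ℕ → ℝ := fun p => (-(x ^ 2 / 4)) ^ p.1 * (-(y ^ 2 / 4)) ^ p.2 /
    ((p.1.factorial : ℝ) * p.2.factorial * (Real.Gamma (p.1 + c) * Real.Gamma (p.2 + c)))
  -- The two Bessel series are multiplied out, and each term integrates to a Gaussian moment. The
  -- integrals of the norms form the same double series with the signs removed, so one summation
  -- formula gives both the domination and the value.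
  let F : ℕ × ℕ → ℝ → ℝ := fun p ξ => a p * (ξ ^ (2 * (p.1 + p.2 + c) - 1) * Real.exp (-t * ξ ^ 2))
  have hpos : ∀ p : ℕ × ℕ, 0 < (p.1 : ℝ) + p.2 + c := fun p => by positivity
  have hF : ∀ p, IntegrableOn (F p) (Ioi 0) := fun p =>
    (integrableOn_rpow_mul_gaussian (hpos p) ht).1.const_mul _
  have htp : ∀ p : ℕ × ℕ, t ^ (-((p.1 : ℝ) + p.2 + c)) = t ^ (-c) * (t⁻¹ ^ p.1 * t⁻¹ ^ p.2) := by
    intro p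
    rw [← pow_add, inv_pow, ← Real.rpow_natCast, ← Real.rpow_neg ht.le, ← Real.rpow_add ht]
    congr 1; push_cast; ring
  have hFi : ∀ p, ∫ ξ in Ioi (0 : ℝ), F p ξ = 1 / 2 * t ^ (-c) *
      ((-(x ^ 2 / (4 * t))) ^ p.1 * (-(y ^ 2 / (4 * t))) ^ p.2 * weberCoeff c p.1 p.2) := by
    intro p
    simp only [F, a]
    rw [integral_const_mul, (integrableOn_rpow_mul_gaussian (hpos p) ht).2, htp, weberCoeff,
      show -(x ^ 2 / (4 * t)) = -(x ^ 2 / 4) * t⁻¹ by field_simp,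
      show -(y ^ 2 / (4 * t)) = -(y ^ 2 / 4) * t⁻¹ by field_simp, mul_pow, mul_pow]
    ring
  have hFn : ∀ p, ∫ ξ in Ioi (0 : ℝ), ‖F p ξ‖ = 1 / 2 * t ^ (-c) *
      ((x ^ 2 / (4 * t)) ^ p.1 * (y ^ 2 / (4 * t)) ^ p.2 * weberCoeff c p.1 p.2) := by
    intro p
    have h1 := Real.Gamma_pos_of_pos (show 0 < (p.1 : ℝ) + c by positivity)
    have h2 := Real.Gamma_pos_of_pos (show 0 < (p.2 : ℝ) + c by positivity)
    have e1 : ∫ ξ in Ioi (0 : ℝ), ‖F p ξ‖ = |a p| * ∫ ξ in Ioi (0 : ℝ),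
        ξ ^ (2 * ((p.1 : ℝ) + p.2 + c) - 1) * Real.exp (-t * ξ ^ 2) := by
      rw [← integral_const_mul]
      refine setIntegral_congr_fun measurableSet_Ioi fun ξ hξ => ?_
      have hξ' : 0 < ξ := hξ
      simp only [F]
      rw [norm_mul, Real.norm_eq_abs, Real.norm_of_nonneg (by positivity)]
    have e2 : |a p| = (x ^ 2 / 4) ^ p.1 * (y ^ 2 / 4) ^ p.2 /
        ((p.1.factorial : ℝ) * p.2.factorial * (Real.Gamma (p.1 + c) * Real.Gamma (p.2 + c))) := by
      simp only [a]
      rw [abs_div, abs_mul, abs_pow, abs_pow, abs_neg, abs_neg, abs_of_nonneg (by positivity : 0 ≤ x ^ 2 / 4),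
        abs_of_nonneg (by positivity : 0 ≤ y ^ 2 / 4), abs_of_pos]
      positivity
    rw [e1, e2, (integrableOn_rpow_mul_gaussian (hpos p) ht).2, htp, weberCoeff,
      show x ^ 2 / (4 * t) = (x ^ 2 / 4) * t⁻¹ by field_simp,
      show y ^ 2 / (4 * t) = (y ^ 2 / 4) * t⁻¹ by field_simp, mul_pow, mul_pow]
    ring
  have hsum : Summable fun p => ∫ ξ in Ioi (0 : ℝ), ‖F p ξ‖ := by
    simp only [hFn]
    exact (hasSum_weberCoeff hc _ _).summable.mul_left _
  have h := hasSum_integral_of_summable_integral_norm hF hsum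
  simp only [hFi] at h
  have h2 := (hasSum_weberCoeff hc (-(x ^ 2 / (4 * t))) (-(y ^ 2 / (4 * t)))).mul_left (1 / 2 * t ^ (-c))
  have h3 := h.unique h2
  rw [show (x * y / (4 * t)) ^ 2 = -(x ^ 2 / (4 * t)) * -(y ^ 2 / (4 * t)) by ring]
  rw [mul_right_comm, mul_assoc (1 / 2 * t ^ (-c)), ← h3]
  refine setIntegral_congr_fun measurableSet_Ioi fun ξ hξ => ?_
  have hξ' : 0 < ξ := hξ
  have h4 := tsum_mul_tsum_of_summable_norm (summable_besselE hc (-((x * ξ) ^ 2 / 4))).norm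
    (summable_besselE hc (-((y * ξ) ^ 2 / 4))).norm
  simp only [besselE]
  rw [h4, ← tsum_mul_left]
  refine tsum_congr fun p => ?_
  simp only [F, a]
  have e3 : ξ ^ (2 * ((p.1 : ℝ) + p.2 + c) - 1) = ξ ^ (2 * c - 1) * ((ξ ^ 2) ^ p.1 * (ξ ^ 2) ^ p.2) := by
    rw [← pow_add, ← pow_mul, ← Real.rpow_natCast, ← Real.rpow_add hξ']
    congr 1; push_cast; ring
  rw [e3, show -((x * ξ) ^ 2 / 4) = -(x ^ 2 / 4) * ξ ^ 2 by ring,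
    show -((y * ξ) ^ 2 / 4) = -(y ^ 2 / 4) * ξ ^ 2 by ring, mul_pow, mul_pow]
  ring

theorem sqrt_mul_besselJ {lam z : ℝ} (hz : 0 < z) :
    √z * besselJ (lam - 1 / 2) z =
      2 ^ (1 / 2 - lam) * z ^ lam * besselE (lam + 1 / 2) (-(z ^ 2 / 4)) := by
  rw [besselJ_eq, Real.div_rpow hz.le two_pos.le, Real.rpow_sub hz, ← Real.sqrt_eq_rpow,
    show (1 / 2 - lam : ℝ) = -(lam - 1 / 2) by ring, Real.rpow_neg two_pos.le]
  have : 0 < √z := by positivity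
  field_simp

/-- Weber's integral with `c = λ + 1/2`. The prefactor is the product of the normalizations of two
Hankel kernels, so the kernel of the multiplier `e^(-tξ²)` is exactly `W_t`. -/
theorem weber_heatKernel {lam t x y : ℝ} (hlam : 0 < lam) (ht : 0 < t) (hx : 0 < x) (hy : 0 < y) :
    (2 ^ (1 / 2 - lam)) ^ 2 * (x * y) ^ lam * ∫ ξ in Ioi (0 : ℝ), ξ ^ (2 * lam) * Real.exp (-t * ξ ^ 2) *
      (besselE (lam + 1 / 2) (-((x * ξ) ^ 2 / 4)) * besselE (lam + 1 / 2) (-((y * ξ) ^ 2 / 4))) =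
    heatKernel lam t x y := by
  have hxy : 0 < x * y := by positivity
  have h := integral_besselE_mul_besselE_gaussian (c := lam + 1 / 2) (by positivity) ht x y
  rw [show 2 * (lam + 1 / 2) - 1 = 2 * lam by ring] at h
  rw [h, heatKernel, besselI_eq, show x * y / (2 * t) / 2 = x * y / (4 * t) by field_simp; ring,
    show (x * y / (2 * t)) ^ 2 / 4 = (x * y / (4 * t)) ^ 2 by field_simp; ring,
    show -(x ^ 2 + y ^ 2) / (4 * t) = -(x ^ 2 / (4 * t)) + -(y ^ 2 / (4 * t)) by ring, Real.exp_add,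
    Real.div_rpow hxy.le (by positivity), Real.rpow_sub hxy, ← Real.sqrt_eq_rpow (x * y),
    Real.mul_rpow (by norm_num) ht.le, Real.rpow_neg ht.le]
  have h1 : (4 : ℝ) ^ (lam - 1 / 2) = ((2 ^ (1 / 2 - lam)) ^ 2)⁻¹ := by
    rw [← Real.rpow_natCast, ← Real.rpow_mul two_pos.le, ← Real.rpow_neg two_pos.le,
      show (4 : ℝ) = 2 ^ (2 : ℝ) by norm_num, ← Real.rpow_mul two_pos.le]
    congr 1; push_cast; ring
  have h2 : t ^ (lam + 1 / 2) = t ^ (lam - 1 / 2) * t := by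
    rw [← Real.rpow_add_one ht.ne']; congr 1; ring
  rw [h1, h2]
  have h3 : 0 < √(x * y) := by positivity
  have h4 := Real.rpow_pos_of_pos ht (lam - 1 / 2)
  have h5 : (0 : ℝ) < 2 ^ (1 / 2 - lam) := by positivity
  field_simp

/-! ### Rapid decay of the Hankel transform of test functions -/

theorem integrableOn_rpow_mul_one_add_rpow {a b : ℝ} (ha : -1 < a) (hb : a + 1 < b) :
    IntegrableOn (fun x : ℝ => x ^ a * (1 + x) ^ (-b)) (Ioi 0) := by
  have hm : Measurable fun x : ℝ => x ^ a * (1 + x) ^ (-b) := by fun_prop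
  rw [← Ioc_union_Ioi_eq_Ioi (zero_le_one (α := ℝ))]
  refine IntegrableOn.union ?_ ?_
  · have h : IntegrableOn (fun x : ℝ => x ^ a) (Ioc 0 1) := by
      rw [← intervalIntegrable_iff_integrableOn_Ioc_of_le zero_le_one]
      exact intervalIntegral.intervalIntegrable_rpow' ha
    refine Integrable.mono' h hm.aestronglyMeasurable ?_
    refine ae_restrict_of_forall_mem measurableSet_Ioc fun x hx => ?_
    have h1 := Real.rpow_nonneg hx.1.le a
    have h2 : (1 + x) ^ (-b) ≤ 1 :=
      Real.rpow_le_one_of_one_le_of_nonpos (by linarith [hx.1]) (by linarith)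
    have h3 : 0 ≤ (1 + x) ^ (-b) := Real.rpow_nonneg (by linarith [hx.1]) _
    rw [Real.norm_of_nonneg (by positivity)]
    exact mul_le_of_le_one_right h1 h2
  · have h : IntegrableOn (fun x : ℝ => x ^ (a - b)) (Ioi 1) :=
      integrableOn_Ioi_rpow_of_lt (by linarith) one_pos
    refine Integrable.mono' h hm.aestronglyMeasurable ?_
    refine ae_restrict_of_forall_mem measurableSet_Ioi fun x hx => ?_
    have hx1 : 1 < x := hx
    have hx0 : 0 < x := by linarith
    have h3 : 0 ≤ (1 + x) ^ (-b) := Real.rpow_nonneg (by linarith) _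
    rw [Real.norm_of_nonneg (by positivity), sub_eq_add_neg, Real.rpow_add hx0]
    exact mul_le_mul_of_nonneg_left
      (Real.rpow_le_rpow_of_nonpos hx0 (by linarith) (by linarith)) (Real.rpow_nonneg hx0.le a)

/-- Measurable functions on `(0, ∞)`, bounded near `0` and rapidly decaying at infinity. -/
def RapidDecay (f : ℝ → ℝ) : Prop :=
  AEStronglyMeasurable f (volume.restrict (Ioi 0)) ∧ ∀ m : ℕ, ∃ C : ℝ, ∀ x : ℝ, 0 < x → (1 + x) ^ m * |f x| ≤ C

theorem RapidDecay.exists_le {f : ℝ → ℝ} (hf : RapidDecay f) (b : ℝ) :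
    ∃ C : ℝ, 0 < C ∧ ∀ x : ℝ, 0 < x → |f x| ≤ C * (1 + x) ^ (-b) := by
  obtain ⟨C, hC⟩ := hf.2 ⌈b⌉₊
  refine ⟨max C 1, by positivity, fun x hx => ?_⟩
  have hx1 : 1 ≤ 1 + x := by linarith
  have h1 : 0 < (1 + x) ^ b := Real.rpow_pos_of_pos (by linarith) _
  rw [Real.rpow_neg (by linarith), ← div_eq_mul_inv, le_div_iff₀ h1]
  refine le_trans ?_ ((hC x hx).trans (le_max_left _ _))
  rw [mul_comm, ← Real.rpow_natCast]
  gcongr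
  exact Nat.le_ceil b

theorem RapidDecay.aestronglyMeasurable {f : ℝ → ℝ} (hf : RapidDecay f) :
    AEStronglyMeasurable f (volume.restrict (Ioi 0)) := hf.1

theorem RapidDecay.integrableOn_rpow_mul {f : ℝ → ℝ} (hf : RapidDecay f) {a : ℝ} (ha : -1 < a) :
    IntegrableOn (fun x : ℝ => x ^ a * f x) (Ioi 0) := by
  obtain ⟨C, hC0, hC⟩ := hf.exists_le (a + 2)
  have h := (integrableOn_rpow_mul_one_add_rpow ha (show a + 1 < a + 2 by linarith)).const_mul C
  refine Integrable.mono' h ?_ ?_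
  · exact (Measurable.aestronglyMeasurable (by fun_prop)).mul hf.aestronglyMeasurable
  · refine ae_restrict_of_forall_mem measurableSet_Ioi fun x hx => ?_
    have hx0 : 0 < x := hx
    have h1 := Real.rpow_nonneg hx0.le a
    rw [norm_mul, Real.norm_of_nonneg h1, Real.norm_eq_abs]
    calc x ^ a * |f x| ≤ x ^ a * (C * (1 + x) ^ (-(a + 2))) := by gcongr; exact hC x hx0
      _ = _ := by ring

/-- The Hankel transform of `x ^ λ f`, divided by `2 ^ (1/2-λ) y ^ λ`. -/
def hankelT (lam : ℝ) (f : ℝ → ℝ) (y : ℝ) : ℝ :=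
  ∫ x in Ioi (0 : ℝ), x ^ (2 * lam) * besselE (lam + 1 / 2) (-((x * y) ^ 2 / 4)) * f x

theorem hankel_eq_hankelT {lam y : ℝ} {φ f : ℝ → ℝ} (hy : 0 < y)
    (h : ∀ x : ℝ, 0 < x → φ x = x ^ lam * f x) :
    hankel lam φ y = 2 ^ (1 / 2 - lam) * y ^ lam * hankelT lam f y := by
  rw [hankel, hankelT, ← integral_const_mul]
  refine setIntegral_congr_fun measurableSet_Ioi fun x hx => ?_
  have hx0 : 0 < x := hx
  rw [sqrt_mul_besselJ (by positivity), h x hx0, Real.mul_rpow hy.le hx0.le, mul_comm y x,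
    show 2 * lam = lam + lam by ring, Real.rpow_add hx0]
  ring

theorem continuous_besselE_neg_sq {c : ℝ} (hc : 0 < c) (y : ℝ) :
    Continuous fun x : ℝ => besselE c (-((x * y) ^ 2 / 4)) :=
  (continuous_besselE hc).comp (by fun_prop)

theorem integrableOn_hankelT {lam a : ℝ} {f : ℝ → ℝ} (hlam : 0 < lam) (ha : -1 < a)
    (hf : RapidDecay f) {y : ℝ} (hy : 0 ≤ y) :
    IntegrableOn (fun x : ℝ => x ^ a * besselE (lam + 1 / 2) (-((x * y) ^ 2 / 4)) * f x) (Ioi 0) := by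
  have h := (hf.integrableOn_rpow_mul ha).norm.const_mul (Real.Gamma (lam + 1 / 2))⁻¹
  refine Integrable.mono' h ?_ ?_
  · have := (continuous_besselE_neg_sq (c := lam + 1 / 2) (by positivity) y).measurable
    exact (Measurable.aestronglyMeasurable (by fun_prop)).mul hf.aestronglyMeasurable
  · refine ae_restrict_of_forall_mem measurableSet_Ioi fun x hx => ?_
    have hx0 : 0 < x := hx
    have h1 := abs_besselE_neg_sq_le (c := lam + 1 / 2) (z := x * y) (by linarith) (by positivity)
    rw [norm_mul, norm_mul, norm_mul, Real.norm_eq_abs (besselE _ _), mul_comm (‖x ^ a‖), mul_assoc]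
    gcongr

/-- Differentiate `x^(2λ+1) E_{λ+3/2}(-(xy)²/4) f(x)`. By the recurrence, the derivative falling on
the first two factors gives `2 x^(2λ) E_{λ+1/2} f`; the derivative of `f` gives the other integrand,
with `λ` raised by one. The boundary terms vanish, so the two integrals balance. -/
theorem hankelT_eq_neg_half_mul {lam y : ℝ} {f f₁ : ℝ → ℝ} (hlam : 0 < lam) (hy : 0 < y)
    (hf : RapidDecay f) (hf₁ : RapidDecay f₁)
    (hd : ∀ x : ℝ, 0 < x → HasDerivAt f (x * f₁ x) x) :
    hankelT lam f y = -(1 / 2) * hankelT (lam + 1) f₁ y := by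
  let F : ℝ → ℝ := fun x => x ^ (2 * lam + 1) * besselE (lam + 1 + 1 / 2) (-((x * y) ^ 2 / 4)) * f x
  let F' : ℝ → ℝ := fun x => 2 * (x ^ (2 * lam) * besselE (lam + 1 / 2) (-((x * y) ^ 2 / 4)) * f x) +
    x ^ (2 * (lam + 1)) * besselE (lam + 1 + 1 / 2) (-((x * y) ^ 2 / 4)) * f₁ x
  have i1 := (integrableOn_hankelT (a := 2 * lam) hlam (by linarith) hf hy.le).const_mul 2
  have i2 := integrableOn_hankelT (lam := lam + 1) (a := 2 * (lam + 1)) (by linarith) (by linarith) hf₁ hy.le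
  have hF' : IntegrableOn F' (Ioi 0) := i1.add i2
  have hF : IntegrableOn F (Ioi 0) :=
    integrableOn_hankelT (lam := lam + 1) (a := 2 * lam + 1) (by linarith) (by linarith) hf hy.le
  have hder : ∀ x ∈ Ioi (0 : ℝ), HasDerivAt F (F' x) x := by
    intro x hx
    have hx0 : 0 < x := hx
    have h1 : HasDerivAt (fun x : ℝ => x ^ (2 * lam + 1)) ((2 * lam + 1) * x ^ (2 * lam)) x := by
      have := Real.hasDerivAt_rpow_const (x := x) (p := 2 * lam + 1) (Or.inl hx0.ne')
      rwa [add_sub_cancel_right] at this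
    have h2 : HasDerivAt (fun x : ℝ => besselE (lam + 1 + 1 / 2) (-((x * y) ^ 2 / 4)))
        (-(x * y / 2) * besselE (lam + 1 + 1 / 2 + 1) (-((x * y) ^ 2 / 4)) * y) x := by
      have h3 := hasDerivAt_besselE_neg_sq (c := lam + 1 + 1 / 2) (by linarith) (x * y)
      exact h3.comp x (hasDerivAt_mul_const y)
    refine ((h1.mul h2).mul (hd x hx0)).congr_deriv ?_
    have h4 := besselE_contiguous (c := lam + 1 / 2) (by linarith) (-((x * y) ^ 2 / 4))
    rw [show lam + 1 / 2 + 1 = lam + 1 + 1 / 2 by ring,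
      show lam + 1 / 2 + 2 = lam + 1 + 1 / 2 + 1 by ring] at h4
    simp only [F', Pi.mul_apply]
    have h5 : x ^ (2 * lam + 1) = x ^ (2 * lam) * x := Real.rpow_add_one hx0.ne' _
    have h6 : x ^ (2 * (lam + 1)) = x ^ (2 * lam) * x * x := by
      rw [show 2 * (lam + 1) = 2 * lam + 1 + 1 by ring, Real.rpow_add_one hx0.ne', h5]
    rw [h4, h5, h6]
    ring
  have hF0 : F 0 = 0 := by
    simp only [F]; rw [Real.zero_rpow (by linarith)]; ring
  have hc : ContinuousWithinAt F (Ici 0) 0 := by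
    obtain ⟨C, hC0, hC⟩ := hf.exists_le 0
    have hG := Real.Gamma_pos_of_pos (show 0 < lam + 1 + 1 / 2 by linarith)
    rw [ContinuousWithinAt, hF0]
    refine squeeze_zero_norm' (a := fun x => x ^ (2 * lam + 1) * ((Real.Gamma (lam + 1 + 1 / 2))⁻¹ * C)) ?_ ?_
    · filter_upwards [self_mem_nhdsWithin] with x hx
      rcases (mem_Ici.mp hx).eq_or_lt with h | h
      · rw [← h, hF0, norm_zero, Real.zero_rpow (by linarith), zero_mul]
      · simp only [F]
        have h1 := abs_besselE_neg_sq_le (c := lam + 1 + 1 / 2) (z := x * y) (by linarith) (by positivity)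
        have h2 := hC x h
        rw [neg_zero, Real.rpow_zero, mul_one] at h2
        rw [norm_mul, norm_mul, Real.norm_of_nonneg (by positivity), Real.norm_eq_abs,
          Real.norm_eq_abs, mul_assoc]
        gcongr
    · have h1 : ContinuousAt (fun x : ℝ => x ^ (2 * lam + 1)) 0 :=
        Real.continuousAt_rpow_const _ _ (Or.inr (by linarith))
      have h2 : Tendsto (fun x : ℝ => x ^ (2 * lam + 1) * ((Real.Gamma (lam + 1 + 1 / 2))⁻¹ * C)) (𝓝 0)
          (𝓝 ((0 : ℝ) ^ (2 * lam + 1) * ((Real.Gamma (lam + 1 + 1 / 2))⁻¹ * C))) := h1.tendsto.mul_const _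
      rw [Real.zero_rpow (by linarith), zero_mul] at h2
      exact h2.mono_left nhdsWithin_le_nhds
  -- No pointwise estimate at infinity is needed: a function that is integrable together with its
  -- derivative tends to zero.
  have hinf := tendsto_zero_of_hasDerivAt_of_integrableOn_Ioi hder hF' hF
  have h := integral_Ioi_of_hasDerivAt_of_tendsto hc hder hF' hinf
  rw [hF0, sub_zero] at h
  simp only [F'] at h
  rw [integral_add i1 i2, integral_const_mul] at h
  simp only [hankelT]
  linarith

/-- Integrating by parts `2m` times raises the order of the Bessel factor by `2m`. That factor then
decays like `(xy)^(-2m)`, and the powers of `x` are absorbed by the rapid decay of `f (2m)`. -/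
theorem hankelT_decay {lam : ℝ} {f : ℕ → ℝ → ℝ} (hlam : 0 < lam) (hf : ∀ k, RapidDecay (f k))
    (hd : ∀ k, ∀ x : ℝ, 0 < x → HasDerivAt (f k) (x * f (k + 1) x) x) (b : ℝ) :
    ∃ C : ℝ, 0 < C ∧ ∀ y : ℝ, 0 < y → |hankelT lam (f 0) y| ≤ C * (1 + y) ^ (-b) := by
  have hiter : ∀ k : ℕ, ∀ y : ℝ, 0 < y →
      hankelT lam (f 0) y = (-(1 / 2)) ^ k * hankelT (lam + k) (f k) y := by
    intro k y hy
    induction k with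
    | zero => simp
    | succ k ih =>
      rw [ih, hankelT_eq_neg_half_mul (by positivity) hy (hf k) (hf (k + 1)) (hd k), pow_succ]
      push_cast
      rw [add_assoc lam, mul_assoc]
  have hpow : ∀ m : ℕ, ∃ C : ℝ, ∀ y : ℝ, 0 < y → y ^ (2 * m) * |hankelT lam (f 0) y| ≤ C := by
    intro m
    obtain ⟨C, hC⟩ := besselE_neg_sq_decay (c := lam + 1 / 2) (by linarith) m
    have hi := ((hf (2 * m)).integrableOn_rpow_mul (a := 2 * lam + 2 * m)
      (by have : (0 : ℝ) ≤ m := m.cast_nonneg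
          linarith)).norm.const_mul C
    refine ⟨∫ x in Ioi (0 : ℝ), C * ‖x ^ (2 * lam + 2 * m) * f (2 * m) x‖, fun y hy => ?_⟩
    rw [hiter (2 * m) y hy, abs_mul, abs_pow, ← mul_assoc, mul_comm (y ^ (2 * m)), mul_assoc]
    have h1 : |-(1 / 2 : ℝ)| ^ (2 * m) ≤ 1 := by
      refine pow_le_one₀ (abs_nonneg _) ?_
      rw [abs_neg, abs_of_pos (by norm_num)]
      norm_num
    refine (mul_le_of_le_one_left (by positivity) h1).trans ?_
    rw [← abs_of_pos (pow_pos hy (2 * m)), ← abs_mul, hankelT, ← integral_const_mul, ← Real.norm_eq_abs]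
    refine norm_integral_le_of_norm_le hi ?_
    refine ae_restrict_of_forall_mem measurableSet_Ioi fun x hx => ?_
    have hx0 : 0 < x := hx
    have h2 := hC (x * y) (by positivity)
    have e1 : x ^ (2 * (lam + ((2 * m : ℕ) : ℝ))) = x ^ (2 * lam + 2 * m) * x ^ (2 * m) := by
      rw [← Real.rpow_natCast x, ← Real.rpow_add hx0]; congr 1; push_cast; ring
    rw [e1, show lam + ((2 * m : ℕ) : ℝ) + 1 / 2 = lam + 1 / 2 + 2 * m by push_cast; ring]
    rw [mul_pow] at h2
    simp only [norm_mul, Real.norm_eq_abs]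
    rw [abs_of_pos (pow_pos hx0 (2 * m)), abs_of_pos (pow_pos hy (2 * m))]
    calc _ = (x ^ (2 * m) * y ^ (2 * m) *
          |besselE (lam + 1 / 2 + 2 * m) (-((x * y) ^ 2 / 4))|) *
          (|x ^ (2 * lam + 2 * (m : ℝ))| * |f (2 * m) x|) := by ring
      _ ≤ _ := by gcongr
  obtain ⟨C₀, hC₀⟩ := hpow 0
  obtain ⟨C, hC⟩ := hpow ⌈b⌉₊
  refine ⟨max (2 ^ (2 * ⌈b⌉₊ - 1) * (C₀ + C)) 1, by positivity, fun y hy => ?_⟩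
  have h0 := hC₀ y hy
  have h1 := hC y hy
  have hb : 0 < (1 + y) ^ b := Real.rpow_pos_of_pos (by linarith) _
  rw [Real.rpow_neg (by linarith), ← div_eq_mul_inv, le_div_iff₀ hb]
  refine le_trans ?_ (le_max_left _ _)
  have h2 : (1 + y) ^ b ≤ 2 ^ (2 * ⌈b⌉₊ - 1) * (1 + y ^ (2 * ⌈b⌉₊)) := by
    calc (1 + y) ^ b ≤ (1 + y) ^ ((2 * ⌈b⌉₊ : ℕ) : ℝ) := by
          refine Real.rpow_le_rpow_of_exponent_le (by linarith) ((Nat.le_ceil b).trans ?_)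
          exact_mod_cast (by omega : ⌈b⌉₊ ≤ 2 * ⌈b⌉₊)
      _ = (1 + y) ^ (2 * ⌈b⌉₊) := Real.rpow_natCast _ _
      _ ≤ _ := by simpa using add_pow_le zero_le_one hy.le (2 * ⌈b⌉₊)
  simp only [mul_zero, pow_zero, one_mul] at h0
  calc |hankelT lam (f 0) y| * (1 + y) ^ b
      ≤ |hankelT lam (f 0) y| * (2 ^ (2 * ⌈b⌉₊ - 1) * (1 + y ^ (2 * ⌈b⌉₊))) := by gcongr
    _ = 2 ^ (2 * ⌈b⌉₊ - 1) * (|hankelT lam (f 0) y| + y ^ (2 * ⌈b⌉₊) * |hankelT lam (f 0) y|) := by ring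
    _ ≤ _ := by gcongr

/-- Dividing by `x^λ` and iterating `(1/x) d/dx` gives a chain with `f_k' = x f_{k+1}`, the form in
which integration by parts consumes the seminorms. Smoothness of `φ` enters here for
differentiability and measurability. -/
theorem testSpace_structure {lam : ℝ} {φ : ℝ → ℝ} (hφ : φ ∈ testSpace lam) :
    ∃ f : ℕ → ℝ → ℝ, (∀ k, RapidDecay (f k)) ∧
      (∀ k, ∀ x : ℝ, 0 < x → HasDerivAt (f k) (x * f (k + 1) x) x) ∧
      ∀ x : ℝ, 0 < x → φ x = x ^ lam * f 0 x := by
  obtain ⟨hsm, hbd⟩ := hφ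
  let f : ℕ → ℝ → ℝ := fun k => invDeriv^[k] (fun z => z ^ (-lam) * φ z)
  have hs : ∀ k, ContDiffOn ℝ ((⊤ : ℕ∞) : WithTop ℕ∞) (f k) (Ioi 0) := by
    intro k
    induction k with
    | zero =>
      refine ContDiffOn.mul (fun x hx => ?_) hsm
      exact (Real.contDiffAt_rpow_const_of_ne (ne_of_gt hx)).contDiffWithinAt
    | succ k ih =>
      have e : f (k + 1) = fun x => x⁻¹ * deriv (f k) x := by
        simp only [f]; rw [Function.iterate_succ_apply']; rfl
      rw [e]
      refine ContDiffOn.mul (fun x hx => ?_) (ih.deriv_of_isOpen isOpen_Ioi (by simp))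
      exact (contDiffAt_inv ℝ (ne_of_gt hx)).contDiffWithinAt
  refine ⟨f, fun k => ⟨(hs k).continuousOn.aestronglyMeasurable measurableSet_Ioi, fun m => hbd m k⟩, fun k x hx => ?_, fun x hx => ?_⟩
  · have e : f (k + 1) = fun x => x⁻¹ * deriv (f k) x := by
      simp only [f]; rw [Function.iterate_succ_apply']; rfl
    rw [e, mul_inv_cancel_left₀ hx.ne']
    exact (((hs k).differentiableOn (by simp)).differentiableAt (Ioi_mem_nhds hx)).hasDerivAt
  · simp only [f, Function.iterate_zero, id]
    rw [← mul_assoc, ← Real.rpow_add hx, add_neg_cancel, Real.rpow_zero, one_mul]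

theorem ae_pos_prod : ∀ᵐ p : ℝ × ℝ ∂((volume.restrict (Ioi (0 : ℝ))).prod (volume.restrict (Ioi (0 : ℝ)))),
    0 < p.1 ∧ 0 < p.2 := by
  rw [Measure.prod_restrict]
  exact ae_restrict_of_forall_mem (measurableSet_Ioi.prod measurableSet_Ioi) fun p hp => ⟨hp.1, hp.2⟩

theorem measurable_hankelT_kernel {lam : ℝ} (hlam : 0 < lam) :
    Measurable fun p : ℝ × ℝ => p.2 ^ (2 * lam) * besselE (lam + 1 / 2) (-((p.2 * p.1) ^ 2 / 4)) := by
  have := (continuous_besselE (c := lam + 1 / 2) (by positivity)).measurable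
  fun_prop

theorem rapidDecay_hankelT {lam : ℝ} {f : ℕ → ℝ → ℝ} (hlam : 0 < lam) (hf : ∀ k, RapidDecay (f k))
    (hd : ∀ k, ∀ x : ℝ, 0 < x → HasDerivAt (f k) (x * f (k + 1) x) x) :
    RapidDecay (hankelT lam (f 0)) := by
  constructor
  · have h : AEStronglyMeasurable (fun p : ℝ × ℝ =>
        p.2 ^ (2 * lam) * besselE (lam + 1 / 2) (-((p.2 * p.1) ^ 2 / 4)) * f 0 p.2)
        ((volume.restrict (Ioi (0 : ℝ))).prod (volume.restrict (Ioi (0 : ℝ)))) :=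
      (measurable_hankelT_kernel hlam).aestronglyMeasurable.mul (hf 0).aestronglyMeasurable.comp_snd
    exact h.integral_prod_right'
  · intro m
    obtain ⟨C, -, hC⟩ := hankelT_decay hlam hf hd m
    refine ⟨C, fun x hx => ?_⟩
    have h := hC x hx
    have h1 : 0 < (1 + x) ^ m := by positivity
    rw [Real.rpow_neg (by linarith), Real.rpow_natCast, ← div_eq_mul_inv, le_div_iff₀ h1] at h
    linarith

/-! ### The semigroup formula for the fractional operator on test functions -/

/-- The heat semigroup `W_t v`. -/
def heatSg (lam t : ℝ) (v : ℝ → ℝ) (x : ℝ) : ℝ := ∫ y in Ioi (0 : ℝ), heatKernel lam t x y * v y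

/-- Insert the Hankel transform of `f` and exchange the integrals; the inner integral is Weber's.
Fubini is licensed by the Gaussian in `ξ`, the integrability of `y^(2λ) f(y)`, and the uniform bound
on both Bessel factors. -/
theorem heatSg_eq_hankelT {lam t x : ℝ} {φ f : ℝ → ℝ} (hlam : 0 < lam) (ht : 0 < t) (hx : 0 < x)
    (hf : RapidDecay f) (hφ : ∀ x : ℝ, 0 < x → φ x = x ^ lam * f x) :
    heatSg lam t φ x = (2 ^ (1 / 2 - lam)) ^ 2 * x ^ lam *
      hankelT lam (fun ξ => Real.exp (-t * ξ ^ 2) * hankelT lam f ξ) x := by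
  let e : ℝ → ℝ := fun z => besselE (lam + 1 / 2) (-(z ^ 2 / 4))
  have he : Measurable e := ((continuous_besselE (c := lam + 1 / 2) (by positivity)).comp
    (by fun_prop : Continuous fun z : ℝ => -(z ^ 2 / 4))).measurable
  let F : ℝ → ℝ → ℝ := fun ξ y => (ξ ^ (2 * lam) * Real.exp (-t * ξ ^ 2) * e (ξ * x) * e (y * ξ)) *
    (y ^ (2 * lam) * f y)
  have i1 := (integrableOn_rpow_mul_gaussian (a := lam + 1 / 2) (by positivity) ht).1
  rw [show 2 * (lam + 1 / 2) - 1 = 2 * lam by ring] at i1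
  have i2 := (hf.integrableOn_rpow_mul (a := 2 * lam) (by linarith)).norm
  have hFi : Integrable (Function.uncurry F)
      ((volume.restrict (Ioi (0 : ℝ))).prod (volume.restrict (Ioi (0 : ℝ)))) := by
    refine Integrable.mono' ((i1.mul_prod i2).const_mul ((Real.Gamma (lam + 1 / 2))⁻¹ ^ 2)) ?_ ?_
    · have h1 : AEStronglyMeasurable (fun p : ℝ × ℝ => p.1 ^ (2 * lam) * Real.exp (-t * p.1 ^ 2) *
          e (p.1 * x) * e (p.2 * p.1))
          ((volume.restrict (Ioi (0 : ℝ))).prod (volume.restrict (Ioi (0 : ℝ)))) :=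
        Measurable.aestronglyMeasurable (by fun_prop)
      exact h1.mul (hf.integrableOn_rpow_mul (a := 2 * lam) (by linarith)).1.comp_snd
    · filter_upwards [ae_pos_prod] with p hp
      have h1 := abs_besselE_neg_sq_le (c := lam + 1 / 2) (z := p.1 * x) (by linarith)
        (mul_pos hp.1 hx).le
      have h2 := abs_besselE_neg_sq_le (c := lam + 1 / 2) (z := p.2 * p.1) (by linarith)
        (mul_pos hp.2 hp.1).le
      have h3 := Real.rpow_nonneg hp.1.le (2 * lam)
      simp only [Function.uncurry, F]
      rw [norm_mul, norm_mul, norm_mul, Real.norm_of_nonneg (by positivity : 0 ≤ p.1 ^ (2 * lam) *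
        Real.exp (-t * p.1 ^ 2)), Real.norm_eq_abs (e _), Real.norm_eq_abs (e _)]
      calc _ ≤ p.1 ^ (2 * lam) * Real.exp (-t * p.1 ^ 2) * (Real.Gamma (lam + 1 / 2))⁻¹ *
            (Real.Gamma (lam + 1 / 2))⁻¹ * ‖p.2 ^ (2 * lam) * f p.2‖ := by gcongr
        _ = _ := by ring
  have hswap := integral_integral_swap hFi
  have e1 : ∫ ξ in Ioi (0 : ℝ), ∫ y in Ioi (0 : ℝ), F ξ y =
      hankelT lam (fun ξ => Real.exp (-t * ξ ^ 2) * hankelT lam f ξ) x := by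
    rw [hankelT]
    refine setIntegral_congr_fun measurableSet_Ioi fun ξ _ => ?_
    simp only [F]
    rw [hankelT, ← integral_const_mul, ← integral_const_mul]
    refine setIntegral_congr_fun measurableSet_Ioi fun y _ => ?_
    simp only [e]
    ring
  rw [← e1, hswap, heatSg, ← integral_const_mul]
  refine setIntegral_congr_fun measurableSet_Ioi fun y hy => ?_
  have hy0 : 0 < y := hy
  simp only [F]
  rw [integral_mul_const, ← weber_heatKernel hlam ht hx hy0, hφ y hy0, Real.mul_rpow hx.le hy0.le,
    show 2 * lam = lam + lam by ring, Real.rpow_add hy0]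
  have e2 : ∫ ξ in Ioi (0 : ℝ), ξ ^ (lam + lam) * Real.exp (-t * ξ ^ 2) * e (ξ * x) * e (y * ξ) =
      ∫ ξ in Ioi (0 : ℝ), ξ ^ (lam + lam) * Real.exp (-t * ξ ^ 2) *
      (besselE (lam + 1 / 2) (-((x * ξ) ^ 2 / 4)) * besselE (lam + 1 / 2) (-((y * ξ) ^ 2 / 4))) := by
    refine setIntegral_congr_fun measurableSet_Ioi fun ξ _ => ?_
    simp only [e]
    rw [mul_comm ξ x, mul_assoc]
  rw [e2]
  ring

/-- Integrate by parts. The boundary term `(1 - e^(-ts)) t^(-σ)/σ` vanishes at `0` because `σ < 1`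
and at infinity because `σ > 0`. What is left is a Gamma integral, and `Γ(1-σ) = -σ Γ(-σ)`. -/
theorem integral_one_sub_exp_div_rpow {σ s : ℝ} (hσ0 : 0 < σ) (hσ1 : σ < 1) (hs : 0 < s) :
    IntegrableOn (fun t : ℝ => (1 - Real.exp (-t * s)) / t ^ (1 + σ)) (Ioi 0) ∧
      ∫ t in Ioi (0 : ℝ), (1 - Real.exp (-t * s)) / t ^ (1 + σ) = -Real.Gamma (-σ) * s ^ σ := by
  have hbd : ∀ t : ℝ, 0 ≤ t → 0 ≤ 1 - Real.exp (-t * s) ∧ 1 - Real.exp (-t * s) ≤ 1 ∧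
      1 - Real.exp (-t * s) ≤ t * s := by
    intro t ht
    have h1 : Real.exp (-t * s) ≤ 1 := Real.exp_le_one_iff.mpr (by nlinarith)
    have h2 := Real.exp_pos (-t * s)
    have h3 := Real.add_one_le_exp (-t * s)
    exact ⟨by linarith, by linarith, by linarith⟩
  have hi : IntegrableOn (fun t : ℝ => (1 - Real.exp (-t * s)) / t ^ (1 + σ)) (Ioi 0) := by
    have h := (integrableOn_min_div_rpow hσ0 hσ1 (inv_pos.mpr hs)).1
    refine Integrable.mono' h (Measurable.aestronglyMeasurable (by fun_prop)) ?_
    refine ae_restrict_of_forall_mem measurableSet_Ioi fun t ht => ?_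
    have ht0 : 0 < t := ht
    obtain ⟨h0, h1, h2⟩ := hbd t ht0.le
    have := Real.rpow_pos_of_pos ht0 (1 + σ)
    rw [Real.norm_of_nonneg (by positivity), div_inv_eq_mul]
    gcongr
    exact le_min h1 h2
  refine ⟨hi, ?_⟩
  have hi2 := (integrableOn_rpow_mul_exp (a := 1 - σ) (by linarith) hs).const_mul (s / σ)
  let F : ℝ → ℝ := fun t => -((1 - Real.exp (-t * s)) * t ^ (-σ) / σ)
  have hder : ∀ t ∈ Ioi (0 : ℝ), HasDerivAt F ((1 - Real.exp (-t * s)) / t ^ (1 + σ) -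
      s / σ * (t ^ (1 - σ - 1) * Real.exp (-(s * t)))) t := by
    intro t ht
    have ht0 : 0 < t := ht
    have h1 : HasDerivAt (fun t : ℝ => 1 - Real.exp (-t * s)) (Real.exp (-t * s) * s) t := by
      have h2 : HasDerivAt (fun t : ℝ => -t * s) (-s) t := by
        simpa using ((hasDerivAt_id t).neg).mul_const s
      refine ((hasDerivAt_const t (1 : ℝ)).sub h2.exp).congr_deriv (by ring)
    have h3 := Real.hasDerivAt_rpow_const (x := t) (p := -σ) (Or.inl ht0.ne')
    refine (((h1.mul h3).div_const σ).neg).congr_deriv ?_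
    have h4 : t ^ (-σ - 1) = (t ^ (1 + σ))⁻¹ := by
      rw [← Real.rpow_neg ht0.le]; congr 1; ring
    rw [h4, show 1 - σ - 1 = -σ by ring, show -(s * t) = -t * s by ring]
    have := Real.rpow_pos_of_pos ht0 (1 + σ)
    field_simp
    ring
  have hF0 : F 0 = 0 := by simp [F]
  have hc : ContinuousWithinAt F (Ici 0) 0 := by
    rw [ContinuousWithinAt, hF0]
    refine squeeze_zero_norm' (a := fun t => t ^ (1 - σ) * (s / σ)) ?_ ?_
    · filter_upwards [self_mem_nhdsWithin] with t ht
      rcases (mem_Ici.mp ht).eq_or_lt with h | h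
      · rw [← h, hF0, norm_zero, Real.zero_rpow (by linarith), zero_mul]
      · obtain ⟨h0, h1, h2⟩ := hbd t h.le
        have h3 := Real.rpow_nonneg h.le (-σ)
        simp only [F]
        rw [norm_neg, Real.norm_of_nonneg (by positivity), show 1 - σ = -σ + 1 by ring,
          Real.rpow_add_one h.ne']
        calc (1 - Real.exp (-t * s)) * t ^ (-σ) / σ ≤ t * s * t ^ (-σ) / σ := by gcongr
          _ = _ := by ring
    · have h1 : ContinuousAt (fun x : ℝ => x ^ (1 - σ)) 0 :=
        Real.continuousAt_rpow_const _ _ (Or.inr (by linarith))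
      have h2 : Tendsto (fun x : ℝ => x ^ (1 - σ) * (s / σ)) (𝓝 0)
          (𝓝 ((0 : ℝ) ^ (1 - σ) * (s / σ))) := h1.tendsto.mul_const _
      rw [Real.zero_rpow (by linarith), zero_mul] at h2
      exact h2.mono_left nhdsWithin_le_nhds
  have hinf : Tendsto F atTop (𝓝 0) := by
    have h1 := (tendsto_rpow_neg_atTop hσ0).mul_const (1 / σ)
    rw [zero_mul] at h1
    refine squeeze_zero_norm' ?_ h1
    filter_upwards [eventually_gt_atTop 0] with t ht
    obtain ⟨h0, h1, h2⟩ := hbd t ht.le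
    have h3 := Real.rpow_nonneg ht.le (-σ)
    simp only [F]
    rw [norm_neg, Real.norm_of_nonneg (by positivity)]
    calc (1 - Real.exp (-t * s)) * t ^ (-σ) / σ ≤ 1 * t ^ (-σ) / σ := by gcongr
      _ = _ := by ring
  have h := integral_Ioi_of_hasDerivAt_of_tendsto hc hder (hi.sub hi2) hinf
  rw [integral_sub hi hi2, integral_const_mul, Real.integral_rpow_mul_exp_neg_mul_Ioi (by linarith) hs,
    hF0, sub_zero, sub_eq_zero] at h
  rw [h]
  have h1 := Real.Gamma_add_one (s := -σ) (by linarith)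
  rw [show -σ + 1 = 1 - σ by ring] at h1
  rw [h1, one_div, Real.inv_rpow hs.le, Real.rpow_sub hs, Real.rpow_one]
  have := Real.rpow_pos_of_pos hs σ
  field_simp

/-- The scalar formula at `s = ξ²`, integrated against the Hankel kernel. The iterated integral of
the absolute value carries the extra weight `ξ^(2σ)`, which the decay of `w` absorbs. -/
theorem hankelT_time_integral {lam σ x : ℝ} {w : ℝ → ℝ} (hlam : 0 < lam) (hσ0 : 0 < σ) (hσ1 : σ < 1)
    (hx : 0 < x) (hw : RapidDecay w) :
    IntegrableOn (fun t => (hankelT lam w x -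
      hankelT lam (fun ξ => Real.exp (-t * ξ ^ 2) * w ξ) x) / t ^ (1 + σ)) (Ioi 0) ∧
    ∫ t in Ioi (0 : ℝ), (hankelT lam w x -
      hankelT lam (fun ξ => Real.exp (-t * ξ ^ 2) * w ξ) x) / t ^ (1 + σ) =
      -Real.Gamma (-σ) * hankelT lam (fun ξ => ξ ^ (2 * σ) * w ξ) x := by
  let k : ℝ → ℝ := fun ξ => ξ ^ (2 * lam) * besselE (lam + 1 / 2) (-((ξ * x) ^ 2 / 4)) * w ξ
  have hk : IntegrableOn k (Ioi 0) := integrableOn_hankelT hlam (by linarith) hw hx.le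
  let F : ℝ → ℝ → ℝ := fun t ξ => k ξ * ((1 - Real.exp (-t * ξ ^ 2)) / t ^ (1 + σ))
  have hsq : ∀ ξ : ℝ, 0 < ξ → (ξ ^ 2) ^ σ = ξ ^ (2 * σ) := by
    intro ξ hξ
    rw [← Real.rpow_natCast, ← Real.rpow_mul hξ.le]; norm_num
  have hFi : Integrable (Function.uncurry F)
      ((volume.restrict (Ioi (0 : ℝ))).prod (volume.restrict (Ioi (0 : ℝ)))) := by
    rw [integrable_prod_iff']
    · constructor
      · refine ae_restrict_of_forall_mem measurableSet_Ioi fun ξ hξ => ?_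
        have hξ0 : 0 < ξ := hξ
        exact (integral_one_sub_exp_div_rpow hσ0 hσ1 (pow_pos hξ0 2)).1.const_mul (k ξ)
      · have h := ((integrableOn_hankelT (a := 2 * lam + 2 * σ) hlam (by linarith) hw hx.le).norm.const_mul
          (-Real.Gamma (-σ)))
        refine IntegrableOn.congr_fun h (fun ξ hξ => ?_) measurableSet_Ioi
        have hξ0 : 0 < ξ := hξ
        have e1 : ∫ t in Ioi (0 : ℝ), ‖Function.uncurry F (t, ξ)‖ =
            |k ξ| * ∫ t in Ioi (0 : ℝ), (1 - Real.exp (-t * ξ ^ 2)) / t ^ (1 + σ) := by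
          rw [← integral_const_mul]
          refine setIntegral_congr_fun measurableSet_Ioi fun t ht => ?_
          have ht0 : 0 < t := ht
          have h1 : Real.exp (-t * ξ ^ 2) ≤ 1 := Real.exp_le_one_iff.mpr (by nlinarith [sq_nonneg ξ])
          have h2 := Real.rpow_pos_of_pos ht0 (1 + σ)
          simp only [Function.uncurry, F]
          rw [norm_mul, Real.norm_eq_abs, Real.norm_of_nonneg (div_nonneg (by linarith) h2.le)]
        rw [e1, (integral_one_sub_exp_div_rpow hσ0 hσ1 (pow_pos hξ0 2)).2, hsq ξ hξ0]
        simp only [k, norm_mul, abs_mul, Real.norm_eq_abs]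
        rw [Real.rpow_add hξ0, abs_mul, abs_of_pos (Real.rpow_pos_of_pos hξ0 (2 * σ))]
        ring
    · have h1 : AEStronglyMeasurable (fun p : ℝ × ℝ => (1 - Real.exp (-p.1 * p.2 ^ 2)) / p.1 ^ (1 + σ))
          ((volume.restrict (Ioi (0 : ℝ))).prod (volume.restrict (Ioi (0 : ℝ)))) :=
        Measurable.aestronglyMeasurable (by fun_prop)
      exact hk.1.comp_snd.mul h1
  have e2 : ∀ t ∈ Ioi (0 : ℝ), ∫ ξ in Ioi (0 : ℝ), F t ξ = (hankelT lam w x -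
      hankelT lam (fun ξ => Real.exp (-t * ξ ^ 2) * w ξ) x) / t ^ (1 + σ) := by
    intro t ht
    have ht0 : 0 < t := ht
    have hk2 : IntegrableOn (fun ξ => ξ ^ (2 * lam) * besselE (lam + 1 / 2) (-((ξ * x) ^ 2 / 4)) *
        (Real.exp (-t * ξ ^ 2) * w ξ)) (Ioi 0) := by
      refine Integrable.mono' hk.norm ?_ (Eventually.of_forall fun ξ => ?_)
      · have h1 : AEStronglyMeasurable (fun ξ : ℝ => Real.exp (-t * ξ ^ 2)) (volume.restrict (Ioi 0)) :=
          Measurable.aestronglyMeasurable (by fun_prop)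
        refine (h1.mul hk.1).congr (Eventually.of_forall fun ξ => ?_)
        simp only [k, Pi.mul_apply]; ring
      · have h1 : Real.exp (-t * ξ ^ 2) ≤ 1 := Real.exp_le_one_iff.mpr (by nlinarith [sq_nonneg ξ])
        rw [show ξ ^ (2 * lam) * besselE (lam + 1 / 2) (-((ξ * x) ^ 2 / 4)) *
          (Real.exp (-t * ξ ^ 2) * w ξ) = Real.exp (-t * ξ ^ 2) * k ξ by simp only [k]; ring, norm_mul,
          Real.norm_of_nonneg (Real.exp_pos _).le]
        exact mul_le_of_le_one_left (norm_nonneg _) h1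
    rw [hankelT, hankelT, ← integral_sub hk hk2, ← integral_div]
    refine setIntegral_congr_fun measurableSet_Ioi fun ξ _ => ?_
    simp only [F, k]
    ring
  have hswap := integral_integral_swap hFi
  rw [setIntegral_congr_fun measurableSet_Ioi e2] at hswap
  constructor
  · exact IntegrableOn.congr_fun hFi.integral_prod_left e2 measurableSet_Ioi
  · rw [hswap, hankelT, ← integral_const_mul]
    refine setIntegral_congr_fun measurableSet_Ioi fun ξ hξ => ?_
    have hξ0 : 0 < ξ := hξ
    simp only [F]
    rw [integral_const_mul, (integral_one_sub_exp_div_rpow hσ0 hσ1 (pow_pos hξ0 2)).2, hsq ξ hξ0]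
    simp only [k]
    ring

/-- The spectral definition of `Δ_λ^σ φ` agrees with the semigroup formula. -/
theorem fracBesselTest_eq {lam σ x : ℝ} {φ : ℝ → ℝ} (hlam : 0 < lam) (hσ0 : 0 < σ) (hσ1 : σ < 1)
    (hx : 0 < x) (hφ : φ ∈ testSpace lam)
    (hint : IntegrableOn (fun t => (heatSg lam t φ x - φ x) / t ^ (1 + σ)) (Ioi 0)) :
    fracBesselTest lam σ φ x =
      1 / Real.Gamma (-σ) * ∫ t in Ioi (0 : ℝ), (heatSg lam t φ x - φ x) / t ^ (1 + σ) := by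
  obtain ⟨f, hf, hd, hφf⟩ := testSpace_structure hφ
  have hw := rapidDecay_hankelT hlam hf hd
  set w := hankelT lam (f 0) with hwdef
  set κ : ℝ := 2 ^ (1 / 2 - lam) with hκ
  obtain ⟨h1, h2⟩ := hankelT_time_integral (σ := σ) hlam hσ0 hσ1 hx hw
  have hG := neg_Gamma_neg_pos hσ0 hσ1
  have e1 : fracBesselTest lam σ φ x = κ ^ 2 * x ^ lam * hankelT lam (fun ξ => ξ ^ (2 * σ) * w ξ) x := by
    rw [fracBesselTest, hankel_eq_hankelT (f := fun y => κ * (y ^ (2 * σ) * w y)) hx]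
    · rw [hankelT, hankelT, ← integral_const_mul, ← integral_const_mul]
      refine setIntegral_congr_fun measurableSet_Ioi fun ξ _ => ?_
      ring
    · intro y hy
      rw [hankel_eq_hankelT hy hφf]
      ring
  have e2 : ∀ t ∈ Ioi (0 : ℝ), κ ^ 2 * x ^ lam * ((hankelT lam w x -
      hankelT lam (fun ξ => Real.exp (-t * ξ ^ 2) * w ξ) x) / t ^ (1 + σ)) =
      (κ ^ 2 * x ^ lam * hankelT lam w x - heatSg lam t φ x) / t ^ (1 + σ) := by
    intro t ht
    rw [heatSg_eq_hankelT hlam ht hx (hf 0) hφf]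
    ring
  have i1 : IntegrableOn (fun t => (κ ^ 2 * x ^ lam * hankelT lam w x - heatSg lam t φ x) / t ^ (1 + σ))
      (Ioi 0) := IntegrableOn.congr_fun (h1.const_mul (κ ^ 2 * x ^ lam)) e2 measurableSet_Ioi
  -- Hankel inversion at `x` is a by-product. Both `c - W_t φ(x)` and `W_t φ(x) - φ(x)` are
  -- integrable against `t^(-1-σ)`, where `c` is the left side; hence so is the constant `c - φ(x)`.
  -- No power of `t` is integrable on the whole half-line, so this constant is zero.
  have hinv : κ ^ 2 * x ^ lam * hankelT lam w x = φ x := by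
    by_contra hne
    have hne' : κ ^ 2 * x ^ lam * hankelT lam w x - φ x ≠ 0 := sub_ne_zero.mpr hne
    refine not_integrableOn_Ioi_rpow (-(1 + σ)) ?_
    refine IntegrableOn.congr_fun ((i1.add hint).const_mul (κ ^ 2 * x ^ lam * hankelT lam w x - φ x)⁻¹)
      (fun t ht => ?_) measurableSet_Ioi
    have ht0 : 0 < t := ht
    simp only [Pi.add_apply]
    rw [← add_div, sub_add_sub_cancel, Real.rpow_neg ht0.le]
    field_simp
  rw [hinv] at e2
  have h3 : κ ^ 2 * x ^ lam * ∫ t in Ioi (0 : ℝ), (hankelT lam w x -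
      hankelT lam (fun ξ => Real.exp (-t * ξ ^ 2) * w ξ) x) / t ^ (1 + σ) =
      -∫ t in Ioi (0 : ℝ), (heatSg lam t φ x - φ x) / t ^ (1 + σ) := by
    rw [← integral_const_mul, setIntegral_congr_fun measurableSet_Ioi e2, ← integral_neg]
    refine setIntegral_congr_fun measurableSet_Ioi fun t _ => ?_
    ring
  rw [e1]
  have hG' : Real.Gamma (-σ) ≠ 0 := by linarith
  rw [h2] at h3
  field_simp
  linarith

/-! ### Integration tools, the class `L_σ`, and power singularities -/

/-- A product integrability criterion with a bound for the norms of the sections. -/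
theorem integrable_uncurry_of_section_bound {α β : Type*} [MeasurableSpace α] [MeasurableSpace β]
    {μ : Measure α} {ν : Measure β} [SFinite μ] [SFinite ν] {F : α → β → ℝ} {B : β → ℝ}
    (hm : AEStronglyMeasurable (Function.uncurry F) (μ.prod ν))
    (h1 : ∀ᵐ y ∂ν, Integrable (fun t => F t y) μ) (hB : Integrable B ν)
    (h2 : ∀ᵐ y ∂ν, ∫ t, ‖F t y‖ ∂μ ≤ B y) :
    Integrable (Function.uncurry F) (μ.prod ν) ∧ ∫ t, |∫ y, F t y ∂ν| ∂μ ≤ ∫ y, B y ∂ν := by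
  have hi : Integrable (Function.uncurry F) (μ.prod ν) := by
    rw [integrable_prod_iff' hm]
    refine ⟨h1, hB.mono' ?_ ?_⟩
    · exact hm.norm.prod_swap.integral_prod_right'
    · filter_upwards [h2] with y hy
      rw [Real.norm_of_nonneg (integral_nonneg fun _ => norm_nonneg _)]
      exact hy
  refine ⟨hi, ?_⟩
  have h3 : Integrable (Function.uncurry fun t y => ‖F t y‖) (μ.prod ν) := hi.norm
  calc ∫ t, |∫ y, F t y ∂ν| ∂μ ≤ ∫ t, ∫ y, ‖F t y‖ ∂ν ∂μ :=
        integral_mono_ae hi.integral_prod_left.abs h3.integral_prod_left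
          (Eventually.of_forall fun t => norm_integral_le_integral_norm (F t))
    _ = ∫ y, ∫ t, ‖F t y‖ ∂μ ∂ν := integral_integral_swap h3
    _ ≤ _ := integral_mono_ae h3.integral_prod_right hB h2

/-- The reflection `y ↦ 2x - y` preserves the set and changes the sign of the integrand. If the
integrand is not integrable, the integral is zero by convention. -/
theorem setIntegral_odd_eq_zero {S : Set ℝ} {x : ℝ} (hS : MeasurableSet S)
    (hsym : ∀ y, 2 * x - y ∈ S ↔ y ∈ S) (h : ℝ → ℝ) :
    ∫ y in S, (y - x) * h |x - y| = 0 := by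
  rw [← integral_indicator hS]
  have h1 := integral_sub_left_eq_self (S.indicator fun y => (y - x) * h |x - y|) volume (2 * x)
  have h2 : ∀ y, S.indicator (fun y => (y - x) * h |x - y|) (2 * x - y) =
      -S.indicator (fun y => (y - x) * h |x - y|) y := by
    intro y
    by_cases hy : y ∈ S
    · rw [indicator_of_mem hy, indicator_of_mem ((hsym y).mpr hy),
        show x - (2 * x - y) = -(x - y) by ring, abs_neg]
      ring
    · rw [indicator_of_notMem hy, indicator_of_notMem (fun h => hy ((hsym y).mp h)), neg_zero]
  simp only [h2] at h1
  rw [integral_neg] at h1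
  linarith

theorem integrable_comp_abs_sub {f : ℝ → ℝ} (hf : IntegrableOn f (Ioi 0)) (x : ℝ) :
    Integrable (fun y => f |x - y|) ∧ ∫ y, f |x - y| = 2 * ∫ s in Ioi (0 : ℝ), f s := by
  have h1 : Integrable fun y => f |y| := by
    rw [← integrableOn_univ, ← Iic_union_Ioi (a := (0 : ℝ))]
    refine IntegrableOn.union ?_ ?_
    · have h2 := (hf.comp_neg)
      rw [neg_Ioi, neg_zero] at h2
      rw [integrableOn_Iic_iff_integrableOn_Iio]
      refine h2.congr_fun (fun y hy => ?_) measurableSet_Iio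
      rw [abs_of_neg hy]
    · refine hf.congr_fun (fun y hy => ?_) measurableSet_Ioi
      rw [abs_of_pos hy]
  exact ⟨h1.comp_sub_left x, (integral_sub_left_eq_self (fun y => f |y|) volume x).trans integral_comp_abs⟩

/-- Peetre's inequality `1 + y ≤ (1 + x)(1 + |x-y|)` moves the weight from `y` to `x`, and the
Gaussian absorbs the power of `1 + |x-y|`. The constant depends on `t`; the bound serves
integrability at a fixed time only. -/
theorem exists_gaussKer_le_weight {σ t : ℝ} (hσ0 : 0 < σ) (hσ1 : σ < 1) (ht : 0 < t) :
    ∃ C : ℝ, 0 < C ∧ ∀ x y : ℝ, 0 < x → 0 < y →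
      gaussKer t (x - y) ≤ C * (1 + x) ^ (1 + 2 * σ) / (1 + y) ^ (1 + 2 * σ) := by
  set M := max 1 (8 * t) with hM
  have hM1 : 1 ≤ M := le_max_left _ _
  have hM2 : 8 * t ≤ M := le_max_right _ _
  have hs : 0 < √(4 * Real.pi * t) := by positivity
  refine ⟨4 * M ^ 2 / √(4 * Real.pi * t), by positivity, fun x y hx hy => ?_⟩
  set s := x - y with hsdef
  have h1 : 1 + s ^ 2 ≤ M * Real.exp (s ^ 2 / (8 * t)) := by
    have h2 := Real.add_one_le_exp (s ^ 2 / (8 * t))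
    have h3 : s ^ 2 ≤ M * (s ^ 2 / (8 * t)) := by
      rw [mul_div_assoc', le_div_iff₀ (by positivity)]
      nlinarith [sq_nonneg s]
    nlinarith
  have h4 : (1 + |s|) ^ (1 + 2 * σ) ≤ 4 * M ^ 2 * Real.exp (s ^ 2 / (4 * t)) := by
    have h5 : 1 ≤ 1 + |s| := by linarith [abs_nonneg s]
    calc (1 + |s|) ^ (1 + 2 * σ) ≤ (1 + |s|) ^ ((4 : ℕ) : ℝ) :=
          Real.rpow_le_rpow_of_exponent_le h5 (by push_cast; linarith)
      _ = ((1 + |s|) ^ 2) ^ 2 := by rw [Real.rpow_natCast]; ring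
      _ ≤ (2 * (1 + s ^ 2)) ^ 2 := by
        gcongr
        nlinarith [sq_abs s, sq_nonneg (1 - |s|)]
      _ = 4 * (1 + s ^ 2) ^ 2 := by ring
      _ ≤ 4 * (M * Real.exp (s ^ 2 / (8 * t))) ^ 2 := by gcongr
      _ = 4 * M ^ 2 * (Real.exp (s ^ 2 / (8 * t)) * Real.exp (s ^ 2 / (8 * t))) := by ring
      _ = _ := by rw [← Real.exp_add]; congr 2; field_simp; ring
  have h6 : (1 + y) ^ (1 + 2 * σ) ≤ (1 + x) ^ (1 + 2 * σ) * (1 + |s|) ^ (1 + 2 * σ) := by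
    rw [← Real.mul_rpow (by linarith) (by positivity)]
    refine Real.rpow_le_rpow (by linarith) ?_ (by linarith)
    have := neg_abs_le s
    nlinarith [abs_nonneg s]
  have hy1 : 0 < (1 + y) ^ (1 + 2 * σ) := Real.rpow_pos_of_pos (by linarith) _
  have hx1 : 0 < (1 + x) ^ (1 + 2 * σ) := Real.rpow_pos_of_pos (by linarith) _
  have h7 : Real.exp (-(s ^ 2 / (4 * t))) ≤
      4 * M ^ 2 * (1 + x) ^ (1 + 2 * σ) / (1 + y) ^ (1 + 2 * σ) := by
    rw [Real.exp_neg, inv_eq_one_div, div_le_div_iff₀ (Real.exp_pos _) hy1, one_mul]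
    calc (1 + y) ^ (1 + 2 * σ) ≤ (1 + x) ^ (1 + 2 * σ) * (1 + |s|) ^ (1 + 2 * σ) := h6
      _ ≤ (1 + x) ^ (1 + 2 * σ) * (4 * M ^ 2 * Real.exp (s ^ 2 / (4 * t))) := by gcongr
      _ = _ := by ring
  calc gaussKer t s ≤ 4 * M ^ 2 * (1 + x) ^ (1 + 2 * σ) / (1 + y) ^ (1 + 2 * σ) /
        √(4 * Real.pi * t) := by unfold gaussKer; gcongr
    _ = _ := by ring

theorem MemL.aestronglyMeasurable {σ : ℝ} {v : ℝ → ℝ} (hv : MemL σ v) :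
    AEStronglyMeasurable v (volume.restrict (Ioi 0)) := by
  have h1 : AEStronglyMeasurable (fun x : ℝ => (1 + x) ^ (1 + 2 * σ)) (volume.restrict (Ioi 0)) :=
    Measurable.aestronglyMeasurable (by fun_prop)
  refine (hv.1.mul h1).congr ?_
  refine ae_restrict_of_forall_mem measurableSet_Ioi fun x hx => ?_
  have hx0 : 0 < x := hx
  have : 0 < (1 + x) ^ (1 + 2 * σ) := Real.rpow_pos_of_pos (by linarith) _
  simp only [Pi.mul_apply]
  field_simp

theorem MemL.integrableOn_heatKernel_mul {lam σ t x : ℝ} {v : ℝ → ℝ} (hlam : 0 < lam) (hσ0 : 0 < σ)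
    (hσ1 : σ < 1) (hv : MemL σ v) (ht : 0 < t) (hx : 0 < x) :
    IntegrableOn (fun y => heatKernel lam t x y * v y) (Ioi 0) := by
  obtain ⟨C, hC1, hC⟩ := heatKernel_le hlam
  obtain ⟨C', hC0', hC'⟩ := exists_gaussKer_le_weight hσ0 hσ1 ht
  refine Integrable.mono' (hv.norm.const_mul (C * (C' * (1 + x) ^ (1 + 2 * σ)))) ?_ ?_
  · exact (measurable_heatKernel_space hlam t x).aestronglyMeasurable.mul hv.aestronglyMeasurable
  · refine ae_restrict_of_forall_mem measurableSet_Ioi fun y hy => ?_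
    have hy0 : 0 < y := hy
    have hy1 : 0 < (1 + y) ^ (1 + 2 * σ) := Real.rpow_pos_of_pos (by linarith) _
    rw [norm_mul, norm_div, Real.norm_of_nonneg (heatKernel_nonneg hlam ht hx hy0),
      Real.norm_of_nonneg hy1.le]
    calc heatKernel lam t x y * ‖v y‖
        ≤ C * (C' * (1 + x) ^ (1 + 2 * σ) / (1 + y) ^ (1 + 2 * σ)) * ‖v y‖ := by
          have h1 := hC t x y ht hx hy0
          have h2 := hC' x y hx hy0
          gcongr
          exact h1.trans (by gcongr)
      _ = _ := by ring

/-- The inequality behind this is `min(1, x)(1 + y) ≤ x + y`. -/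
theorem rpow_add_le_weight {σ x y : ℝ} (hσ0 : 0 < σ) (hx : 0 < x) (hy : 0 < y) :
    (x + y) ^ (-(1 + 2 * σ)) ≤ (min 1 x) ^ (-(1 + 2 * σ)) * (1 + y) ^ (-(1 + 2 * σ)) := by
  have hm : 0 < min 1 x := lt_min one_pos hx
  rw [← Real.mul_rpow hm.le (by linarith)]
  refine Real.rpow_le_rpow_of_nonpos (by positivity) ?_ (by linarith)
  have h1 := min_le_left 1 x
  have h2 := min_le_right 1 x
  nlinarith

theorem MemL.integrableOn_abs_mul_rpow_add {σ x : ℝ} {v : ℝ → ℝ} (hσ0 : 0 < σ)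
    (hv : MemL σ v) (hx : 0 < x) :
    IntegrableOn (fun y => |v y| * (x + y) ^ (-(1 + 2 * σ))) (Ioi 0) := by
  refine Integrable.mono' (hv.norm.const_mul ((min 1 x) ^ (-(1 + 2 * σ)))) ?_ ?_
  · have h1 : AEStronglyMeasurable (fun y : ℝ => (x + y) ^ (-(1 + 2 * σ))) (volume.restrict (Ioi 0)) :=
      Measurable.aestronglyMeasurable (by fun_prop)
    exact hv.aestronglyMeasurable.norm.mul h1
  · refine ae_restrict_of_forall_mem measurableSet_Ioi fun y hy => ?_
    have hy0 : 0 < y := hy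
    have hy1 : 0 < (1 + y) ^ (1 + 2 * σ) := Real.rpow_pos_of_pos (by linarith) _
    have h0 : 0 ≤ (x + y) ^ (-(1 + 2 * σ)) := Real.rpow_nonneg (by linarith) _
    have h := rpow_add_le_weight hσ0 hx hy0
    rw [Real.norm_of_nonneg (by positivity), norm_div, Real.norm_of_nonneg hy1.le, Real.norm_eq_abs]
    calc |v y| * (x + y) ^ (-(1 + 2 * σ))
        ≤ |v y| * ((min 1 x) ^ (-(1 + 2 * σ)) * (1 + y) ^ (-(1 + 2 * σ))) := by gcongr
      _ = _ := by rw [Real.rpow_neg (by linarith : 0 ≤ 1 + y)]; ring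

theorem integrable_indicator_ball_rpow {s r : ℝ} (hs : -1 < s) (hr : 0 < r) (x : ℝ) :
    IntegrableOn (fun y => |x - y| ^ s) (Metric.ball x r) ∧
      ∫ y in Metric.ball x r, |x - y| ^ s = 2 / (s + 1) * r ^ (s + 1) := by
  let f : ℝ → ℝ := (Iio r).indicator fun s' => s' ^ s
  have e0 : Iio r ∩ Ioi 0 = Ioo 0 r := by ext z; simp [and_comm]
  have hi : IntegrableOn (fun s' : ℝ => s' ^ s) (Ioo 0 r) := by
    rw [← integrableOn_Ioc_iff_integrableOn_Ioo, ← intervalIntegrable_iff_integrableOn_Ioc_of_le hr.le]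
    exact intervalIntegral.intervalIntegrable_rpow' hs
  have hf : IntegrableOn f (Ioi 0) := by
    rw [IntegrableOn, integrable_indicator_iff measurableSet_Iio, IntegrableOn,
      Measure.restrict_restrict measurableSet_Iio, e0]
    exact hi
  have hfi : ∫ s' in Ioi (0 : ℝ), f s' = 1 / (s + 1) * r ^ (s + 1) := by
    rw [setIntegral_indicator measurableSet_Iio, inter_comm, e0, ← integral_Ioc_eq_integral_Ioo,
      ← intervalIntegral.integral_of_le hr.le, integral_rpow (Or.inl hs),
      Real.zero_rpow (by linarith)]
    ring
  have e1 : (fun y => f |x - y|) = (Metric.ball x r).indicator fun y => |x - y| ^ s := by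
    ext y
    by_cases hy : |x - y| < r
    · rw [indicator_of_mem (by rwa [Metric.mem_ball, dist_comm, Real.dist_eq])]
      exact indicator_of_mem (s := Iio r) hy _
    · rw [indicator_of_notMem (by rwa [Metric.mem_ball, dist_comm, Real.dist_eq])]
      exact indicator_of_notMem (s := Iio r) hy _
  obtain ⟨h1, h2⟩ := integrable_comp_abs_sub hf x
  rw [e1] at h1 h2
  rw [integral_indicator Metric.isOpen_ball.measurableSet, hfi] at h2
  refine ⟨(integrable_indicator_iff Metric.isOpen_ball.measurableSet).mp h1, h2.trans ?_⟩
  ring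

theorem integrable_compl_ball_rpow {σ r : ℝ} (hσ : 0 < σ) (hr : 0 < r) (x : ℝ) :
    IntegrableOn (fun y => |x - y| ^ (-(1 + 2 * σ))) (Metric.ball x r)ᶜ ∧
      ∫ y in (Metric.ball x r)ᶜ, |x - y| ^ (-(1 + 2 * σ)) = 1 / σ * r ^ (-(2 * σ)) := by
  let f : ℝ → ℝ := (Ici r).indicator fun s' => s' ^ (-(1 + 2 * σ))
  have e0 : Ici r ∩ Ioi 0 = Ici r := inter_eq_left.mpr fun z hz => hr.trans_le hz
  have hi : IntegrableOn (fun s' : ℝ => s' ^ (-(1 + 2 * σ))) (Ici r) := by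
    rw [integrableOn_Ici_iff_integrableOn_Ioi]
    exact integrableOn_Ioi_rpow_of_lt (by linarith) hr
  have hf : IntegrableOn f (Ioi 0) := by
    rw [IntegrableOn, integrable_indicator_iff measurableSet_Ici, IntegrableOn,
      Measure.restrict_restrict measurableSet_Ici, e0]
    exact hi
  have hfi : ∫ s' in Ioi (0 : ℝ), f s' = 1 / (2 * σ) * r ^ (-(2 * σ)) := by
    rw [setIntegral_indicator measurableSet_Ici, inter_comm, e0, integral_Ici_eq_integral_Ioi,
      integral_Ioi_rpow_of_lt (by linarith) hr, show -(1 + 2 * σ) + 1 = -(2 * σ) by ring]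
    field_simp
  have e1 : (fun y => f |x - y|) = (Metric.ball x r)ᶜ.indicator fun y => |x - y| ^ (-(1 + 2 * σ)) := by
    ext y
    by_cases hy : r ≤ |x - y|
    · rw [indicator_of_mem (by rwa [mem_compl_iff, Metric.mem_ball, dist_comm, Real.dist_eq, not_lt])]
      exact indicator_of_mem (s := Ici r) hy _
    · rw [indicator_of_notMem (by rwa [mem_compl_iff, Metric.mem_ball, dist_comm, Real.dist_eq, not_lt])]
      exact indicator_of_notMem (s := Ici r) hy _
  obtain ⟨h1, h2⟩ := integrable_comp_abs_sub hf x
  have hms : MeasurableSet (Metric.ball x r)ᶜ := Metric.isOpen_ball.measurableSet.compl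
  rw [e1] at h1 h2
  rw [integral_indicator hms, hfi] at h2
  refine ⟨(integrable_indicator_iff hms).mp h1, h2.trans ?_⟩
  field_simp

/-! ### First-order deviations and the expansion of the semigroup increment -/

/-- The deviation of `v` from its first-order expansion at `x` with slope `p`, where the linear term
is only used for `|y - x| < x / 2`. -/
def nearDev (v : ℝ → ℝ) (p x y : ℝ) : ℝ :=
  v y - v x - (Metric.ball x (x / 2)).indicator (fun y => p * (y - x)) y

theorem measurableSet_ball' (x r : ℝ) : MeasurableSet (Metric.ball x r) :=
  Metric.isOpen_ball.measurableSet

theorem ball_half_subset {x : ℝ} : Metric.ball x (x / 2) ⊆ Ioi 0 := by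
  intro y hy
  rw [Metric.mem_ball, Real.dist_eq, abs_lt] at hy
  rw [mem_Ioi]
  by_contra h
  linarith [hy.1, hy.2]

theorem half_lt_of_mem_ball {x y : ℝ} (hy : y ∈ Metric.ball x (x / 2)) : x / 2 < y := by
  rw [Metric.mem_ball, Real.dist_eq, abs_lt] at hy
  linarith [hy.1]

theorem nearDev_self (v : ℝ → ℝ) (p x : ℝ) : nearDev v p x x = 0 := by
  unfold nearDev
  by_cases h : x ∈ Metric.ball x (x / 2)
  · rw [indicator_of_mem h]; ring
  · rw [indicator_of_notMem h]; ring

theorem MemL.aestronglyMeasurable_nearDev {σ : ℝ} {v : ℝ → ℝ} (hv : MemL σ v) (p x : ℝ) :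
    AEStronglyMeasurable (nearDev v p x) (volume.restrict (Ioi 0)) := by
  have h1 : Measurable ((Metric.ball x (x / 2)).indicator fun y => p * (y - x)) :=
    Measurable.indicator (by fun_prop) (measurableSet_ball' _ _)
  exact (hv.aestronglyMeasurable.sub aestronglyMeasurable_const).sub h1.aestronglyMeasurable

theorem add_le_six_mul_abs_sub {x y : ℝ} (hy : 0 < y)
    (h : y ∉ Metric.ball x (x / 2)) : x + y ≤ 6 * |x - y| := by
  rw [Metric.mem_ball, dist_comm, Real.dist_eq, not_lt] at h
  rcases abs_cases (x - y) with ⟨h1, h2⟩ | ⟨h1, h2⟩ <;> rw [h1] at h ⊢ <;> linarith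

/-- Inside the ball the integrand is at most `A|x-y|^(β-1-2σ)`, integrable because `β > 2σ`. Outside
there is no linear term; the part of `v(x)` integrates to a multiple of `x^(-2σ)`, and in the part
of `v(y)` the distance `|x-y|` is comparable with `x + y`. -/
theorem exists_nearDev_integral_le {σ β : ℝ} (hσ0 : 0 < σ) (hβ : 2 * σ < β) :
    ∃ C : ℝ, 0 < C ∧ ∀ (v : ℝ → ℝ) (p x A : ℝ), MemL σ v → 0 < x → 0 ≤ A →
      (∀ y ∈ Metric.ball x (x / 2), |v y - v x - p * (y - x)| ≤ A * |x - y| ^ β) →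
      IntegrableOn (fun y => |nearDev v p x y| * |x - y| ^ (-(1 + 2 * σ))) (Ioi 0) ∧
      ∫ y in Ioi (0 : ℝ), |nearDev v p x y| * |x - y| ^ (-(1 + 2 * σ)) ≤
        C * (A * x ^ (β - 2 * σ) + |v x| * x ^ (-(2 * σ)) +
          ∫ y in Ioi (0 : ℝ), |v y| * (x + y) ^ (-(1 + 2 * σ))) := by
  have hβ' : 0 < β - 2 * σ := by linarith
  set C₁ := 2 / (β - 2 * σ) with hC₁
  set C₂ := (1 / σ) * 2 ^ (2 * σ) with hC₂
  set C₃ : ℝ := 6 ^ (1 + 2 * σ) with hC₃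
  have h1 : 0 < C₁ := by positivity
  have h2 : 0 < C₂ := by positivity
  have h3 : 0 < C₃ := by positivity
  refine ⟨C₁ + C₂ + C₃, by positivity, fun v p x A hv hx hA hnear => ?_⟩
  have hx2 : 0 < x / 2 := by positivity
  obtain ⟨i1, j1⟩ := integrable_indicator_ball_rpow (s := β - (1 + 2 * σ)) (by linarith) hx2 x
  obtain ⟨i2, j2⟩ := integrable_compl_ball_rpow hσ0 hx2 x
  have hms := measurableSet_ball' x (x / 2)
  let b₁ : ℝ → ℝ := (Metric.ball x (x / 2)).indicator fun y => |x - y| ^ (β - (1 + 2 * σ))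
  let b₂ : ℝ → ℝ := (Metric.ball x (x / 2))ᶜ.indicator fun y => |x - y| ^ (-(1 + 2 * σ))
  have k1 : Integrable b₁ := (integrable_indicator_iff hms).mpr i1
  have k2 : Integrable b₂ := (integrable_indicator_iff hms.compl).mpr i2
  have i3 := hv.integrableOn_abs_mul_rpow_add hσ0 hx
  have n1 : ∀ y, 0 ≤ b₁ y := fun y => indicator_nonneg (fun _ _ => by positivity) _
  have n2 : ∀ y, 0 ≤ b₂ y := fun y => indicator_nonneg (fun _ _ => by positivity) _
  have l1 : ∫ y in Ioi (0 : ℝ), b₁ y ≤ C₁ * x ^ (β - 2 * σ) := by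
    refine (setIntegral_le_integral k1 (Eventually.of_forall n1)).trans ?_
    rw [integral_indicator hms, j1, show β - (1 + 2 * σ) + 1 = β - 2 * σ by ring]
    gcongr
    linarith
  have l2 : ∫ y in Ioi (0 : ℝ), b₂ y ≤ C₂ * x ^ (-(2 * σ)) := by
    refine (setIntegral_le_integral k2 (Eventually.of_forall n2)).trans (le_of_eq ?_)
    rw [integral_indicator hms.compl, j2, Real.div_rpow hx.le two_pos.le, Real.rpow_neg two_pos.le]
    rw [hC₂]; field_simp
  have hbound : ∀ y ∈ Ioi (0 : ℝ), |nearDev v p x y| * |x - y| ^ (-(1 + 2 * σ)) ≤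
      A * b₁ y + |v x| * b₂ y + C₃ * (|v y| * (x + y) ^ (-(1 + 2 * σ))) := by
    intro y hy
    have hy0 : 0 < y := hy
    have t1 : 0 ≤ A * b₁ y := mul_nonneg hA (n1 y)
    have t2 : 0 ≤ |v x| * b₂ y := mul_nonneg (abs_nonneg _) (n2 y)
    have t3 : 0 ≤ C₃ * (|v y| * (x + y) ^ (-(1 + 2 * σ))) := by positivity
    by_cases hb : y ∈ Metric.ball x (x / 2)
    · rcases eq_or_ne y x with rfl | hne
      · rw [nearDev_self]; simp only [abs_zero, zero_mul]; linarith
      · have hpos : 0 < |x - y| := abs_pos.mpr (sub_ne_zero.mpr hne.symm)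
        have h4 : |nearDev v p x y| * |x - y| ^ (-(1 + 2 * σ)) ≤ A * b₁ y := by
          simp only [nearDev, b₁]
          rw [indicator_of_mem hb, indicator_of_mem hb, sub_eq_add_neg β, Real.rpow_add hpos, ← mul_assoc]
          gcongr
          exact hnear y hb
        linarith
    · have h5 := add_le_six_mul_abs_sub hy0 hb
      have hpos : 0 < |x - y| := by linarith
      have h6 : |x - y| ^ (-(1 + 2 * σ)) ≤ C₃ * (x + y) ^ (-(1 + 2 * σ)) := by
        have : (6 * |x - y|) ^ (-(1 + 2 * σ)) ≤ (x + y) ^ (-(1 + 2 * σ)) :=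
          Real.rpow_le_rpow_of_nonpos (by linarith) h5 (by linarith)
        rw [Real.mul_rpow (by norm_num) hpos.le, Real.rpow_neg (by norm_num : (0 : ℝ) ≤ 6)] at this
        calc |x - y| ^ (-(1 + 2 * σ)) = C₃ * ((6 ^ (1 + 2 * σ))⁻¹ * |x - y| ^ (-(1 + 2 * σ))) := by
              rw [hC₃]; field_simp
          _ ≤ _ := by gcongr
      have h7 : |nearDev v p x y| ≤ |v y| + |v x| := by
        rw [nearDev, indicator_of_notMem hb, sub_zero]
        exact abs_sub _ _
      have h8 : b₂ y = |x - y| ^ (-(1 + 2 * σ)) := indicator_of_mem (by exact hb) _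
      calc |nearDev v p x y| * |x - y| ^ (-(1 + 2 * σ))
          ≤ (|v y| + |v x|) * |x - y| ^ (-(1 + 2 * σ)) := by gcongr
        _ = |v y| * |x - y| ^ (-(1 + 2 * σ)) + |v x| * b₂ y := by rw [h8]; ring
        _ ≤ |v y| * (C₃ * (x + y) ^ (-(1 + 2 * σ))) + |v x| * b₂ y := by gcongr
        _ = C₃ * (|v y| * (x + y) ^ (-(1 + 2 * σ))) + |v x| * b₂ y := by ring
        _ ≤ _ := by linarith
  have m1 : Integrable (fun y => A * b₁ y) (volume.restrict (Ioi 0)) := k1.integrableOn.const_mul A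
  have m2 : Integrable (fun y => |v x| * b₂ y) (volume.restrict (Ioi 0)) := k2.integrableOn.const_mul _
  have m3 : Integrable (fun y => C₃ * (|v y| * (x + y) ^ (-(1 + 2 * σ)))) (volume.restrict (Ioi 0)) :=
    i3.const_mul C₃
  have m12 := m1.add m2
  have hint : IntegrableOn (fun y => |nearDev v p x y| * |x - y| ^ (-(1 + 2 * σ))) (Ioi 0) := by
    refine Integrable.mono' (m12.add m3) ?_ ?_
    · have h4 : AEStronglyMeasurable (fun y : ℝ => |x - y| ^ (-(1 + 2 * σ))) (volume.restrict (Ioi 0)) :=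
        Measurable.aestronglyMeasurable (by fun_prop)
      exact (hv.aestronglyMeasurable_nearDev p x).norm.mul h4
    · refine ae_restrict_of_forall_mem measurableSet_Ioi fun y hy => ?_
      rw [Real.norm_of_nonneg (by positivity)]
      exact hbound y hy
  refine ⟨hint, ?_⟩
  have hT : 0 ≤ ∫ y in Ioi (0 : ℝ), |v y| * (x + y) ^ (-(1 + 2 * σ)) :=
    setIntegral_nonneg measurableSet_Ioi fun y hy => by
      have : 0 < y := hy
      positivity
  set T := ∫ y in Ioi (0 : ℝ), |v y| * (x + y) ^ (-(1 + 2 * σ))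
  have hX1 := Real.rpow_nonneg hx.le (β - 2 * σ)
  have hX2 := Real.rpow_nonneg hx.le (-(2 * σ))
  calc ∫ y in Ioi (0 : ℝ), |nearDev v p x y| * |x - y| ^ (-(1 + 2 * σ))
      ≤ ∫ y in Ioi (0 : ℝ), (A * b₁ y + |v x| * b₂ y + C₃ * (|v y| * (x + y) ^ (-(1 + 2 * σ)))) :=
        setIntegral_mono_on hint (m12.add m3) measurableSet_Ioi hbound
    _ = A * (∫ y in Ioi (0 : ℝ), b₁ y) + |v x| * (∫ y in Ioi (0 : ℝ), b₂ y) + C₃ * T := by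
        rw [integral_add (by exact m12) m3, integral_add m1 m2, integral_const_mul, integral_const_mul,
          integral_const_mul]
    _ ≤ A * (C₁ * x ^ (β - 2 * σ)) + |v x| * (C₂ * x ^ (-(2 * σ))) + C₃ * T := by gcongr
    _ ≤ _ := by
        have q1 : 0 ≤ A * x ^ (β - 2 * σ) := by positivity
        have q2 : 0 ≤ |v x| * x ^ (-(2 * σ)) := by positivity
        nlinarith [mul_nonneg h1.le q2, mul_nonneg h1.le hT, mul_nonneg h2.le q1, mul_nonneg h2.le hT,
          mul_nonneg h3.le q1, mul_nonneg h3.le q2]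

theorem integrable_ball_heatKernel_sub {lam t x : ℝ} (hlam : 0 < lam) (ht : 0 < t) (hx : 0 < x) :
    IntegrableOn (fun y => (y - x) * heatKernel lam t x y) (Metric.ball x (x / 2)) ∧
      IntegrableOn (fun y => (y - x) * gaussKer t (x - y)) (Metric.ball x (x / 2)) := by
  have hb : ∀ᵐ y ∂volume.restrict (Metric.ball x (x / 2)), ‖y - x‖ ≤ x / 2 := by
    refine ae_restrict_of_forall_mem (measurableSet_ball' _ _) fun y hy => ?_
    rw [Metric.mem_ball, dist_eq_norm] at hy
    exact hy.le
  have hm : AEStronglyMeasurable (fun y : ℝ => y - x) (volume.restrict (Metric.ball x (x / 2))) :=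
    Measurable.aestronglyMeasurable (by fun_prop)
  exact ⟨((integrableOn_heatKernel hlam ht hx).mono_set ball_half_subset).bdd_mul hm hb,
    (integrable_gaussKer ht x).integrableOn.bdd_mul hm hb⟩

/-- Subtract `v(x)` times the mass of the kernel, and the linear term on the ball. The Gaussian may
be inserted in the linear term because `(y - x) G_t(x - y)` is odd about `x` on a symmetric ball. -/
theorem heatSg_sub_eq {lam σ t x : ℝ} {v : ℝ → ℝ} (hlam : 0 < lam) (hσ0 : 0 < σ) (hσ1 : σ < 1)
    (hv : MemL σ v) (ht : 0 < t) (hx : 0 < x) (p : ℝ) :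
    heatSg lam t v x - v x = (∫ y in Ioi (0 : ℝ), heatKernel lam t x y * nearDev v p x y) +
      p * (∫ y in Metric.ball x (x / 2), (y - x) * (heatKernel lam t x y - gaussKer t (x - y))) +
      v x * (heatOne lam t x - 1) := by
  obtain ⟨i1, i2⟩ := integrable_ball_heatKernel_sub hlam ht hx
  have hms := measurableSet_ball' x (x / 2)
  have i3 := hv.integrableOn_heatKernel_mul hlam hσ0 hσ1 ht hx
  have i4 := (integrableOn_heatKernel hlam ht hx).mul_const (v x)
  have i5 : IntegrableOn ((Metric.ball x (x / 2)).indicator fun y => p * ((y - x) * heatKernel lam t x y))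
      (Ioi 0) := ((integrable_indicator_iff hms).mpr (i1.const_mul p)).integrableOn
  have i34 : Integrable (fun y => heatKernel lam t x y * v y - heatKernel lam t x y * v x)
      (volume.restrict (Ioi 0)) := i3.sub i4
  have e1 : ∫ y in Ioi (0 : ℝ), heatKernel lam t x y * nearDev v p x y =
      heatSg lam t v x - heatOne lam t x * v x -
        p * ∫ y in Metric.ball x (x / 2), (y - x) * heatKernel lam t x y := by
    rw [heatSg, heatOne, ← integral_mul_const, ← integral_sub i3 i4, ← integral_const_mul,
      ← inter_eq_self_of_subset_right (ball_half_subset (x := x)), ← setIntegral_indicator hms,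
      ← integral_sub i34 i5]
    refine setIntegral_congr_fun measurableSet_Ioi fun y _ => ?_
    simp only [nearDev]
    by_cases hb : y ∈ Metric.ball x (x / 2)
    · rw [indicator_of_mem hb, indicator_of_mem hb]; ring
    · rw [indicator_of_notMem hb, indicator_of_notMem hb]; ring
  have e2 : ∫ y in Metric.ball x (x / 2), (y - x) * gaussKer t (x - y) = 0 := by
    have h := setIntegral_odd_eq_zero (S := Metric.ball x (x / 2)) (x := x) hms (fun y => by
      rw [Metric.mem_ball, Metric.mem_ball, dist_comm, Real.dist_eq, Real.dist_eq]
      rw [show x - (2 * x - y) = y - x by ring]) (gaussKer t)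
    rw [← h]
    congr 1; ext y
    simp only [gaussKer, sq_abs]
  have e3 : ∫ y in Metric.ball x (x / 2), (y - x) * (heatKernel lam t x y - gaussKer t (x - y)) =
      ∫ y in Metric.ball x (x / 2), (y - x) * heatKernel lam t x y := by
    simp only [mul_sub]
    rw [integral_sub i1 i2, e2, sub_zero]
  rw [e1, e3]
  ring

/-- The integral of the semigroup increment at a point, and its expression by the kernels. -/
theorem heatSg_time_integral {lam σ : ℝ} (hlam : 0 < lam) (hσ0 : 0 < σ) (hσ1 : σ < 1) :
    ∃ C : ℝ, 0 < C ∧ ∀ (v : ℝ → ℝ) (p x : ℝ), MemL σ v → 0 < x →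
      IntegrableOn (fun y => |nearDev v p x y| * |x - y| ^ (-(1 + 2 * σ))) (Ioi 0) →
      IntegrableOn (fun t => (heatSg lam t v x - v x) / t ^ (1 + σ)) (Ioi 0) ∧
      ∫ t in Ioi (0 : ℝ), |(heatSg lam t v x - v x) / t ^ (1 + σ)| ≤
        C * ((∫ y in Ioi (0 : ℝ), |nearDev v p x y| * |x - y| ^ (-(1 + 2 * σ))) +
          |p| * x ^ (1 - 2 * σ) + |v x| * x ^ (-(2 * σ))) ∧
      IntegrableOn (fun y => nearDev v p x y * fracKernel lam σ x y) (Ioi 0) ∧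
      IntegrableOn (fun y => (y - x) * remKernel lam σ x y) (Metric.ball x (x / 2)) ∧
      1 / Real.Gamma (-σ) * ∫ t in Ioi (0 : ℝ), (heatSg lam t v x - v x) / t ^ (1 + σ) =
        -(∫ y in Ioi (0 : ℝ), nearDev v p x y * fracKernel lam σ x y) -
          p * (∫ y in Metric.ball x (x / 2), (y - x) * remKernel lam σ x y) + v x * fracB lam σ x := by
  obtain ⟨iW, C₁, hC₁0, hC₁⟩ := heatKernel_time_integral hlam hσ0
  obtain ⟨iR, C₂, hC₂0, hC₂⟩ := heatKernel_sub_gaussKer_time_integral hlam hσ0 hσ1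
  obtain ⟨iB, C₃, hC₃0, hC₃⟩ := heatOne_time_integral hlam hσ0 hσ1
  have hG := neg_Gamma_neg_pos hσ0 hσ1
  have hG' : Real.Gamma (-σ) ≠ 0 := by linarith
  refine ⟨C₁ + C₂ * 2 ^ σ + C₃, by positivity, fun v p x hv hx hdev => ?_⟩
  have hpow : ∀ t ∈ Ioi (0 : ℝ), 0 < t ^ (1 + σ) := fun t ht => Real.rpow_pos_of_pos ht _
  let F : ℝ → ℝ → ℝ := fun t y => heatKernel lam t x y / t ^ (1 + σ) * nearDev v p x y
  have hF : Integrable (Function.uncurry F)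
      ((volume.restrict (Ioi (0 : ℝ))).prod (volume.restrict (Ioi (0 : ℝ)))) ∧
      ∫ t in Ioi (0 : ℝ), |∫ y in Ioi (0 : ℝ), F t y| ≤
        ∫ y in Ioi (0 : ℝ), C₁ * (|nearDev v p x y| * |x - y| ^ (-(1 + 2 * σ))) := by
    refine integrable_uncurry_of_section_bound ?_ ?_ (hdev.const_mul C₁) ?_
    · have h1 : Measurable fun q : ℝ × ℝ => heatKernel lam q.1 x q.2 :=
        (measurable_heatKernel hlam).comp (g := fun p : (ℝ × ℝ) × ℝ => heatKernel lam p.1.1 p.1.2 p.2)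
          (f := fun q : ℝ × ℝ => ((q.1, x), q.2)) (by fun_prop)
      have h2 : AEStronglyMeasurable (fun q : ℝ × ℝ => heatKernel lam q.1 x q.2 / q.1 ^ (1 + σ))
          ((volume.restrict (Ioi (0 : ℝ))).prod (volume.restrict (Ioi (0 : ℝ)))) :=
        Measurable.aestronglyMeasurable (by fun_prop)
      exact h2.mul (hv.aestronglyMeasurable_nearDev p x).comp_snd
    · refine ae_restrict_of_forall_mem measurableSet_Ioi fun y hy => ?_
      rcases eq_or_ne x y with rfl | hne
      · simp only [F, nearDev_self, mul_zero]; exact integrable_zero _ _ _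
      · exact (iW x y hx hy hne).mul_const _
    · refine ae_restrict_of_forall_mem measurableSet_Ioi fun y hy => ?_
      rcases eq_or_ne x y with rfl | hne
      · simp [F, nearDev_self]
      · have e1 : ∫ t in Ioi (0 : ℝ), ‖F t y‖ =
            (∫ t in Ioi (0 : ℝ), heatKernel lam t x y / t ^ (1 + σ)) * |nearDev v p x y| := by
          rw [← integral_mul_const]
          refine setIntegral_congr_fun measurableSet_Ioi fun t ht => ?_
          simp only [F]
          rw [norm_mul, Real.norm_of_nonneg
            (div_nonneg (heatKernel_nonneg hlam ht hx hy) (hpow t ht).le), Real.norm_eq_abs]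
        rw [e1]
        calc _ ≤ C₁ * |x - y| ^ (-(1 + 2 * σ)) * |nearDev v p x y| := by
              gcongr; exact hC₁ x y hx hy hne
          _ = _ := by ring
  let R : ℝ → ℝ → ℝ := fun t y => (heatKernel lam t x y - gaussKer t (x - y)) / t ^ (1 + σ) * (y - x)
  have hms := measurableSet_ball' x (x / 2)
  -- The factor `|y - x|` cancels the singularity of the remainder kernel, and `xy ≥ x²/2` on the
  -- ball; the section bound is then a constant, and its integral over a ball of length `x` scales
  -- as `x^(1-2σ)`.
  have hcst : IntegrableOn (fun _ : ℝ => C₂ * (2 ^ σ * x ^ (-(2 * σ)))) (Metric.ball x (x / 2)) :=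
    integrableOn_const measure_ball_lt_top.ne
  have hR : Integrable (Function.uncurry R)
      ((volume.restrict (Ioi (0 : ℝ))).prod (volume.restrict (Metric.ball x (x / 2)))) ∧
      ∫ t in Ioi (0 : ℝ), |∫ y in Metric.ball x (x / 2), R t y| ≤
        ∫ y in Metric.ball x (x / 2), C₂ * (2 ^ σ * x ^ (-(2 * σ))) := by
    refine integrable_uncurry_of_section_bound ?_ ?_ hcst ?_
    · have h1 : Measurable fun q : ℝ × ℝ => heatKernel lam q.1 x q.2 :=
        (measurable_heatKernel hlam).comp (g := fun p : (ℝ × ℝ) × ℝ => heatKernel lam p.1.1 p.1.2 p.2)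
          (f := fun q : ℝ × ℝ => ((q.1, x), q.2)) (by fun_prop)
      have h2 : Measurable fun q : ℝ × ℝ => gaussKer q.1 (x - q.2) :=
        measurable_gaussKer.comp (g := fun p : ℝ × ℝ => gaussKer p.1 p.2)
          (f := fun q : ℝ × ℝ => (q.1, x - q.2)) (by fun_prop)
      exact Measurable.aestronglyMeasurable (by simp only [R, Function.uncurry_def]; fun_prop)
    · refine ae_restrict_of_forall_mem hms fun y hy => ?_
      rcases eq_or_ne x y with rfl | hne
      · simp only [R, sub_self, mul_zero]; exact integrable_zero _ _ _
      · exact (iR x y hx (ball_half_subset hy) hne).mul_const _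
    · refine ae_restrict_of_forall_mem hms fun y hy => ?_
      rcases eq_or_ne x y with rfl | hne
      · simp only [R, sub_self, mul_zero, norm_zero, integral_zero]; positivity
      · have hy0 : 0 < y := ball_half_subset hy
        have e1 : ∫ t in Ioi (0 : ℝ), ‖R t y‖ =
            (∫ t in Ioi (0 : ℝ), |heatKernel lam t x y - gaussKer t (x - y)| / t ^ (1 + σ)) * |y - x| := by
          rw [← integral_mul_const]
          refine setIntegral_congr_fun measurableSet_Ioi fun t ht => ?_
          simp only [R]
          rw [norm_mul, norm_div, Real.norm_of_nonneg (hpow t ht).le, Real.norm_eq_abs, Real.norm_eq_abs]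
        have hd : 0 < |x - y| := abs_pos.mpr (sub_ne_zero.mpr hne)
        have e2 : (x * y) ^ (-σ) ≤ 2 ^ σ * x ^ (-(2 * σ)) := by
          have h1 : x ^ 2 / 2 ≤ x * y := by nlinarith [half_lt_of_mem_ball hy]
          refine (Real.rpow_le_rpow_of_nonpos (by positivity) h1 (by linarith)).trans (le_of_eq ?_)
          rw [Real.div_rpow (by positivity) two_pos.le, ← Real.rpow_natCast, ← Real.rpow_mul hx.le,
            Real.rpow_neg two_pos.le, div_inv_eq_mul, mul_comm]
          congr 2; push_cast; ring
        rw [e1, abs_sub_comm y x]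
        calc _ ≤ C₂ * ((x * y) ^ (-σ) * |x - y|⁻¹) * |x - y| := by
              gcongr; exact hC₂ x y hx hy0 hne
          _ = C₂ * (x * y) ^ (-σ) := by field_simp
          _ ≤ _ := by gcongr
  have hcv : ∫ y in Metric.ball x (x / 2), C₂ * (2 ^ σ * x ^ (-(2 * σ))) =
      C₂ * 2 ^ σ * x ^ (1 - 2 * σ) := by
    rw [setIntegral_const, Measure.real, Real.volume_ball, ENNReal.toReal_ofReal (by positivity),
      smul_eq_mul, show 1 - 2 * σ = -(2 * σ) + 1 by ring, Real.rpow_add_one hx.ne']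
    ring
  -- The increment is the sum of three pieces, each absolutely integrable in `t`; Fubini in the
  -- first two turns the heat kernels into `fracKernel` and `remKernel`.
  have e1 : ∀ t ∈ Ioi (0 : ℝ), (∫ y in Ioi (0 : ℝ), F t y) +
      p * (∫ y in Metric.ball x (x / 2), R t y) + v x * ((heatOne lam t x - 1) / t ^ (1 + σ)) =
      (heatSg lam t v x - v x) / t ^ (1 + σ) := by
    intro t ht
    have e2 : ∫ y in Ioi (0 : ℝ), F t y =
        (∫ y in Ioi (0 : ℝ), heatKernel lam t x y * nearDev v p x y) / t ^ (1 + σ) := by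
      rw [← integral_div]
      refine setIntegral_congr_fun measurableSet_Ioi fun y _ => ?_
      simp only [F]; ring
    have e3 : ∫ y in Metric.ball x (x / 2), R t y =
        (∫ y in Metric.ball x (x / 2), (y - x) * (heatKernel lam t x y - gaussKer t (x - y))) /
          t ^ (1 + σ) := by
      rw [← integral_div]
      refine setIntegral_congr_fun hms fun y _ => ?_
      simp only [R]; ring
    rw [heatSg_sub_eq hlam hσ0 hσ1 hv ht hx p, e2, e3]
    ring
  have j1 : IntegrableOn (fun t => ∫ y in Ioi (0 : ℝ), F t y) (Ioi 0) := hF.1.integral_prod_left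
  have j2 : IntegrableOn (fun t => p * ∫ y in Metric.ball x (x / 2), R t y) (Ioi 0) :=
    hR.1.integral_prod_left.const_mul p
  have j3 : IntegrableOn (fun t => v x * ((heatOne lam t x - 1) / t ^ (1 + σ))) (Ioi 0) :=
    (iB x hx).const_mul _
  have j12 : IntegrableOn (fun t => (∫ y in Ioi (0 : ℝ), F t y) +
      p * ∫ y in Metric.ball x (x / 2), R t y) (Ioi 0) := j1.add j2
  have j123 : IntegrableOn (fun t => (∫ y in Ioi (0 : ℝ), F t y) +
      p * (∫ y in Metric.ball x (x / 2), R t y) + v x * ((heatOne lam t x - 1) / t ^ (1 + σ))) (Ioi 0) :=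
    j12.add j3
  have hint : IntegrableOn (fun t => (heatSg lam t v x - v x) / t ^ (1 + σ)) (Ioi 0) :=
    IntegrableOn.congr_fun j123 e1 measurableSet_Ioi
  have s1 := integral_integral_swap hF.1
  have s2 := integral_integral_swap hR.1
  have e4 : ∀ y, ∫ t in Ioi (0 : ℝ), F t y = -Real.Gamma (-σ) * (nearDev v p x y * fracKernel lam σ x y) := by
    intro y
    simp only [F]
    rw [integral_mul_const, fracKernel]
    field_simp
  have e5 : ∀ y, ∫ t in Ioi (0 : ℝ), R t y = -Real.Gamma (-σ) * ((y - x) * remKernel lam σ x y) := by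
    intro y
    simp only [R]
    rw [integral_mul_const, remKernel]
    field_simp
  have k1 : IntegrableOn (fun y => nearDev v p x y * fracKernel lam σ x y) (Ioi 0) := by
    have h : IntegrableOn (fun y => ∫ t in Ioi (0 : ℝ), F t y) (Ioi 0) := hF.1.integral_prod_right
    simp only [e4] at h
    refine IntegrableOn.congr_fun (h.const_mul (-Real.Gamma (-σ))⁻¹) (fun y _ => ?_) measurableSet_Ioi
    rw [inv_mul_cancel_left₀ hG.ne']
  have k2 : IntegrableOn (fun y => (y - x) * remKernel lam σ x y) (Metric.ball x (x / 2)) := by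
    have h : IntegrableOn (fun y => ∫ t in Ioi (0 : ℝ), R t y) (Metric.ball x (x / 2)) :=
      hR.1.integral_prod_right
    simp only [e5] at h
    refine IntegrableOn.congr_fun (h.const_mul (-Real.Gamma (-σ))⁻¹) (fun y _ => ?_) hms
    rw [inv_mul_cancel_left₀ hG.ne']
  refine ⟨hint, ?_, k1, k2, ?_⟩
  · have e6 : ∫ t in Ioi (0 : ℝ), |(heatSg lam t v x - v x) / t ^ (1 + σ)| ≤
        ∫ t in Ioi (0 : ℝ), (|∫ y in Ioi (0 : ℝ), F t y| +
          |p| * |∫ y in Metric.ball x (x / 2), R t y| +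
          |v x| * (|heatOne lam t x - 1| / t ^ (1 + σ))) := by
      have j3' : IntegrableOn (fun t => |v x| * (|heatOne lam t x - 1| / t ^ (1 + σ))) (Ioi 0) := by
        refine IntegrableOn.congr_fun ((iB x hx).abs.const_mul |v x|) (fun t ht => ?_) measurableSet_Ioi
        rw [abs_div, abs_of_pos (hpow t ht)]
      refine setIntegral_mono_on hint.abs ((j1.abs.add
        (hR.1.integral_prod_left.abs.const_mul |p|)).add j3') measurableSet_Ioi fun t ht => ?_
      rw [← e1 t ht]
      refine (abs_add_three _ _ _).trans (le_of_eq ?_)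
      rw [abs_mul, abs_mul, abs_div, abs_of_pos (hpow t ht)]
    refine e6.trans ?_
    have j3' : IntegrableOn (fun t => |v x| * (|heatOne lam t x - 1| / t ^ (1 + σ))) (Ioi 0) := by
      refine IntegrableOn.congr_fun ((iB x hx).abs.const_mul |v x|) (fun t ht => ?_) measurableSet_Ioi
      rw [abs_div, abs_of_pos (hpow t ht)]
    have j2' : IntegrableOn (fun t => |p| * |∫ y in Metric.ball x (x / 2), R t y|) (Ioi 0) :=
      hR.1.integral_prod_left.abs.const_mul |p|
    have j12' : IntegrableOn (fun t => |∫ y in Ioi (0 : ℝ), F t y| +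
        |p| * |∫ y in Metric.ball x (x / 2), R t y|) (Ioi 0) := j1.abs.add j2'
    rw [integral_add j12' j3', integral_add j1.abs j2', integral_const_mul, integral_const_mul]
    have q1 := hF.2
    have q2 := hR.2
    rw [hcv] at q2
    rw [integral_const_mul] at q1
    have q3 := hC₃ x hx
    have hI : 0 ≤ ∫ y in Ioi (0 : ℝ), |nearDev v p x y| * |x - y| ^ (-(1 + 2 * σ)) :=
      integral_nonneg fun y => by positivity
    set I := ∫ y in Ioi (0 : ℝ), |nearDev v p x y| * |x - y| ^ (-(1 + 2 * σ))
    have hP : 0 ≤ |p| * x ^ (1 - 2 * σ) := by positivity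
    have hV : 0 ≤ |v x| * x ^ (-(2 * σ)) := by positivity
    have hK : 0 ≤ C₂ * 2 ^ σ := by positivity
    calc _ ≤ C₁ * I + |p| * (C₂ * 2 ^ σ * x ^ (1 - 2 * σ)) + |v x| * (C₃ * x ^ (-(2 * σ))) := by gcongr
      _ = C₁ * I + C₂ * 2 ^ σ * (|p| * x ^ (1 - 2 * σ)) + C₃ * (|v x| * x ^ (-(2 * σ))) := by ring
      _ ≤ _ := by
        nlinarith [mul_nonneg hC₁0.le hP, mul_nonneg hC₁0.le hV, mul_nonneg hK hI, mul_nonneg hK hV,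
          mul_nonneg hC₃0.le hI, mul_nonneg hC₃0.le hP]
  · rw [← setIntegral_congr_fun measurableSet_Ioi e1, integral_add j12 j3, integral_add j1 j2,
      integral_const_mul, integral_const_mul, s1, s2]
    simp only [e4, e5]
    rw [integral_const_mul, integral_const_mul, fracB]
    field_simp
    ring

/-! ### Taylor estimates and increments of test functions -/

/-- The mean value inequality for `z ↦ v(z) - v'(x) z` on the closed ball of radius `|x - y|`, where
its derivative is at most `A|x-y|^α`. -/
theorem abs_sub_sub_deriv_mul_le {v v' : ℝ → ℝ} {x y A α : ℝ} (hα : 0 ≤ α) (hA0 : 0 ≤ A)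
    (hd : ∀ z, |x - z| ≤ |x - y| → HasDerivAt v (v' z) z)
    (hA : ∀ z, |x - z| ≤ |x - y| → |v' z - v' x| ≤ A * |x - z| ^ α) :
    |v y - v x - v' x * (y - x)| ≤ A * |x - y| ^ (1 + α) := by
  have hmem : ∀ z, z ∈ Metric.closedBall x |x - y| → |x - z| ≤ |x - y| := fun z hz => by
    rwa [Metric.mem_closedBall, dist_comm, Real.dist_eq] at hz
  have h := (convex_closedBall x |x - y|).norm_image_sub_le_of_norm_hasDerivWithin_le
    (f := fun z => v z - v' x * z) (f' := fun z => v' z - v' x) (C := A * |x - y| ^ α)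
    (x := x) (y := y) (fun z hz => ?_) (fun z hz => ?_) (Metric.mem_closedBall_self (abs_nonneg _)) ?_
  · rw [Real.norm_eq_abs, Real.norm_eq_abs, abs_sub_comm y x] at h
    rw [Real.rpow_one_add' (abs_nonneg _) (by linarith), mul_comm |x - y|, ← mul_assoc]
    refine le_trans (le_of_eq ?_) h
    congr 1; ring
  · have := (hd z (hmem z hz)).sub ((hasDerivAt_id' z).const_mul (v' x))
    rw [mul_one] at this
    exact this.hasDerivWithinAt
  · rw [Real.norm_eq_abs]
    refine (hA z (hmem z hz)).trans ?_
    have := hmem z hz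
    gcongr
  · rw [Metric.mem_closedBall, dist_comm, Real.dist_eq]

theorem rpow_mul_mul_le {a b N M C w x : ℝ} (hx : 0 < x) (hb : 0 ≤ b) (hM : N + b ≤ M) (hC : 0 ≤ C)
    (h : |w| ≤ C * (1 + x) ^ (-M)) :
    |x ^ (a + b) * w| ≤ C * (x ^ a * (1 + x) ^ (-N)) := by
  have h1 : 1 ≤ 1 + x := by linarith
  rw [abs_mul, abs_of_pos (Real.rpow_pos_of_pos hx _), Real.rpow_add hx]
  have h2 : x ^ b ≤ (1 + x) ^ b := Real.rpow_le_rpow hx.le (by linarith) hb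
  calc x ^ a * x ^ b * |w| ≤ x ^ a * (1 + x) ^ b * (C * (1 + x) ^ (-M)) := by gcongr
    _ = C * (x ^ a * (1 + x) ^ (b - M)) := by
        rw [sub_eq_add_neg, Real.rpow_add (by linarith)]; ring
    _ ≤ _ := by
        gcongr
        linarith

/-- Test functions and their first two derivatives are bounded by powers at `0` and decay rapidly. -/
theorem testSpace_deriv_bounds {lam : ℝ} {φ : ℝ → ℝ} (hφ : φ ∈ testSpace lam) :
    ∃ φ₁ φ₂ : ℝ → ℝ, (∀ x : ℝ, 0 < x → HasDerivAt φ (φ₁ x) x) ∧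
      (∀ x : ℝ, 0 < x → HasDerivAt φ₁ (φ₂ x) x) ∧
      ∀ N : ℝ, ∃ C : ℝ, 0 < C ∧ ∀ x : ℝ, 0 < x →
        |φ x| ≤ C * (x ^ lam * (1 + x) ^ (-N)) ∧ |φ₁ x| ≤ C * (x ^ (lam - 1) * (1 + x) ^ (-N)) ∧
        |φ₂ x| ≤ C * (x ^ (lam - 2) * (1 + x) ^ (-N)) := by
  obtain ⟨f, hf, hd, hφf⟩ := testSpace_structure hφ
  refine ⟨fun x => lam * (x ^ (lam - 1) * f 0 x) + x ^ (lam + 1) * f 1 x,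
    fun x => lam * (lam - 1) * (x ^ (lam - 2) * f 0 x) + (2 * lam + 1) * (x ^ lam * f 1 x) +
      x ^ (lam + 2) * f 2 x, fun x hx => ?_, fun x hx => ?_, fun N => ?_⟩
  · have h1 := (Real.hasDerivAt_rpow_const (p := lam) (Or.inl hx.ne')).mul (hd 0 x hx)
    refine HasDerivAt.congr_of_eventuallyEq (h1.congr_deriv ?_) ?_
    · simp only [zero_add]
      rw [Real.rpow_add_one hx.ne']; ring
    · filter_upwards [lt_mem_nhds hx] with z hz
      simp [hφf z hz]
  · have h1 := (((Real.hasDerivAt_rpow_const (p := lam - 1) (Or.inl hx.ne')).mul (hd 0 x hx)).const_mul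
      lam).add ((Real.hasDerivAt_rpow_const (p := lam + 1) (Or.inl hx.ne')).mul (hd 1 x hx))
    refine h1.congr_deriv ?_
    simp only [zero_add, one_add_one_eq_two]
    rw [show lam + 2 = lam + 1 + 1 by ring, Real.rpow_add_one hx.ne' (lam + 1),
      show lam - 1 - 1 = lam - 2 by ring, show lam + 1 - 1 = lam by ring,
      show x ^ lam = x ^ (lam - 1) * x by rw [← Real.rpow_add_one hx.ne', sub_add_cancel]]
    ring
  -- Four extra orders of decay suffice: the worst term is `x^(λ+2) f 2`, to be bounded by
  -- `x^(λ-2)`.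
  · obtain ⟨C₀, h00, h0⟩ := (hf 0).exists_le (N + 4)
    obtain ⟨C₁, h10, h1⟩ := (hf 1).exists_le (N + 4)
    obtain ⟨C₂, h20, h2⟩ := (hf 2).exists_le (N + 4)
    refine ⟨C₀ + (|lam| * C₀ + C₁) + (|lam * (lam - 1)| * C₀ + |2 * lam + 1| * C₁ + C₂),
      by positivity, fun x hx => ⟨?_, ?_, ?_⟩⟩
    · have b0 := rpow_mul_mul_le (a := lam) (b := 0) (N := N) hx le_rfl (by linarith) h00.le (h0 x hx)
      rw [add_zero] at b0
      rw [hφf x hx]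
      refine b0.trans ?_
      gcongr
      have : 0 ≤ |lam| * C₀ + C₁ + (|lam * (lam - 1)| * C₀ + |2 * lam + 1| * C₁ + C₂) := by positivity
      linarith
    · have b0 := rpow_mul_mul_le (a := lam - 1) (b := 0) (N := N) hx le_rfl (by linarith) h00.le (h0 x hx)
      have b1 := rpow_mul_mul_le (a := lam - 1) (b := 2) (N := N) hx (by norm_num) (by linarith) h10.le
        (h1 x hx)
      rw [add_zero] at b0
      rw [show lam - 1 + 2 = lam + 1 by ring] at b1
      have hQ : 0 ≤ x ^ (lam - 1) * (1 + x) ^ (-N) := by positivity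
      set Q := x ^ (lam - 1) * (1 + x) ^ (-N)
      refine (abs_add_le _ _).trans ?_
      rw [abs_mul]
      calc _ ≤ |lam| * (C₀ * Q) + C₁ * Q := by gcongr
        _ = (|lam| * C₀ + C₁) * Q := by ring
        _ ≤ _ := by
          refine mul_le_mul_of_nonneg_right ?_ hQ
          have : 0 ≤ C₀ + (|lam * (lam - 1)| * C₀ + |2 * lam + 1| * C₁ + C₂) := by positivity
          linarith
    · have b0 := rpow_mul_mul_le (a := lam - 2) (b := 0) (N := N) hx le_rfl (by linarith) h00.le (h0 x hx)
      have b1 := rpow_mul_mul_le (a := lam - 2) (b := 2) (N := N) hx (by norm_num) (by linarith) h10.le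
        (h1 x hx)
      have b2 := rpow_mul_mul_le (a := lam - 2) (b := 4) (N := N) hx (by norm_num) (by linarith) h20.le
        (h2 x hx)
      rw [add_zero] at b0
      rw [show lam - 2 + 2 = lam by ring] at b1
      rw [show lam - 2 + 4 = lam + 2 by ring] at b2
      have hQ : 0 ≤ x ^ (lam - 2) * (1 + x) ^ (-N) := by positivity
      set Q := x ^ (lam - 2) * (1 + x) ^ (-N)
      refine (abs_add_three _ _ _).trans ?_
      rw [abs_mul, abs_mul (2 * lam + 1)]
      calc _ ≤ |lam * (lam - 1)| * (C₀ * Q) + |2 * lam + 1| * (C₁ * Q) + C₂ * Q := by gcongr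
        _ = (|lam * (lam - 1)| * C₀ + |2 * lam + 1| * C₁ + C₂) * Q := by ring
        _ ≤ _ := by
          refine mul_le_mul_of_nonneg_right ?_ hQ
          have : 0 ≤ C₀ + (|lam| * C₀ + C₁) := by positivity
          linarith

theorem testSpace_exists_le {lam : ℝ} {φ : ℝ → ℝ} (hφ : φ ∈ testSpace lam) (N : ℝ) :
    ∃ C : ℝ, 0 < C ∧ ∀ x : ℝ, 0 < x → |φ x| ≤ C * (x ^ lam * (1 + x) ^ (-N)) := by
  obtain ⟨_, _, _, _, h⟩ := testSpace_deriv_bounds hφ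
  obtain ⟨C, hC, h⟩ := h N
  exact ⟨C, hC, fun x hx => (h x hx).1⟩

theorem testSpace_aestronglyMeasurable {lam : ℝ} {φ : ℝ → ℝ} (hφ : φ ∈ testSpace lam) :
    AEStronglyMeasurable φ (volume.restrict (Ioi 0)) :=
  hφ.1.continuousOn.aestronglyMeasurable measurableSet_Ioi

theorem testSpace_integrableOn_mul_rpow {lam a b : ℝ} {φ : ℝ → ℝ} (hφ : φ ∈ testSpace lam)
    (ha : -1 < lam + a) : IntegrableOn (fun x => x ^ a * (1 + x) ^ b * |φ x|) (Ioi 0) := by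
  obtain ⟨C, hC0, hC⟩ := testSpace_exists_le hφ (b + (lam + a + 2))
  refine Integrable.mono' ((integrableOn_rpow_mul_one_add_rpow ha
    (show lam + a + 1 < lam + a + 2 by linarith)).const_mul C) ?_ ?_
  · have h1 : AEStronglyMeasurable (fun x : ℝ => x ^ a * (1 + x) ^ b) (volume.restrict (Ioi 0)) :=
      Measurable.aestronglyMeasurable (by fun_prop)
    exact h1.mul (testSpace_aestronglyMeasurable hφ).norm
  · refine ae_restrict_of_forall_mem measurableSet_Ioi fun x hx => ?_
    have hx0 : 0 < x := hx
    have h1 : 0 < 1 + x := by linarith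
    rw [Real.norm_of_nonneg (by positivity)]
    calc x ^ a * (1 + x) ^ b * |φ x|
        ≤ x ^ a * (1 + x) ^ b * (C * (x ^ lam * (1 + x) ^ (-(b + (lam + a + 2))))) := by
          gcongr; exact hC x hx
      _ = C * (x ^ (lam + a) * (1 + x) ^ (-(lam + a + 2))) := by
          rw [neg_add, Real.rpow_add h1, Real.rpow_add hx0 lam, Real.rpow_neg h1.le b]
          have : 0 < (1 + x) ^ b := Real.rpow_pos_of_pos h1 _
          field_simp

theorem testSpace_memL {lam σ : ℝ} {φ : ℝ → ℝ} (hlam : 0 < lam) (hφ : φ ∈ testSpace lam) :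
    MemL σ φ := by
  have h := testSpace_integrableOn_mul_rpow (a := 0) (b := -(1 + 2 * σ)) hφ (by linarith)
  refine Integrable.mono' h ?_ ?_
  · have h1 : AEStronglyMeasurable (fun x : ℝ => ((1 + x) ^ (1 + 2 * σ))⁻¹) (volume.restrict (Ioi 0)) :=
      Measurable.aestronglyMeasurable (by fun_prop)
    simp only [div_eq_mul_inv]
    exact (testSpace_aestronglyMeasurable hφ).mul h1
  · refine ae_restrict_of_forall_mem measurableSet_Ioi fun x hx => ?_
    have hx0 : 0 < x := hx
    have h1 : 0 < 1 + x := by linarith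
    rw [norm_div, Real.norm_of_nonneg (Real.rpow_nonneg h1.le _), Real.norm_eq_abs, Real.rpow_zero,
      one_mul, Real.rpow_neg h1.le, div_eq_inv_mul]

theorem rpow_mem_ball_le {x z a : ℝ} (hz : z ∈ Metric.ball x (x / 2)) :
    z ^ a ≤ 2 ^ |a| * x ^ a := by
  have hx := half_lt_of_mem_ball hz
  rw [Metric.mem_ball, Real.dist_eq, abs_lt] at hz
  have hx0 : 0 < x := by linarith [hz.1, hz.2]
  have hz0 : 0 < z := by linarith
  rw [← div_le_iff₀ (by positivity), ← Real.div_rpow hz0.le hx0.le]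
  rcases le_total (z / x) 1 with h | h
  · refine rpow_le_two_rpow_abs a ?_ h
    rw [le_div_iff₀ hx0]; linarith
  · calc (z / x) ^ a ≤ (z / x) ^ |a| := Real.rpow_le_rpow_of_exponent_le h (le_abs_self a)
      _ ≤ 2 ^ |a| := by
        refine Real.rpow_le_rpow (by positivity) ?_ (abs_nonneg a)
        rw [div_le_iff₀ hx0]; linarith [hz.2]

theorem one_add_rpow_mem_ball_le {x z a : ℝ} (hz : z ∈ Metric.ball x (x / 2)) :
    (1 + z) ^ a ≤ 2 ^ |a| * (1 + x) ^ a := by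
  refine rpow_mem_ball_le ?_
  rw [Metric.mem_ball, Real.dist_eq] at hz ⊢
  rw [add_sub_add_left_eq_sub]
  linarith

/-- The near-diagonal deviation of a test function. -/
theorem testSpace_taylor {lam : ℝ} {φ : ℝ → ℝ} (hφ : φ ∈ testSpace lam) (N : ℝ) :
    ∃ (φ₁ : ℝ → ℝ) (C : ℝ), 0 < C ∧ ∀ x : ℝ, 0 < x →
      |φ x| ≤ C * (x ^ lam * (1 + x) ^ (-N)) ∧ |φ₁ x| ≤ C * (x ^ (lam - 1) * (1 + x) ^ (-N)) ∧
      ∀ y ∈ Metric.ball x (x / 2), |φ y - φ x - φ₁ x * (y - x)| ≤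
        C * (x ^ (lam - 2) * (1 + x) ^ (-N)) * |x - y| ^ (2 : ℝ) := by
  obtain ⟨φ₁, φ₂, hd, hd₁, hb⟩ := testSpace_deriv_bounds hφ
  obtain ⟨C, hC0, hC⟩ := hb N
  have hK : (1 : ℝ) ≤ 2 ^ |lam - 2| * 2 ^ |-N| :=
    one_le_mul_of_one_le_of_one_le (Real.one_le_rpow one_le_two (abs_nonneg _))
      (Real.one_le_rpow one_le_two (abs_nonneg _))
  set K : ℝ := 2 ^ |lam - 2| * 2 ^ |-N| with hKdef
  refine ⟨φ₁, C * K, by positivity, fun x hx => ?_⟩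
  have hCK : C ≤ C * K := le_mul_of_one_le_right hC0.le hK
  obtain ⟨b0, b1, -⟩ := hC x hx
  refine ⟨b0.trans (by gcongr), b1.trans (by gcongr), fun y hy => ?_⟩
  have hball : ∀ z, |x - z| ≤ |x - y| → z ∈ Metric.ball x (x / 2) := fun z hz => by
    rw [Metric.mem_ball, dist_comm, Real.dist_eq] at hy ⊢
    exact hz.trans_lt hy
  have h2 : ∀ z ∈ Metric.ball x (x / 2), |φ₂ z| ≤ C * K * (x ^ (lam - 2) * (1 + x) ^ (-N)) := by
    intro z hz
    have hz0 : 0 < z := ball_half_subset hz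
    refine (hC z hz0).2.2.trans ?_
    calc C * (z ^ (lam - 2) * (1 + z) ^ (-N))
        ≤ C * ((2 ^ |lam - 2| * x ^ (lam - 2)) * (2 ^ |-N| * (1 + x) ^ (-N))) := by
          gcongr
          · exact rpow_mem_ball_le hz
          · exact one_add_rpow_mem_ball_le hz
      _ = _ := by rw [hKdef]; ring
  have h := abs_sub_sub_deriv_mul_le (v := φ) (v' := φ₁) (x := x) (y := y) (α := 1)
    (A := C * K * (x ^ (lam - 2) * (1 + x) ^ (-N))) zero_le_one (by positivity)
    (fun z hz => hd z (ball_half_subset (hball z hz))) (fun z hz => ?_)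
  · rwa [one_add_one_eq_two] at h
  · rw [Real.rpow_one, abs_sub_comm x z]
    have hmem := hball z hz
    exact (convex_ball x (x / 2)).norm_image_sub_le_of_norm_hasDerivWithin_le
      (fun w hw => (hd₁ w (ball_half_subset hw)).hasDerivWithinAt) h2
      (Metric.mem_ball_self (by linarith)) hmem

/-- By `x + y ≥ min(1, y)(1 + x)` the decay in `x` is extracted at the price of `min(1, y)^(-1-2σ)`.
This is integrable against `φ = O(y^λ)` at the origin because `λ > 2σ`. -/
theorem testSpace_tail_integral {lam σ : ℝ} {φ : ℝ → ℝ} (hσ0 : 0 < σ) (hlam : 2 * σ < lam)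
    (hφ : φ ∈ testSpace lam) :
    ∃ C : ℝ, 0 < C ∧ ∀ x : ℝ, 0 < x →
      ∫ y in Ioi (0 : ℝ), |φ y| * (x + y) ^ (-(1 + 2 * σ)) ≤ C * (1 + x) ^ (-(1 + 2 * σ)) := by
  have i1 := testSpace_integrableOn_mul_rpow (a := 0) (b := 0) hφ (by linarith)
  have i2 := testSpace_integrableOn_mul_rpow (a := -(1 + 2 * σ)) (b := 0) hφ (by linarith)
  simp only [Real.rpow_zero, mul_one, one_mul] at i1 i2
  have i12 : IntegrableOn (fun y => |φ y| + y ^ (-(1 + 2 * σ)) * |φ y|) (Ioi 0) := i1.add i2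
  have hI : 0 ≤ ∫ y in Ioi (0 : ℝ), (|φ y| + y ^ (-(1 + 2 * σ)) * |φ y|) :=
    setIntegral_nonneg measurableSet_Ioi fun y hy => by
      have : 0 < y := hy
      positivity
  refine ⟨(∫ y in Ioi (0 : ℝ), (|φ y| + y ^ (-(1 + 2 * σ)) * |φ y|)) + 1, by positivity,
    fun x hx => ?_⟩
  have h1 : ∫ y in Ioi (0 : ℝ), |φ y| * (x + y) ^ (-(1 + 2 * σ)) ≤
      ∫ y in Ioi (0 : ℝ), (|φ y| + y ^ (-(1 + 2 * σ)) * |φ y|) * (1 + x) ^ (-(1 + 2 * σ)) := by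
    refine setIntegral_mono_on ((testSpace_memL (by linarith) hφ).integrableOn_abs_mul_rpow_add hσ0 hx)
      (i12.mul_const _) measurableSet_Ioi fun y hy => ?_
    have hy0 : 0 < y := hy
    have h2 := rpow_add_le_weight hσ0 hy0 hx
    rw [add_comm y x] at h2
    have h3 : (min 1 y) ^ (-(1 + 2 * σ)) ≤ 1 + y ^ (-(1 + 2 * σ)) := by
      rcases min_choice 1 y with h | h <;> rw [h]
      · rw [Real.one_rpow]
        linarith [Real.rpow_nonneg hy0.le (-(1 + 2 * σ))]
      · linarith
    calc |φ y| * (x + y) ^ (-(1 + 2 * σ))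
        ≤ |φ y| * ((1 + y ^ (-(1 + 2 * σ))) * (1 + x) ^ (-(1 + 2 * σ))) := by
          gcongr
          refine h2.trans ?_
          gcongr
      _ = _ := by ring
  refine h1.trans ?_
  rw [integral_mul_const]
  gcongr
  linarith

theorem rpow_mul_one_add_rpow_le {x a s N : ℝ} (hx : 0 < x) (ha : 0 ≤ a) (hN : a + s ≤ N) :
    x ^ a * (1 + x) ^ (-N) ≤ (1 + x) ^ (-s) := by
  have h1 : 0 < 1 + x := by linarith
  calc x ^ a * (1 + x) ^ (-N) ≤ (1 + x) ^ a * (1 + x) ^ (-N) := by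
        gcongr; linarith
    _ = (1 + x) ^ (a - N) := by rw [sub_eq_add_neg, Real.rpow_add h1]
    _ ≤ _ := Real.rpow_le_rpow_of_exponent_le (by linarith) (by linarith)

/-- The semigroup increment of a test function, integrated in time. -/
theorem testSpace_heatSg_time_integral {lam σ : ℝ} {φ : ℝ → ℝ} (hσ0 : 0 < σ) (hσ1 : σ < 1)
    (hlam : 2 * σ < lam) (hφ : φ ∈ testSpace lam) :
    (∀ x : ℝ, 0 < x → IntegrableOn (fun t => (heatSg lam t φ x - φ x) / t ^ (1 + σ)) (Ioi 0)) ∧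
    ∃ C : ℝ, 0 < C ∧ ∀ x : ℝ, 0 < x →
      ∫ t in Ioi (0 : ℝ), |(heatSg lam t φ x - φ x) / t ^ (1 + σ)| ≤
        C * (1 + x) ^ (-(1 + 2 * σ)) := by
  have hlam0 : 0 < lam := by linarith
  have hL := testSpace_memL (σ := σ) hlam0 hφ
  obtain ⟨φ₁, C, hC0, hC⟩ := testSpace_taylor hφ (lam + 1)
  obtain ⟨C₁, hC₁0, hC₁⟩ := heatSg_time_integral hlam0 hσ0 hσ1
  obtain ⟨C₂, hC₂0, hC₂⟩ := exists_nearDev_integral_le (β := 2) hσ0 (by linarith)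
  obtain ⟨C₃, hC₃0, hC₃⟩ := testSpace_tail_integral hσ0 hlam hφ
  have key := fun (x : ℝ) (hx : 0 < x) => hC₂ φ (φ₁ x) x (C * (x ^ (lam - 2) * (1 + x) ^ (-(lam + 1))))
    hL hx (by positivity) (hC x hx).2.2
  refine ⟨fun x hx => (hC₁ φ (φ₁ x) x hL hx (key x hx).1).1,
    C₁ * (C₂ * (C + C + C₃) + C + C), by positivity, fun x hx => ?_⟩
  obtain ⟨b0, b1, -⟩ := hC x hx
  have hx1 : 0 < 1 + x := by linarith
  -- The terms from `φ`, its slope and its Taylor error all reduce to `x^(λ-2σ)(1+x)^(-(λ+1))`. The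
  -- decay order `λ + 1` is `(λ-2σ) + (1+2σ)`, just enough to match the weight of `L_σ`.
  have hQ := rpow_mul_one_add_rpow_le (x := x) (a := lam - 2 * σ) (s := 1 + 2 * σ) (N := lam + 1) hx
    (by linarith) (by linarith)
  set Q := (1 + x) ^ (-(1 + 2 * σ))
  have d0 : |φ x| * x ^ (-(2 * σ)) ≤ C * Q := by
    calc |φ x| * x ^ (-(2 * σ)) ≤ C * (x ^ lam * (1 + x) ^ (-(lam + 1))) * x ^ (-(2 * σ)) := by gcongr
      _ = C * (x ^ (lam - 2 * σ) * (1 + x) ^ (-(lam + 1))) := by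
          rw [sub_eq_add_neg, Real.rpow_add hx]; ring
      _ ≤ _ := by gcongr
  have d1 : |φ₁ x| * x ^ (1 - 2 * σ) ≤ C * Q := by
    calc |φ₁ x| * x ^ (1 - 2 * σ)
        ≤ C * (x ^ (lam - 1) * (1 + x) ^ (-(lam + 1))) * x ^ (1 - 2 * σ) := by gcongr
      _ = C * (x ^ (lam - 2 * σ) * (1 + x) ^ (-(lam + 1))) := by
          rw [show lam - 2 * σ = (lam - 1) + (1 - 2 * σ) by ring, Real.rpow_add hx]; ring
      _ ≤ _ := by gcongr
  have d2 : C * (x ^ (lam - 2) * (1 + x) ^ (-(lam + 1))) * x ^ (2 - 2 * σ) ≤ C * Q := by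
    calc _ = C * (x ^ (lam - 2 * σ) * (1 + x) ^ (-(lam + 1))) := by
          rw [show lam - 2 * σ = (lam - 2) + (2 - 2 * σ) by ring, Real.rpow_add hx]; ring
      _ ≤ _ := by gcongr
  refine (hC₁ φ (φ₁ x) x hL hx (key x hx).1).2.1.trans ?_
  calc _ ≤ C₁ * (C₂ * (C * Q + C * Q + C₃ * Q) + C * Q + C * Q) := by
        gcongr
        refine (key x hx).2.trans ?_
        gcongr
        exact hC₃ x hx
    _ = _ := by ring

/-! ### Transposition to functions in `L_σ` -/

theorem aestronglyMeasurable_heatSg {lam : ℝ} {v : ℝ → ℝ} (hlam : 0 < lam)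
    (hv : AEStronglyMeasurable v (volume.restrict (Ioi 0))) :
    AEStronglyMeasurable (fun q : ℝ × ℝ => heatSg lam q.1 v q.2)
      ((volume.restrict (Ioi (0 : ℝ))).prod (volume.restrict (Ioi (0 : ℝ)))) := by
  have h : AEStronglyMeasurable (fun q : (ℝ × ℝ) × ℝ => heatKernel lam q.1.1 q.1.2 q.2 * v q.2)
      (((volume.restrict (Ioi (0 : ℝ))).prod (volume.restrict (Ioi (0 : ℝ)))).prod
        (volume.restrict (Ioi (0 : ℝ)))) :=
    (measurable_heatKernel hlam).aestronglyMeasurable.mul hv.comp_snd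
  exact h.integral_prod_right'

theorem integrable_heatKernel_mul_mul {lam σ t : ℝ} {u φ : ℝ → ℝ} (hlam : 0 < lam) (hσ0 : 0 < σ)
    (hσ1 : σ < 1) (hu : MemL σ u) (hφ : φ ∈ testSpace lam) (ht : 0 < t) :
    Integrable (Function.uncurry fun x y => u x * (heatKernel lam t x y * φ y))
      ((volume.restrict (Ioi (0 : ℝ))).prod (volume.restrict (Ioi (0 : ℝ)))) := by
  obtain ⟨C, hC1, hC⟩ := heatKernel_le hlam
  obtain ⟨C', hC0', hC'⟩ := exists_gaussKer_le_weight hσ0 hσ1 ht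
  have i1 := testSpace_integrableOn_mul_rpow (a := 0) (b := 1 + 2 * σ) hφ (by linarith)
  have i2 := (hu.norm.mul_prod i1).const_mul (C * C')
  refine Integrable.mono' i2 ?_ ?_
  · have h1 : Measurable fun q : ℝ × ℝ => heatKernel lam t q.1 q.2 :=
      (measurable_heatKernel hlam).comp (g := fun p : (ℝ × ℝ) × ℝ => heatKernel lam p.1.1 p.1.2 p.2)
        (f := fun q : ℝ × ℝ => ((t, q.1), q.2)) (by fun_prop)
    exact hu.aestronglyMeasurable.comp_fst.mul
      (h1.aestronglyMeasurable.mul (testSpace_aestronglyMeasurable hφ).comp_snd)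
  · filter_upwards [ae_pos_prod] with q hq
    obtain ⟨hx, hy⟩ := hq
    have hx1 : 0 < 1 + q.1 := by linarith
    have hy1 : 0 < 1 + q.2 := by linarith
    have h2 := hC' q.2 q.1 hy hx
    rw [← gaussKer_neg, neg_sub] at h2
    simp only [Function.uncurry]
    rw [norm_mul, norm_mul, Real.norm_of_nonneg (heatKernel_nonneg hlam ht hx hy), norm_div,
      Real.norm_of_nonneg (Real.rpow_nonneg hx1.le _), Real.rpow_zero, one_mul]
    simp only [Real.norm_eq_abs]
    calc |u q.1| * (heatKernel lam t q.1 q.2 * |φ q.2|)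
        ≤ |u q.1| * ((C * (C' * (1 + q.2) ^ (1 + 2 * σ) / (1 + q.1) ^ (1 + 2 * σ))) * |φ q.2|) := by
          gcongr
          refine (hC t q.1 q.2 ht hx hy).trans ?_
          gcongr
      _ = _ := by ring

theorem integrableOn_mul_testFun {lam σ : ℝ} {u φ : ℝ → ℝ} (hlam : 0 < lam) (hu : MemL σ u)
    (hφ : φ ∈ testSpace lam) : IntegrableOn (fun x => u x * φ x) (Ioi 0) := by
  obtain ⟨C, hC0, hC⟩ := testSpace_exists_le hφ (lam + (1 + 2 * σ))
  refine Integrable.mono' (hu.norm.const_mul C) ?_ ?_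
  · exact hu.aestronglyMeasurable.mul (testSpace_aestronglyMeasurable hφ)
  · refine ae_restrict_of_forall_mem measurableSet_Ioi fun x hx => ?_
    have hx0 : 0 < x := hx
    have h1 : 0 < 1 + x := by linarith
    rw [norm_mul, norm_div, Real.norm_of_nonneg (Real.rpow_nonneg h1.le _)]
    simp only [Real.norm_eq_abs]
    calc |u x| * |φ x| ≤ |u x| * (C * (1 + x) ^ (-(1 + 2 * σ))) := by
          gcongr
          refine (hC x hx).trans ?_
          gcongr
          exact rpow_mul_one_add_rpow_le hx hlam.le le_rfl
      _ = _ := by rw [Real.rpow_neg h1.le]; ring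

/-- The semigroup is symmetric. -/
theorem integral_mul_heatSg_sub {lam σ t : ℝ} {u φ : ℝ → ℝ} (hlam : 0 < lam) (hσ0 : 0 < σ)
    (hσ1 : σ < 1) (hu : MemL σ u) (hφ : φ ∈ testSpace lam) (ht : 0 < t) :
    ∫ x in Ioi (0 : ℝ), u x * (heatSg lam t φ x - φ x) =
      ∫ x in Ioi (0 : ℝ), φ x * (heatSg lam t u x - u x) := by
  have hI := integrable_heatKernel_mul_mul hlam hσ0 hσ1 hu hφ ht
  have h0 := integrableOn_mul_testFun hlam hu hφ
  have e1 : ∀ x, ∫ y in Ioi (0 : ℝ), u x * (heatKernel lam t x y * φ y) = u x * heatSg lam t φ x :=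
    fun x => integral_const_mul _ _
  have e2 : ∀ y, ∫ x in Ioi (0 : ℝ), u x * (heatKernel lam t x y * φ y) = φ y * heatSg lam t u y := by
    intro y
    rw [heatSg, ← integral_const_mul]
    refine integral_congr_ae (Eventually.of_forall fun x => ?_)
    simp only [heatKernel_symm lam t x y]
    ring
  have i1 : IntegrableOn (fun x => u x * heatSg lam t φ x) (Ioi 0) := by
    have h : IntegrableOn (fun x => ∫ y in Ioi (0 : ℝ), u x * (heatKernel lam t x y * φ y)) (Ioi 0) :=
      hI.integral_prod_left
    simpa only [e1] using h
  have i2 : IntegrableOn (fun y => φ y * heatSg lam t u y) (Ioi 0) := by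
    have h : IntegrableOn (fun y => ∫ x in Ioi (0 : ℝ), u x * (heatKernel lam t x y * φ y)) (Ioi 0) :=
      hI.integral_prod_right
    simpa only [e2] using h
  have h0' : IntegrableOn (fun x => φ x * u x) (Ioi 0) := by simpa only [mul_comm] using h0
  have hsw := integral_integral_swap hI
  simp only [e1, e2] at hsw
  simp only [mul_sub]
  rw [integral_sub i1 h0, integral_sub i2 h0', hsw]
  simp only [mul_comm]

/-- Fubini in `(t, x)` is used on both sides, and the two are equal at each fixed `t` by symmetry of
the semigroup. On the side of `φ`, its integrated increment decays like `(1+x)^(-1-2σ)` and pairs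
with `u` in `L_σ`. On the side of `u`, the integrated increment may blow up like `x^(-1-2σ)` and
grow polynomially, which `φ` absorbs because `λ > 2σ`. -/
theorem fracBesselIs_of_time_integral {lam σ C M : ℝ} {u g : ℝ → ℝ} (hσ0 : 0 < σ) (hσ1 : σ < 1)
    (hlam : 2 * σ < lam) (hu : MemL σ u)
    (hint : ∀ x : ℝ, 0 < x → IntegrableOn (fun t => (heatSg lam t u x - u x) / t ^ (1 + σ)) (Ioi 0))
    (hbd : ∀ x : ℝ, 0 < x → ∫ t in Ioi (0 : ℝ), |(heatSg lam t u x - u x) / t ^ (1 + σ)| ≤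
      C * (x ^ (-(1 + 2 * σ)) * (1 + x) ^ M))
    (hg : ∀ x : ℝ, 0 < x →
      g x = 1 / Real.Gamma (-σ) * ∫ t in Ioi (0 : ℝ), (heatSg lam t u x - u x) / t ^ (1 + σ)) :
    FracBesselIs lam σ u g := by
  rintro ⟨φ, hφ⟩
  have hlam0 : 0 < lam := by linarith
  obtain ⟨jint, C₁, hC₁0, hC₁⟩ := testSpace_heatSg_time_integral hσ0 hσ1 hlam hφ
  have hpow : Measurable fun q : ℝ × ℝ => (q.1 ^ (1 + σ))⁻¹ := by fun_prop
  have hFG : ∀ v w : ℝ → ℝ, AEStronglyMeasurable v (volume.restrict (Ioi 0)) →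
      AEStronglyMeasurable w (volume.restrict (Ioi 0)) →
      AEStronglyMeasurable (Function.uncurry fun t x => v x * ((heatSg lam t w x - w x) / t ^ (1 + σ)))
        ((volume.restrict (Ioi (0 : ℝ))).prod (volume.restrict (Ioi (0 : ℝ)))) := by
    intro v w hv hw
    simp only [div_eq_mul_inv]
    exact hv.comp_snd.mul
      (((aestronglyMeasurable_heatSg hlam0 hw).sub hw.comp_snd).mul hpow.aestronglyMeasurable)
  have hmu := hu.aestronglyMeasurable
  have hmφ := testSpace_aestronglyMeasurable hφ
  have hF := (integrable_uncurry_of_section_bound (hFG u φ hmu hmφ)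
    (B := fun x => |u x| * (C₁ * (1 + x) ^ (-(1 + 2 * σ))))
    (ae_restrict_of_forall_mem measurableSet_Ioi fun x hx => (jint x hx).const_mul _) (by
      refine IntegrableOn.congr_fun (hu.norm.const_mul C₁) (fun x hx => ?_) measurableSet_Ioi
      have hx0 : 0 < x := hx
      have h1 : 0 < 1 + x := by linarith
      rw [norm_div, Real.norm_of_nonneg (Real.rpow_nonneg h1.le _), Real.rpow_neg h1.le,
        Real.norm_eq_abs]
      ring)
    (ae_restrict_of_forall_mem measurableSet_Ioi fun x hx => by
      simp only [norm_mul, Real.norm_eq_abs]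
      rw [integral_const_mul]
      gcongr
      exact hC₁ x hx)).1
  have hG := (integrable_uncurry_of_section_bound (hFG φ u hmφ hmu)
    (B := fun x => |φ x| * (C * (x ^ (-(1 + 2 * σ)) * (1 + x) ^ M)))
    (ae_restrict_of_forall_mem measurableSet_Ioi fun x hx => (hint x hx).const_mul _) (by
      refine IntegrableOn.congr_fun ((testSpace_integrableOn_mul_rpow (a := -(1 + 2 * σ)) (b := M) hφ
        (by linarith)).const_mul C) (fun x hx => ?_) measurableSet_Ioi
      ring)
    (ae_restrict_of_forall_mem measurableSet_Ioi fun x hx => by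
      simp only [norm_mul, Real.norm_eq_abs]
      rw [integral_const_mul]
      gcongr
      exact hbd x hx)).1
  have eF : ∀ x ∈ Ioi (0 : ℝ), 1 / Real.Gamma (-σ) *
      (∫ t in Ioi (0 : ℝ), u x * ((heatSg lam t φ x - φ x) / t ^ (1 + σ))) =
      u x * fracBesselTest lam σ φ x := by
    intro x hx
    rw [fracBesselTest_eq hlam0 hσ0 hσ1 hx hφ (jint x hx), integral_const_mul]
    ring
  have eG : ∀ x ∈ Ioi (0 : ℝ), 1 / Real.Gamma (-σ) *
      (∫ t in Ioi (0 : ℝ), φ x * ((heatSg lam t u x - u x) / t ^ (1 + σ))) = g x * φ x := by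
    intro x hx
    rw [hg x hx, integral_const_mul]
    ring
  refine ⟨IntegrableOn.congr_fun (hF.integral_prod_right.const_mul (1 / Real.Gamma (-σ))) eF
    measurableSet_Ioi, IntegrableOn.congr_fun (hG.integral_prod_right.const_mul (1 / Real.Gamma (-σ))) eG
    measurableSet_Ioi, ?_⟩
  rw [fracBessel]
  simp only
  rw [← setIntegral_congr_fun measurableSet_Ioi eF, ← setIntegral_congr_fun measurableSet_Ioi eG,
    integral_const_mul, integral_const_mul, ← integral_integral_swap hF, ← integral_integral_swap hG]
  congr 1
  refine setIntegral_congr_fun measurableSet_Ioi fun t ht => ?_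
  simp only [← mul_div_assoc]
  rw [integral_div, integral_div, integral_mul_heatSg_sub hlam0 hσ0 hσ1 hu hφ ht]

/-! ### Continuity of the singular integral -/

theorem measurable_fracKernel {lam : ℝ} (hlam : 0 < lam) (σ x : ℝ) :
    Measurable fun y => fracKernel lam σ x y := by
  have h1 : Measurable fun q : ℝ × ℝ => heatKernel lam q.2 x q.1 :=
    (measurable_heatKernel hlam).comp (g := fun p : (ℝ × ℝ) × ℝ => heatKernel lam p.1.1 p.1.2 p.2)
      (f := fun q : ℝ × ℝ => ((q.2, x), q.1)) (by fun_prop)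
  have h2 : Measurable fun q : ℝ × ℝ => heatKernel lam q.2 x q.1 / q.2 ^ (1 + σ) := by fun_prop
  exact (h2.stronglyMeasurable.integral_prod_right' (ν := volume.restrict (Ioi 0))).measurable.const_mul _

theorem mul_mem_ball_half {x s : ℝ} (hx : 0 < x) :
    x * s ∈ Metric.ball x (x / 2) ↔ s ∈ Metric.ball (1 : ℝ) (1 / 2) := by
  rw [Metric.mem_ball, Metric.mem_ball, Real.dist_eq, Real.dist_eq,
    show x * s - x = x * (s - 1) by ring, abs_mul, abs_of_pos hx, show x / 2 = x * (1 / 2) by ring,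
    mul_lt_mul_iff_right₀ hx]

/-- The substitution `y = xs` and homogeneity isolate the dependence on `x` in an explicit power, so
continuity of this term needs no limit theorem. -/
theorem integral_ball_remKernel {lam σ x : ℝ} (hx : 0 < x) :
    ∫ y in Metric.ball x (x / 2), (y - x) * remKernel lam σ x y =
      x ^ (1 - 2 * σ) * ∫ s in Metric.ball (1 : ℝ) (1 / 2), (s - 1) * remKernel lam σ 1 s := by
  rw [← integral_indicator (measurableSet_ball' _ _), ← integral_indicator (measurableSet_ball' _ _)]
  have h := Measure.integral_comp_mul_left
    ((Metric.ball x (x / 2)).indicator fun y => (y - x) * remKernel lam σ x y) x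
  rw [abs_of_pos (inv_pos.mpr hx), smul_eq_mul, eq_inv_mul_iff_mul_eq₀ hx.ne'] at h
  rw [← h, ← integral_const_mul, ← integral_const_mul]
  congr 1
  ext s
  by_cases hs : s ∈ Metric.ball (1 : ℝ) (1 / 2)
  · rw [indicator_of_mem hs, indicator_of_mem ((mul_mem_ball_half hx).mpr hs)]
    have e := remKernel_scale (lam := lam) (σ := σ) (x := 1) (y := s) hx
    rw [mul_one] at e
    rw [e, show 1 - 2 * σ = -(1 + 2 * σ) + 1 + 1 by ring, Real.rpow_add_one hx.ne',
      Real.rpow_add_one hx.ne']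
    ring
  · rw [indicator_of_notMem hs, indicator_of_notMem (fun h => hs ((mul_mem_ball_half hx).mp h)),
      mul_zero, mul_zero]

theorem fracB_eq {lam σ x : ℝ} (hx : 0 < x) : fracB lam σ x = x ^ (-(2 * σ)) * fracB lam σ 1 := by
  have := fracB_scale (lam := lam) (σ := σ) (x := 1) hx
  rwa [mul_one] at this

/-- The substitution `y = xs` fixes the singularity at `s = 1` and the ball at `|s - 1| < 1/2`. Only
the regular factor then varies with `x`, and one dominating function serves all nearby `x`. -/
theorem integral_nearDev_mul_fracKernel {lam σ p x : ℝ} {w : ℝ → ℝ} (hx : 0 < x) :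
    ∫ y in Ioi (0 : ℝ), nearDev w p x y * fracKernel lam σ x y =
      x ^ (-(2 * σ)) * ∫ s in Ioi (0 : ℝ), nearDev w p x (x * s) * fracKernel lam σ 1 s := by
  have h := integral_comp_mul_left_Ioi (fun y => nearDev w p x y * fracKernel lam σ x y) 0 hx
  rw [mul_zero, smul_eq_mul, eq_inv_mul_iff_mul_eq₀ hx.ne'] at h
  rw [← h, ← integral_const_mul, ← integral_const_mul]
  refine setIntegral_congr_fun measurableSet_Ioi fun s _ => ?_
  have e := fracKernel_scale (lam := lam) (σ := σ) (x := 1) (y := s) hx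
  rw [mul_one] at e
  rw [e, show -(2 * σ) = -(1 + 2 * σ) + 1 by ring, Real.rpow_add_one hx.ne']
  ring

/-- Continuity of the singular integral of a bounded function. -/
theorem continuousAt_integral_nearDev_of_bounded {lam σ β A D x₀ : ℝ} {w p : ℝ → ℝ} (hlam : 0 < lam)
    (hσ0 : 0 < σ) (hσ1 : σ < 1) (hβ : 2 * σ < β) (hA : 0 ≤ A) (hx₀ : 0 < x₀)
    (hw : ∀ y : ℝ, 0 < y → |w y| ≤ D) (hp : ContinuousAt p x₀)
    (hm : ∀ x : ℝ, 0 < x → AEStronglyMeasurable (fun s => w (x * s)) (volume.restrict (Ioi 0)))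
    (hc : ∀ᵐ s ∂volume.restrict (Ioi (0 : ℝ)), ContinuousAt w (x₀ * s)) (hc₀ : ContinuousAt w x₀)
    (hT : ∀ x ∈ Metric.ball x₀ (x₀ / 2), ∀ y ∈ Metric.ball x (x / 2),
      |w y - w x - p x * (y - x)| ≤ A * |x - y| ^ β) :
    ContinuousAt (fun x => ∫ y in Ioi (0 : ℝ), nearDev w (p x) x y * fracKernel lam σ x y) x₀ := by
  obtain ⟨C, hC0, hC⟩ := exists_fracKernel_le hlam hσ0 hσ1
  have hball : Metric.ball x₀ (x₀ / 2) ∈ 𝓝 x₀ := Metric.ball_mem_nhds _ (by linarith)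
  have hnd : ∀ x s, 0 < x → nearDev w (p x) x (x * s) =
      w (x * s) - w x - (Metric.ball (1 : ℝ) (1 / 2)).indicator (fun s => s - 1) s * (p x * x) := by
    intro x s hx
    rw [nearDev]
    by_cases hs : s ∈ Metric.ball (1 : ℝ) (1 / 2)
    · rw [indicator_of_mem hs, indicator_of_mem ((mul_mem_ball_half hx).mpr hs)]; ring
    · rw [indicator_of_notMem hs, indicator_of_notMem (fun h => hs ((mul_mem_ball_half hx).mp h)),
        zero_mul]
  have hms := measurableSet_ball' 1 (1 / 2)
  -- Near `s = 1` the deviation is at most `A (x|1-s|)^β` with `x ≤ 2x₀`; away from `1` it is at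
  -- most `2D`. Both bounds are uniform in `x`.
  let b : ℝ → ℝ := fun s => C * ((Metric.ball (1 : ℝ) (1 / 2)).indicator
    (fun s => A * (2 * x₀) ^ β * |1 - s| ^ (β - (1 + 2 * σ))) s +
    (Metric.ball (1 : ℝ) (1 / 2))ᶜ.indicator (fun s => 2 * D * |1 - s| ^ (-(1 + 2 * σ))) s)
  have hb : Integrable b := by
    have i1 := (integrable_indicator_ball_rpow (s := β - (1 + 2 * σ)) (r := 1 / 2) (by linarith)
      (by norm_num) 1).1
    have i2 := (integrable_compl_ball_rpow (r := 1 / 2) hσ0 (by norm_num) 1).1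
    exact ((((integrable_indicator_iff hms).mpr (i1.const_mul _)).add
      ((integrable_indicator_iff hms.compl).mpr (i2.const_mul _))).const_mul C)
  have key : ContinuousAt (fun x => ∫ s in Ioi (0 : ℝ), nearDev w (p x) x (x * s) * fracKernel lam σ 1 s)
      x₀ := by
    refine continuousAt_of_dominated (bound := b) ?_ ?_ hb.integrableOn ?_
    · filter_upwards [hball] with x hx
      have hx0 : 0 < x := ball_half_subset hx
      simp only [hnd x _ hx0]
      have h1 : Measurable fun s => (Metric.ball (1 : ℝ) (1 / 2)).indicator (fun s => s - 1) s * (p x * x) :=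
        (Measurable.indicator (by fun_prop) hms).mul_const _
      exact (((hm x hx0).sub aestronglyMeasurable_const).sub h1.aestronglyMeasurable).mul
        (measurable_fracKernel hlam σ 1).aestronglyMeasurable
    · filter_upwards [hball] with x hx
      have hx0 : 0 < x := ball_half_subset hx
      have hx2 : x ≤ 2 * x₀ := by
        rw [Metric.mem_ball, Real.dist_eq, abs_lt] at hx; linarith [hx.2]
      refine ae_restrict_of_forall_mem measurableSet_Ioi fun s hs => ?_
      have hs0 : 0 < s := hs
      rcases eq_or_ne 1 s with rfl | hne
      · rw [mul_one, nearDev_self, zero_mul, norm_zero]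
        have hD : 0 ≤ D := (abs_nonneg _).trans (hw x hx0)
        refine mul_nonneg hC0.le (add_nonneg (indicator_nonneg (fun s _ => ?_) _)
          (indicator_nonneg (fun s _ => ?_) _)) <;> positivity
      · have hd : 0 < |1 - s| := abs_pos.mpr (sub_ne_zero.mpr hne)
        rw [norm_mul, Real.norm_of_nonneg (fracKernel_nonneg hlam hσ0 hσ1 one_pos hs0), Real.norm_eq_abs]
        have hK := hC 1 s one_pos hs0 hne
        by_cases hsb : s ∈ Metric.ball (1 : ℝ) (1 / 2)
        · have hmem := (mul_mem_ball_half hx0).mpr hsb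
          have h1 := hT x hx _ hmem
          have e1 : |x - x * s| = x * |1 - s| := by
            rw [show x - x * s = x * (1 - s) by ring, abs_mul, abs_of_pos hx0]
          rw [e1, Real.mul_rpow hx0.le hd.le] at h1
          simp only [b]
          rw [indicator_of_mem hsb, indicator_of_notMem (notMem_compl_iff.mpr hsb), add_zero, nearDev,
            indicator_of_mem hmem]
          calc _ ≤ A * ((2 * x₀) ^ β * |1 - s| ^ β) * (C * |1 - s| ^ (-(1 + 2 * σ))) := by
                have : 0 < β := by linarith
                have h2 : |w (x * s) - w x - p x * (x * s - x)| ≤ A * ((2 * x₀) ^ β * |1 - s| ^ β) :=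
                  h1.trans (by gcongr)
                exact mul_le_mul h2 hK (fracKernel_nonneg hlam hσ0 hσ1 one_pos hs0)
                  ((abs_nonneg _).trans h2)
            _ = _ := by rw [sub_eq_add_neg β, Real.rpow_add hd]; ring
        · have hmem := fun h => hsb ((mul_mem_ball_half hx0).mp h)
          simp only [b]
          rw [indicator_of_notMem hsb, indicator_of_mem (by exact hsb), zero_add, nearDev,
            indicator_of_notMem hmem, sub_zero]
          calc _ ≤ (D + D) * (C * |1 - s| ^ (-(1 + 2 * σ))) := by
                have hw2 := (abs_sub (w (x * s)) (w x)).trans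
                  (add_le_add (hw _ (mul_pos hx0 hs0)) (hw _ hx0))
                exact mul_le_mul hw2 hK (fracKernel_nonneg hlam hσ0 hσ1 one_pos hs0)
                  ((abs_nonneg _).trans hw2)
            _ = _ := by ring
    · filter_upwards [hc] with s hs
      have h1 : ContinuousAt (fun x => (w (x * s) - w x -
          (Metric.ball (1 : ℝ) (1 / 2)).indicator (fun s => s - 1) s * (p x * x)) * fracKernel lam σ 1 s)
          x₀ := by
        have h2 : ContinuousAt (fun x => w (x * s)) x₀ :=
          ContinuousAt.comp (f := fun x => x * s) (g := w) hs (by fun_prop)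
        exact ((h2.sub hc₀).sub (continuousAt_const.mul (hp.mul continuousAt_id))).mul continuousAt_const
      refine h1.congr ?_
      filter_upwards [hball] with x hx
      rw [hnd x s (ball_half_subset hx)]
  refine ContinuousAt.congr (f := fun x => x ^ (-(2 * σ)) *
    ∫ s in Ioi (0 : ℝ), nearDev w (p x) x (x * s) * fracKernel lam σ 1 s)
    ((Real.continuousAt_rpow_const _ _ (Or.inl hx₀.ne')).mul key) ?_
  filter_upwards [hball] with x hx
  exact (integral_nearDev_mul_fracKernel (ball_half_subset hx)).symm

theorem MemL.tendsto_tail {σ : ℝ} {u : ℝ → ℝ} (hu : MemL σ u) :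
    Tendsto (fun n : ℕ => ∫ y in Ioi (n : ℝ), |u y| * (1 + y) ^ (-(1 + 2 * σ))) atTop (𝓝 0) := by
  have i1 : IntegrableOn (fun y => |u y| * (1 + y) ^ (-(1 + 2 * σ))) (Ioi 0) := by
    refine IntegrableOn.congr_fun hu.norm (fun y hy => ?_) measurableSet_Ioi
    have hy0 : 0 < y := hy
    have h1 : 0 < 1 + y := by linarith
    rw [norm_div, Real.norm_of_nonneg (Real.rpow_nonneg h1.le _), Real.rpow_neg h1.le,
      Real.norm_eq_abs, div_eq_mul_inv]
  have h := tendsto_setIntegral_of_antitone (μ := volume) (s := fun n : ℕ => Ioi (n : ℝ))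
    (f := fun y => |u y| * (1 + y) ^ (-(1 + 2 * σ))) (fun n => measurableSet_Ioi)
    (fun m n hmn => Ioi_subset_Ioi (by exact_mod_cast hmn)) ⟨0, by simpa using i1⟩
  have e : ⋂ n : ℕ, Ioi (n : ℝ) = ∅ := by
    ext y
    simp only [mem_iInter, mem_Ioi, mem_empty_iff_false, iff_false, not_forall, not_lt]
    exact exists_nat_ge y
  simpa [e] using h

theorem continuousAt_indicator_Iic {u : ℝ → ℝ} {R z : ℝ} (hz : z ≠ R) (hu : ContinuousAt u z) :
    ContinuousAt ((Iic R).indicator u) z := by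
  rcases lt_or_gt_of_ne hz with h | h
  · refine hu.congr ?_
    filter_upwards [gt_mem_nhds h] with y hy
    rw [indicator_of_mem (by exact hy.le)]
  · refine (continuousAt_const (y := (0 : ℝ))).congr ?_
    filter_upwards [lt_mem_nhds h] with y hy
    rw [indicator_of_notMem (by simpa using hy)]

/-- Continuity of the singular integral. -/
theorem continuousOn_integral_nearDev {lam σ β A C₀ M : ℝ} {u p : ℝ → ℝ} (hlam : 0 < lam)
    (hσ0 : 0 < σ) (hσ1 : σ < 1) (hβ : 2 * σ < β) (hA : 0 ≤ A) (hM : 0 ≤ M) (hC₀ : 0 ≤ C₀)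
    (hu : MemL σ u) (huc : ContinuousOn u (Ioi 0)) (hpc : ContinuousOn p (Ioi 0))
    (hub : ∀ x : ℝ, 0 < x → |u x| ≤ C₀ * (1 + x) ^ M)
    (hT : ∀ x : ℝ, 0 < x → ∀ y ∈ Metric.ball x (x / 2),
      |u y - u x - p x * (y - x)| ≤ A * |x - y| ^ β)
    (hint : ∀ x : ℝ, 0 < x → IntegrableOn (fun y => nearDev u (p x) x y * fracKernel lam σ x y) (Ioi 0)) :
    ContinuousOn (fun x => ∫ y in Ioi (0 : ℝ), nearDev u (p x) x y * fracKernel lam σ x y) (Ioi 0) := by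
  obtain ⟨C, hC0, hC⟩ := exists_fracKernel_le hlam hσ0 hσ1
  intro x₀ hx₀
  have hx₀' : 0 < x₀ := hx₀
  refine ContinuousAt.continuousWithinAt ?_
  have hat : ∀ {f : ℝ → ℝ}, ContinuousOn f (Ioi 0) → ∀ z : ℝ, 0 < z → ContinuousAt f z :=
    fun hf z hz => hf.continuousAt (Ioi_mem_nhds hz)
  have hball : Metric.ball x₀ (x₀ / 2) ∈ 𝓝 x₀ := Metric.ball_mem_nhds _ (by linarith)
  -- An unbounded `u` is cut off at a large `R`. The bounded case applies to the truncation, and the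
  -- discarded tail is small uniformly for `x` near `x₀` because `u` lies in `L_σ`.
  refine continuousAt_of_locally_uniform_approx_of_continuousAt fun V hV => ?_
  obtain ⟨ε, hε, hεV⟩ := Metric.mem_uniformity_dist.mp hV
  have htl := hu.tendsto_tail.const_mul (C * 4 ^ (1 + 2 * σ))
  rw [mul_zero] at htl
  -- The condition `R ≥ 4x₀` keeps every ball of radius `x/2` about a nearby `x` below the cut; with
  -- `R ≥ 1` it also gives `|x - y| ≥ (1 + y)/4` for `y > R`.
  obtain ⟨n, hn1, hn2⟩ := ((htl.eventually (gt_mem_nhds hε)).and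
    (tendsto_natCast_atTop_atTop.eventually_ge_atTop (max (4 * x₀) 1))).exists
  set R : ℝ := (n : ℝ) with hR
  have hR1 : 1 ≤ R := (le_max_right _ _).trans hn2
  have hR4 : 4 * x₀ ≤ R := (le_max_left _ _).trans hn2
  set w := (Iic R).indicator u with hw
  have hwe : ∀ y, y ≤ R → w y = u y := fun y hy => indicator_of_mem (by exact hy) u
  have hlt : ∀ x ∈ Metric.ball x₀ (x₀ / 2), x < 3 / 2 * x₀ := fun x hx => by
    rw [Metric.mem_ball, Real.dist_eq, abs_lt] at hx; linarith [hx.2]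
  have hlt' : ∀ x ∈ Metric.ball x₀ (x₀ / 2), ∀ y ∈ Metric.ball x (x / 2), y ≤ R := fun x hx y hy => by
    rw [Metric.mem_ball, Real.dist_eq, abs_lt] at hy
    have := hlt x hx
    linarith [hy.2]
  refine ⟨_, hball, fun x => ∫ y in Ioi (0 : ℝ), nearDev w (p x) x y * fracKernel lam σ x y, ?_, ?_⟩
  · refine continuousAt_integral_nearDev_of_bounded (A := A) (D := C₀ * (1 + R) ^ M) hlam hσ0 hσ1 hβ hA
      hx₀ (fun y hy => ?_) (hat hpc x₀ hx₀) (fun x hx => ?_) ?_ ?_ (fun x hx y hy => ?_)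
    · by_cases h : y ≤ R
      · rw [hwe y h]
        refine (hub y hy).trans ?_
        gcongr
      · rw [hw, indicator_of_notMem (by simpa using h), abs_zero]
        positivity
    · have h1 : ContinuousOn (fun s => u (x * s)) (Ioi 0) :=
        huc.comp (by fun_prop) fun s hs => mul_pos hx hs
      have h2 := (h1.aestronglyMeasurable (μ := volume) measurableSet_Ioi).indicator
        (s := {s : ℝ | x * s ≤ R}) (measurableSet_le (by fun_prop) measurable_const)
      exact h2
    -- The jump created by the cut-off is met at the single parameter `s = R/x₀`.
    · have h1 : ∀ᵐ s : ℝ, s ≠ R / x₀ := by simp [ae_iff, measure_singleton]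
      filter_upwards [ae_restrict_of_ae h1, ae_restrict_mem measurableSet_Ioi] with s hs hs0
      have hs0' : 0 < s := hs0
      refine continuousAt_indicator_Iic (fun h => hs ?_) (hat huc _ (by positivity))
      rw [eq_div_iff hx₀'.ne', mul_comm]; exact h
    · exact continuousAt_indicator_Iic (by linarith) (hat huc _ hx₀)
    · have hx0 : 0 < x := ball_half_subset hx
      rw [hwe y (hlt' x hx y hy), hwe x (hlt' x hx x (Metric.mem_ball_self (by linarith)))]
      exact hT x hx0 y hy
  · intro x hx
    have hx0 : 0 < x := ball_half_subset hx
    refine hεV ?_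
    have hK : ∀ y ∈ Ioi R, ‖u y * fracKernel lam σ x y‖ ≤
        C * 4 ^ (1 + 2 * σ) * (|u y| * (1 + y) ^ (-(1 + 2 * σ))) := by
      intro y hy
      have hyR : R < y := hy
      have h1 := hlt x hx
      have hy0 : 0 < y := by linarith
      rw [norm_mul, Real.norm_of_nonneg (fracKernel_nonneg hlam hσ0 hσ1 hx0 hy0), Real.norm_eq_abs]
      have h2 : (1 + y) / 4 ≤ |x - y| := by
        rw [abs_sub_comm, abs_of_pos (by linarith)]; linarith
      have h3 : |x - y| ^ (-(1 + 2 * σ)) ≤ 4 ^ (1 + 2 * σ) * (1 + y) ^ (-(1 + 2 * σ)) := by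
        refine (Real.rpow_le_rpow_of_nonpos (by positivity) h2 (by linarith)).trans (le_of_eq ?_)
        rw [Real.div_rpow (by linarith) (by norm_num), Real.rpow_neg (by norm_num : (0 : ℝ) ≤ 4),
          div_inv_eq_mul, mul_comm]
      calc _ ≤ |u y| * (C * (4 ^ (1 + 2 * σ) * (1 + y) ^ (-(1 + 2 * σ)))) := by
            gcongr
            refine (hC x y hx0 hy0 (by linarith)).trans ?_
            gcongr
        _ = _ := by ring
    have i1 : IntegrableOn (fun y => |u y| * (1 + y) ^ (-(1 + 2 * σ))) (Ioi R) := by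
      refine IntegrableOn.congr_fun (IntegrableOn.mono_set (Integrable.norm hu) (Ioi_subset_Ioi (by linarith))) (fun y hy => ?_)
        measurableSet_Ioi
      have hyR : R < y := hy
      have h1 : 0 < 1 + y := by linarith
      rw [norm_div, Real.norm_of_nonneg (Real.rpow_nonneg h1.le _), Real.rpow_neg h1.le,
        Real.norm_eq_abs, div_eq_mul_inv]
    have hsub : Ioi R ⊆ Ioi (0 : ℝ) := Ioi_subset_Ioi (by linarith)
    have i2 : IntegrableOn (fun y => u y * fracKernel lam σ x y) (Ioi R) :=
      Integrable.mono' (i1.const_mul _)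
        ((hu.aestronglyMeasurable.mono_measure (Measure.restrict_mono hsub le_rfl)).mul
          (measurable_fracKernel hlam σ x).aestronglyMeasurable)
        (ae_restrict_of_forall_mem measurableSet_Ioi hK)
    have i3 : IntegrableOn ((Ioi R).indicator fun y => u y * fracKernel lam σ x y) (Ioi 0) :=
      ((integrable_indicator_iff measurableSet_Ioi).mpr i2).integrableOn
    have e1 : ∀ y, nearDev w (p x) x y * fracKernel lam σ x y = nearDev u (p x) x y * fracKernel lam σ x y -
        (Ioi R).indicator (fun y => u y * fracKernel lam σ x y) y := by
      intro y
      have h0 := hwe x (hlt' x hx x (Metric.mem_ball_self (by linarith)))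
      by_cases h : y ≤ R
      · rw [indicator_of_notMem (by simpa using h), nearDev, nearDev, h0, hwe y h, sub_zero]
      · rw [indicator_of_mem (by simpa using h), nearDev, nearDev, h0, hw,
          indicator_of_notMem (by simpa using h)]
        ring
    simp only [e1]
    rw [integral_sub (hint x hx0) i3, dist_eq_norm, sub_sub_cancel, setIntegral_indicator measurableSet_Ioi,
      inter_eq_self_of_subset_right hsub]
    refine lt_of_le_of_lt ?_ hn1
    rw [← integral_const_mul]
    exact norm_integral_le_of_norm_le (i1.const_mul _) (ae_restrict_of_forall_mem measurableSet_Ioi hK)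

/-! ### The representing function: continuity and identification -/

theorem MemL.integral_abs_mul_rpow_add_le {σ : ℝ} {u : ℝ → ℝ} (hσ0 : 0 < σ) (hu : MemL σ u) :
    ∃ C : ℝ, 0 < C ∧ ∀ x : ℝ, 0 < x → ∫ y in Ioi (0 : ℝ), |u y| * (x + y) ^ (-(1 + 2 * σ)) ≤
      C * (x ^ (-(1 + 2 * σ)) * (1 + x) ^ (1 + 2 * σ)) := by
  have hI : 0 ≤ ∫ y in Ioi (0 : ℝ), ‖u y / (1 + y) ^ (1 + 2 * σ)‖ := integral_nonneg fun y => norm_nonneg _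
  refine ⟨(∫ y in Ioi (0 : ℝ), ‖u y / (1 + y) ^ (1 + 2 * σ)‖) + 1, by positivity, fun x hx => ?_⟩
  have h1 : ∫ y in Ioi (0 : ℝ), |u y| * (x + y) ^ (-(1 + 2 * σ)) ≤
      ∫ y in Ioi (0 : ℝ), ‖u y / (1 + y) ^ (1 + 2 * σ)‖ * (x ^ (-(1 + 2 * σ)) * (1 + x) ^ (1 + 2 * σ)) := by
    refine setIntegral_mono_on (hu.integrableOn_abs_mul_rpow_add hσ0 hx) (hu.norm.mul_const _)
      measurableSet_Ioi fun y hy => ?_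
    have hy0 : 0 < y := hy
    have h1 : 0 < 1 + y := by linarith
    have h2 : 0 < 1 + x := by linarith
    have h3 : (min 1 x) ^ (-(1 + 2 * σ)) ≤ x ^ (-(1 + 2 * σ)) * (1 + x) ^ (1 + 2 * σ) := by
      have h4 : x / (1 + x) ≤ min 1 x :=
        le_min (by rw [div_le_one h2]; linarith) (div_le_self hx.le (by linarith))
      refine (Real.rpow_le_rpow_of_nonpos (by positivity) h4 (by linarith)).trans (le_of_eq ?_)
      rw [Real.div_rpow hx.le h2.le, Real.rpow_neg h2.le, div_inv_eq_mul]
    rw [norm_div, Real.norm_of_nonneg (Real.rpow_nonneg h1.le _), Real.norm_eq_abs]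
    calc |u y| * (x + y) ^ (-(1 + 2 * σ))
        ≤ |u y| * ((x ^ (-(1 + 2 * σ)) * (1 + x) ^ (1 + 2 * σ)) * (1 + y) ^ (-(1 + 2 * σ))) := by
          gcongr
          refine (rpow_add_le_weight hσ0 hx hy0).trans ?_
          gcongr
      _ = _ := by rw [Real.rpow_neg h1.le]; ring
  refine h1.trans ?_
  rw [integral_mul_const]
  gcongr
  linarith

/-- The function that represents the fractional Bessel operator, in terms of a first-order expansion
of `u` with slope `p`. -/
def fracFun (lam σ : ℝ) (u p : ℝ → ℝ) (x : ℝ) : ℝ :=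
  -(∫ y in Ioi (0 : ℝ), nearDev u (p x) x y * fracKernel lam σ x y) -
    p x * (∫ y in Metric.ball x (x / 2), (y - x) * remKernel lam σ x y) + u x * fracB lam σ x

/-- The hypothesis on `A`, `β` and `p` is the common form of the two regimes. Absolute convergence
comes from `β > 2σ`, continuity from scaling, and the identification from transposition; there
polynomial bounds on `u` and `p` suffice, as test functions decay rapidly. -/
theorem fracFun_spec {lam σ β A C₀ M : ℝ} {u p : ℝ → ℝ} (hσ0 : 0 < σ) (hσ1 : σ < 1)
    (hlam : 2 * σ < lam) (hβ : 2 * σ < β) (hA : 0 ≤ A) (hM : 0 ≤ M) (hC₀ : 0 ≤ C₀)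
    (hu : MemL σ u) (huc : ContinuousOn u (Ioi 0)) (hpc : ContinuousOn p (Ioi 0))
    (hub : ∀ x : ℝ, 0 < x → |u x| ≤ C₀ * (1 + x) ^ M)
    (hpb : ∀ x : ℝ, 0 < x → |p x| ≤ C₀ * (1 + x) ^ M)
    (hT : ∀ x : ℝ, 0 < x → ∀ y ∈ Metric.ball x (x / 2),
      |u y - u x - p x * (y - x)| ≤ A * |x - y| ^ β) :
    ContinuousOn (fracFun lam σ u p) (Ioi 0) ∧ FracBesselIs lam σ u (fracFun lam σ u p) ∧
      ∀ x : ℝ, 0 < x →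
        IntegrableOn (fun y => nearDev u (p x) x y * fracKernel lam σ x y) (Ioi 0) ∧
        IntegrableOn (fun y => (y - x) * remKernel lam σ x y) (Metric.ball x (x / 2)) := by
  have hlam0 : 0 < lam := by linarith
  obtain ⟨C₁, hC₁0, hC₁⟩ := heatSg_time_integral hlam0 hσ0 hσ1
  obtain ⟨C₂, hC₂0, hC₂⟩ := exists_nearDev_integral_le hσ0 hβ
  obtain ⟨C₃, hC₃0, hC₃⟩ := hu.integral_abs_mul_rpow_add_le hσ0
  have hdev := fun (x : ℝ) (hx : 0 < x) => hC₂ u (p x) x A hu hx hA (hT x hx)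
  have key := fun (x : ℝ) (hx : 0 < x) => hC₁ u (p x) x hu hx (hdev x hx).1
  refine ⟨?_, ?_, fun x hx => ⟨(key x hx).2.2.1, (key x hx).2.2.2.1⟩⟩
  · have h1 := continuousOn_integral_nearDev hlam0 hσ0 hσ1 hβ hA hM hC₀ hu huc hpc hub hT
      fun x hx => (key x hx).2.2.1
    have hr : ∀ a : ℝ, ContinuousOn (fun x : ℝ => x ^ a) (Ioi 0) := fun a x hx =>
      (Real.continuousAt_rpow_const _ _ (Or.inl (ne_of_gt hx))).continuousWithinAt
    have h2 := (h1.neg.sub (hpc.mul ((hr (1 - 2 * σ)).mul (continuousOn_const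
      (c := ∫ s in Metric.ball (1 : ℝ) (1 / 2), (s - 1) * remKernel lam σ 1 s))))).add
      (huc.mul ((hr (-(2 * σ))).mul (continuousOn_const (c := fracB lam σ 1))))
    refine h2.congr fun x hx => ?_
    rw [fracFun, integral_ball_remKernel hx, fracB_eq hx]
    rfl
  · refine fracBesselIs_of_time_integral (M := M + β + (1 + 2 * σ) + 2)
      (C := C₁ * (C₂ * (A + C₀ + C₃) + C₀ + C₀)) hσ0 hσ1 hlam hu (fun x hx => (key x hx).1)
      (fun x hx => ?_) (fun x hx => (key x hx).2.2.2.2.symm)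
    have hx1 : 0 < 1 + x := by linarith
    -- All four terms are put under one majorant `x^(-1-2σ)(1+x)^N`; the size of `N` is irrelevant,
    -- so it is chosen crudely.
    have hX : ∀ a b : ℝ, 0 ≤ a → a + b ≤ M + β + (1 + 2 * σ) + 2 →
        x ^ (a - (1 + 2 * σ)) * (1 + x) ^ b ≤
          x ^ (-(1 + 2 * σ)) * (1 + x) ^ (M + β + (1 + 2 * σ) + 2) := by
      intro a b ha hab
      calc x ^ (a - (1 + 2 * σ)) * (1 + x) ^ b = x ^ (-(1 + 2 * σ)) * (x ^ a * (1 + x) ^ b) := by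
            rw [sub_eq_add_neg, Real.rpow_add hx]; ring
        _ ≤ x ^ (-(1 + 2 * σ)) * ((1 + x) ^ a * (1 + x) ^ b) := by
            gcongr; linarith
        _ = x ^ (-(1 + 2 * σ)) * (1 + x) ^ (a + b) := by rw [Real.rpow_add hx1]
        _ ≤ _ := by
            gcongr
            linarith
    have hβ0 : 0 < β := by linarith
    have t1 := hX (1 + β) 0 (by linarith) (by linarith)
    have t2 := hX 1 M (by linarith) (by linarith)
    have t3 := hX 0 (1 + 2 * σ) le_rfl (by linarith)
    have t4 := hX 2 M (by linarith) (by linarith)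
    rw [Real.rpow_zero, mul_one, show 1 + β - (1 + 2 * σ) = β - 2 * σ by ring] at t1
    rw [show 1 - (1 + 2 * σ) = -(2 * σ) by ring] at t2
    rw [zero_sub] at t3
    rw [show 2 - (1 + 2 * σ) = 1 - 2 * σ by ring] at t4
    set Q := x ^ (-(1 + 2 * σ)) * (1 + x) ^ (M + β + (1 + 2 * σ) + 2)
    have hx2 := Real.rpow_nonneg hx.le (-(2 * σ))
    have hx3 := Real.rpow_nonneg hx.le (1 - 2 * σ)
    have d2 : |u x| * x ^ (-(2 * σ)) ≤ C₀ * Q := by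
      calc |u x| * x ^ (-(2 * σ)) ≤ C₀ * (1 + x) ^ M * x ^ (-(2 * σ)) := by gcongr; exact hub x hx
        _ = C₀ * (x ^ (-(2 * σ)) * (1 + x) ^ M) := by ring
        _ ≤ _ := by gcongr
    have d4 : |p x| * x ^ (1 - 2 * σ) ≤ C₀ * Q := by
      calc |p x| * x ^ (1 - 2 * σ) ≤ C₀ * (1 + x) ^ M * x ^ (1 - 2 * σ) := by gcongr; exact hpb x hx
        _ = C₀ * (x ^ (1 - 2 * σ) * (1 + x) ^ M) := by ring
        _ ≤ _ := by gcongr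
    refine (key x hx).2.1.trans ?_
    calc _ ≤ C₁ * (C₂ * (A * Q + C₀ * Q + C₃ * Q) + C₀ * Q + C₀ * Q) := by
          gcongr
          refine (hdev x hx).2.trans ?_
          gcongr
          exact (hC₃ x hx).trans (by gcongr)
      _ = _ := by ring

/-! ### Truncated integrals and the principal value -/

theorem measurableSet_far (x ε : ℝ) : MeasurableSet {y : ℝ | ε < |x - y|} :=
  measurableSet_lt measurable_const (by fun_prop)

theorem tendsto_setIntegral_far {f : ℝ → ℝ} {S : Set ℝ} (x : ℝ) (hf : IntegrableOn f S) :
    Tendsto (fun ε : ℝ => ∫ y in S ∩ {y | ε < |x - y|}, f y) (𝓝[>] 0) (𝓝 (∫ y in S, f y)) := by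
  simp only [← setIntegral_indicator (measurableSet_far x _)]
  refine tendsto_integral_filter_of_dominated_convergence (fun y => ‖f y‖)
    (Eventually.of_forall fun ε => hf.1.indicator (measurableSet_far x ε))
    (Eventually.of_forall fun ε => Eventually.of_forall fun y => norm_indicator_le_norm_self _ _) hf.norm ?_
  have h1 : ∀ᵐ y : ℝ, y ≠ x := by simp [ae_iff, measure_singleton]
  filter_upwards [ae_restrict_of_ae h1] with y hy
  refine tendsto_const_nhds.congr' ?_
  have hd : 0 < |x - y| := abs_pos.mpr (sub_ne_zero.mpr hy.symm)
  filter_upwards [nhdsWithin_le_nhds (gt_mem_nhds hd)] with ε hε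
  rw [indicator_of_mem (by exact hε)]

theorem memL_const {σ : ℝ} (hσ0 : 0 < σ) (c : ℝ) : MemL σ fun _ => c := by
  have h := (integrableOn_rpow_mul_one_add_rpow (a := 0) (b := 1 + 2 * σ) (by norm_num)
    (by linarith)).const_mul c
  refine IntegrableOn.congr_fun h (fun x hx => ?_) measurableSet_Ioi
  have hx0 : 0 < x := hx
  rw [Real.rpow_zero, one_mul, Real.rpow_neg (by linarith), div_eq_mul_inv]

/-- For `|x - y| > ε` one has `1 + y ≤ B|x - y|` with `B = (1+x)/ε + 1`, so the kernel is dominated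
by the weight of `L_σ`. -/
theorem MemL.integrableOn_far {lam σ x ε : ℝ} {u : ℝ → ℝ} (hlam : 0 < lam) (hσ0 : 0 < σ) (hσ1 : σ < 1)
    (hu : MemL σ u) (hx : 0 < x) (hε : 0 < ε) :
    IntegrableOn (fun y => u y * fracKernel lam σ x y) (Ioi 0 ∩ {y | ε < |x - y|}) := by
  obtain ⟨C, hC0, hC⟩ := exists_fracKernel_le hlam hσ0 hσ1
  have hms := (measurableSet_Ioi (a := (0 : ℝ))).inter (measurableSet_far x ε)
  set B := (1 + x) / ε + 1 with hB
  have hB0 : 0 < B := by positivity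
  have hsub : Ioi 0 ∩ {y | ε < |x - y|} ⊆ Ioi (0 : ℝ) := inter_subset_left
  refine Integrable.mono'
    ((IntegrableOn.mono_set (Integrable.norm hu) hsub).const_mul (C * B ^ (1 + 2 * σ)))
    ((hu.aestronglyMeasurable.mono_measure (Measure.restrict_mono hsub le_rfl)).mul
      (measurable_fracKernel hlam σ x).aestronglyMeasurable)
    (ae_restrict_of_forall_mem hms fun y hy => ?_)
  obtain ⟨hy0, hyε⟩ := hy
  have hy0' : 0 < y := hy0
  have hyε' : ε < |x - y| := hyε
  have hne : x ≠ y := fun h => by rw [h, sub_self, abs_zero] at hyε'; linarith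
  have h1 : 0 < 1 + y := by linarith
  have h2 : (1 + y) / B ≤ |x - y| := by
    rw [div_le_iff₀ hB0, hB, mul_add, mul_one]
    have h3 : 1 + x ≤ |x - y| * ((1 + x) / ε) := by
      rw [← mul_div_assoc, le_div_iff₀ hε]
      nlinarith
    linarith [neg_abs_le (x - y)]
  have h4 : |x - y| ^ (-(1 + 2 * σ)) ≤ B ^ (1 + 2 * σ) * ((1 + y) ^ (1 + 2 * σ))⁻¹ := by
    refine (Real.rpow_le_rpow_of_nonpos (by positivity) h2 (by linarith)).trans (le_of_eq ?_)
    rw [Real.div_rpow h1.le hB0.le, Real.rpow_neg hB0.le, div_inv_eq_mul, mul_comm, Real.rpow_neg h1.le]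
  rw [norm_mul, Real.norm_of_nonneg (fracKernel_nonneg hlam hσ0 hσ1 hx hy0'), norm_div,
    Real.norm_of_nonneg (Real.rpow_nonneg h1.le _)]
  calc _ ≤ ‖u y‖ * (C * (B ^ (1 + 2 * σ) * ((1 + y) ^ (1 + 2 * σ))⁻¹)) := by
        gcongr
        exact (hC x y hx hy0' hne).trans (by gcongr)
    _ = _ := by ring

theorem MemL.integrableOn_far_sub {lam σ x ε : ℝ} {u : ℝ → ℝ} (hlam : 0 < lam) (hσ0 : 0 < σ)
    (hσ1 : σ < 1) (hu : MemL σ u) (hx : 0 < x) (hε : 0 < ε) :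
    IntegrableOn (fun y => (u x - u y) * fracKernel lam σ x y) (Ioi 0 ∩ {y | ε < |x - y|}) := by
  have h : IntegrableOn (fun y => u x * fracKernel lam σ x y - u y * fracKernel lam σ x y)
      (Ioi 0 ∩ {y | ε < |x - y|}) :=
    ((memL_const hσ0 (u x)).integrableOn_far hlam hσ0 hσ1 hx hε).sub
      (hu.integrableOn_far hlam hσ0 hσ1 hx hε)
  simpa only [sub_mul] using h

/-- The truncated singular integrals, in terms of the first-order expansion. -/
theorem setIntegral_far_eq {lam σ p x ε : ℝ} {u : ℝ → ℝ} (hlam : 0 < lam) (hσ0 : 0 < σ) (hσ1 : σ < 1)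
    (hx : 0 < x) (hε : 0 < ε)
    (h1 : IntegrableOn (fun y => nearDev u p x y * fracKernel lam σ x y) (Ioi 0))
    (h2 : IntegrableOn (fun y => (y - x) * remKernel lam σ x y) (Metric.ball x (x / 2))) :
    ∫ y in Ioi (0 : ℝ) ∩ {y | ε < |x - y|}, (u x - u y) * fracKernel lam σ x y =
      -(∫ y in Ioi (0 : ℝ) ∩ {y | ε < |x - y|}, nearDev u p x y * fracKernel lam σ x y) -
        p * ∫ y in Metric.ball x (x / 2) ∩ {y | ε < |x - y|}, (y - x) * remKernel lam σ x y := by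
  set S := {y : ℝ | ε < |x - y|} with hS
  have hmS : MeasurableSet S := measurableSet_far x ε
  have hmb := measurableSet_ball' x (x / 2)
  set c := 1 / (-Real.Gamma (-σ)) * gaussConst (σ + 1 / 2) with hc
  -- The truncated ball is symmetric about `x`, so the explicit part of the kernel contributes
  -- nothing to the first moment; only the remainder kernel survives.
  have hodd : ∫ y in Metric.ball x (x / 2) ∩ S, (y - x) * (c * |x - y| ^ (-(1 + 2 * σ))) = 0 := by
    refine setIntegral_odd_eq_zero (hmb.inter hmS) (fun y => ?_) fun s => c * s ^ (-(1 + 2 * σ))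
    simp only [hS, mem_inter_iff, Metric.mem_ball, mem_ofPred_eq, Real.dist_eq]
    rw [show 2 * x - y - x = x - y by ring, show x - (2 * x - y) = y - x by ring, abs_sub_comm x y]
  have hG : IntegrableOn (fun y => (y - x) * (c * |x - y| ^ (-(1 + 2 * σ)))) (Metric.ball x (x / 2) ∩ S) := by
    refine Measure.integrableOn_of_bounded (M := x / 2 * (|c| * ε ^ (-(1 + 2 * σ))))
      ((measure_mono inter_subset_left).trans_lt measure_ball_lt_top).ne
      (Measurable.aestronglyMeasurable (by fun_prop))
      (ae_restrict_of_forall_mem (hmb.inter hmS) fun y hy => ?_)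
    obtain ⟨hyb, hyS⟩ := hy
    have hyS' : ε < |x - y| := hyS
    rw [Metric.mem_ball, dist_eq_norm] at hyb
    rw [norm_mul, norm_mul, Real.norm_of_nonneg (Real.rpow_nonneg (abs_nonneg _) _), Real.norm_eq_abs c]
    have := Real.rpow_le_rpow_of_nonpos hε hyS'.le (show -(1 + 2 * σ) ≤ 0 by linarith)
    gcongr
  have h2' : IntegrableOn (fun y => (y - x) * remKernel lam σ x y) (Metric.ball x (x / 2) ∩ S) :=
    h2.mono_set inter_subset_left
  have hsum : IntegrableOn (fun y => (y - x) * (c * |x - y| ^ (-(1 + 2 * σ))) +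
      (y - x) * remKernel lam σ x y) (Metric.ball x (x / 2) ∩ S) := hG.add h2'
  have hK : ∀ y ∈ Metric.ball x (x / 2) ∩ S, (y - x) * (c * |x - y| ^ (-(1 + 2 * σ))) +
      (y - x) * remKernel lam σ x y = (y - x) * fracKernel lam σ x y := by
    rintro y ⟨hyb, hyS⟩
    have hyS' : ε < |x - y| := hyS
    have hne : x ≠ y := fun h => by rw [h, sub_self, abs_zero] at hyS'; linarith
    rw [fracKernel_eq_add_remKernel hlam hσ0 hσ1 hx (ball_half_subset hyb) hne]
    ring
  have hKi := IntegrableOn.congr_fun hsum hK (hmb.inter hmS)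
  have e1 : ∫ y in Metric.ball x (x / 2) ∩ S, (y - x) * fracKernel lam σ x y =
      ∫ y in Metric.ball x (x / 2) ∩ S, (y - x) * remKernel lam σ x y := by
    rw [← setIntegral_congr_fun (hmb.inter hmS) hK, integral_add hG h2', hodd, zero_add]
  have hin : Ioi 0 ∩ S ∩ Metric.ball x (x / 2) = Metric.ball x (x / 2) ∩ S := by
    ext y
    simp only [mem_inter_iff]
    exact ⟨fun h => ⟨h.2, h.1.2⟩, fun h => ⟨⟨ball_half_subset h.1, h.2⟩, h.1⟩⟩
  have h1' : IntegrableOn (fun y => nearDev u p x y * fracKernel lam σ x y) (Ioi 0 ∩ S) :=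
    h1.mono_set inter_subset_left
  have h3 : IntegrableOn ((Metric.ball x (x / 2)).indicator fun y => p * ((y - x) * fracKernel lam σ x y))
      (Ioi 0 ∩ S) := by
    rw [IntegrableOn, integrable_indicator_iff hmb, IntegrableOn, Measure.restrict_restrict hmb, inter_comm,
      hin]
    exact hKi.const_mul p
  have h1n : IntegrableOn (fun y => -(nearDev u p x y * fracKernel lam σ x y)) (Ioi 0 ∩ S) := h1'.neg
  rw [← e1, ← integral_const_mul, ← integral_neg, ← hin, ← setIntegral_indicator hmb, ← integral_sub h1n h3]
  refine setIntegral_congr_fun (measurableSet_Ioi.inter hmS) fun y _ => ?_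
  simp only [nearDev]
  by_cases hb : y ∈ Metric.ball x (x / 2)
  · rw [indicator_of_mem hb, indicator_of_mem hb]; ring
  · rw [indicator_of_notMem hb, indicator_of_notMem hb]; ring

/-- After the symmetric cancellation only absolutely convergent integrals remain, and dominated
convergence removes the truncation. -/
theorem tendsto_fracFun {lam σ x : ℝ} {u p : ℝ → ℝ} (hlam : 0 < lam) (hσ0 : 0 < σ) (hσ1 : σ < 1)
    (hx : 0 < x)
    (h1 : IntegrableOn (fun y => nearDev u (p x) x y * fracKernel lam σ x y) (Ioi 0))
    (h2 : IntegrableOn (fun y => (y - x) * remKernel lam σ x y) (Metric.ball x (x / 2))) :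
    Tendsto (fun ε : ℝ =>
      (∫ y in Ioi (0 : ℝ) ∩ {y | ε < |x - y|}, (u x - u y) * fracKernel lam σ x y) +
        u x * fracB lam σ x) (𝓝[>] 0) (𝓝 (fracFun lam σ u p x)) := by
  have h := (((tendsto_setIntegral_far x h1).neg.sub ((tendsto_setIntegral_far x h2).const_mul (p x))).add_const
    (u x * fracB lam σ x))
  refine h.congr' ?_
  filter_upwards [self_mem_nhdsWithin] with ε hε
  rw [setIntegral_far_eq hlam hσ0 hσ1 hx hε h1 h2]

/-! ### The two regimes of regularity -/

theorem abs_le_of_rpow_neg_mul_le {α B x w : ℝ} (hα : 0 ≤ α) (hx : 0 < x)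
    (h : x ^ (-α) * |w| ≤ B) : |w| ≤ max B 0 * (1 + x) ^ α := by
  rw [Real.rpow_neg hx.le, inv_mul_le_iff₀ (Real.rpow_pos_of_pos hx _)] at h
  have h1 : x ^ α ≤ (1 + x) ^ α := Real.rpow_le_rpow hx.le (by linarith) hα
  calc |w| ≤ x ^ α * B := h
    _ ≤ x ^ α * max B 0 := mul_le_mul_of_nonneg_left (le_max_left _ _) (Real.rpow_nonneg hx.le _)
    _ ≤ (1 + x) ^ α * max B 0 := mul_le_mul_of_nonneg_right h1 (le_max_right _ _)
    _ = _ := mul_comm _ _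

/-- A pointwise formula for Hölder functions. -/
theorem fracBessel_of_memHolderPlus {lam σ α : ℝ} {u : ℝ → ℝ} (hσ0 : 0 < σ) (hσ1 : σ < 1)
    (hlam : 2 * σ < lam) (hα : 2 * σ < α) (hu : MemL σ u) (hH : MemHolderPlus α u) :
    ∃ g : ℝ → ℝ, ContinuousOn g (Ioi 0) ∧ FracBesselIs lam σ u g ∧
      ∀ x : ℝ, 0 < x →
        IntegrableOn (fun y => (u x - u y) * fracKernel lam σ x y) (Ioi 0) ∧
        g x = (∫ y in Ioi (0 : ℝ), (u x - u y) * fracKernel lam σ x y) + u x * fracB lam σ x := by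
  obtain ⟨huc, ⟨A, hA⟩, ⟨B, hB⟩⟩ := hH
  have hub : ∀ x : ℝ, 0 < x → |u x| ≤ max B 0 * (1 + x) ^ α := fun x hx =>
    abs_le_of_rpow_neg_mul_le (by linarith) hx (hB x hx)
  -- With slope zero the deviation is `u(y) - u(x)` itself, so the integral converges absolutely
  -- without a principal value.
  obtain ⟨h1, h2, h3⟩ := fracFun_spec (β := α) (A := max A 0) (C₀ := max B 0) (M := α) (p := fun _ => 0)
    hσ0 hσ1 hlam hα (le_max_right _ _) (by linarith) (le_max_right _ _) hu huc continuousOn_const hub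
    (fun x hx => by
      rw [abs_zero]
      have : 0 < (1 + x) ^ α := Real.rpow_pos_of_pos (by linarith) _
      positivity)
    (fun x hx y hy => by
      rw [zero_mul, sub_zero, abs_sub_comm]
      refine (hA x y hx (ball_half_subset hy)).trans ?_
      gcongr
      exact le_max_left _ _)
  refine ⟨_, h1, h2, fun x hx => ?_⟩
  have e : ∀ y, (u x - u y) * fracKernel lam σ x y = -(nearDev u 0 x y * fracKernel lam σ x y) := by
    intro y
    simp [nearDev]
    ring
  refine ⟨?_, ?_⟩
  · simp only [e]
    exact (h3 x hx).1.neg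
  · simp only [e]
    rw [integral_neg, fracFun]
    ring

/-- A pointwise formula for differentiable functions with a Hölder derivative. -/
theorem fracBessel_of_deriv_memHolderPlus {lam σ α : ℝ} {u : ℝ → ℝ} (hσ0 : 0 < σ) (hσ1 : σ < 1)
    (hlam : 2 * σ < lam) (hα0 : 0 ≤ α) (hα : 2 * σ - 1 < α) (hu : MemL σ u)
    (hd : DifferentiableOn ℝ u (Ioi 0)) (hH : MemHolderPlus α (deriv u)) :
    ∃ g : ℝ → ℝ, ContinuousOn g (Ioi 0) ∧ FracBesselIs lam σ u g ∧
      ∀ x : ℝ, 0 < x →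
        (∀ ε : ℝ, 0 < ε → IntegrableOn (fun y => (u x - u y) * fracKernel lam σ x y)
          (Ioi 0 ∩ {y | ε < |x - y|})) ∧
        Tendsto (fun ε : ℝ =>
          (∫ y in Ioi (0 : ℝ) ∩ {y | ε < |x - y|}, (u x - u y) * fracKernel lam σ x y)
            + u x * fracB lam σ x) (𝓝[>] 0) (𝓝 (g x)) := by
  obtain ⟨hpc, ⟨A, hA⟩, ⟨B, hB⟩⟩ := hH
  have hlam0 : 0 < lam := by linarith
  have hderiv : ∀ x : ℝ, 0 < x → HasDerivAt u (deriv u x) x := fun x hx =>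
    (hd.differentiableAt (Ioi_mem_nhds hx)).hasDerivAt
  have hpb : ∀ x : ℝ, 0 < x → |deriv u x| ≤ max B 0 * (1 + x) ^ α := fun x hx =>
    abs_le_of_rpow_neg_mul_le hα0 hx (hB x hx)
  have hB0 : 0 ≤ max B 0 := le_max_right _ _
  set B' := max B 0
  -- The growth of `u` comes from that of its derivative through the mean value inequality from the
  -- point `1`.
  have hub : ∀ x : ℝ, 0 < x → |u x| ≤ (|u 1| + B' * 2 ^ α) * (1 + x) ^ (α + 1) := by
    intro x hx
    have hx1 : 1 ≤ 1 + x := by linarith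
    have hsub : ∀ z ∈ uIcc 1 x, 0 < z ∧ 1 + z ≤ 2 * (1 + x) := fun z hz => by
      rcases mem_uIcc.mp hz with h | h
      · exact ⟨by linarith, by linarith⟩
      · exact ⟨by linarith, by linarith⟩
    have h1 := (convex_uIcc 1 x).norm_image_sub_le_of_norm_hasDerivWithin_le (f := u) (f' := deriv u)
      (C := B' * (2 * (1 + x)) ^ α) (fun z hz => (hderiv z (hsub z hz).1).hasDerivWithinAt)
      (fun z hz => (hpb z (hsub z hz).1).trans (by
        have := hsub z hz
        have h0 : 0 ≤ 1 + z := by linarith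
        gcongr
        exact this.2)) left_mem_uIcc right_mem_uIcc
    rw [Real.norm_eq_abs, Real.norm_eq_abs] at h1
    have h2 : |x - 1| ≤ 1 + x := by rw [abs_le]; constructor <;> linarith
    have h3 : |u x| ≤ |u 1| + |u x - u 1| := by
      have := abs_add_le (u 1) (u x - u 1)
      rwa [add_sub_cancel] at this
    calc |u x| ≤ |u 1| + B' * (2 * (1 + x)) ^ α * (1 + x) := h3.trans (by gcongr; exact h1.trans (by gcongr))
      _ = |u 1| * 1 + B' * 2 ^ α * (1 + x) ^ (α + 1) := by
          rw [Real.mul_rpow two_pos.le (by linarith), Real.rpow_add_one (by linarith)]; ring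
      _ ≤ |u 1| * (1 + x) ^ (α + 1) + B' * 2 ^ α * (1 + x) ^ (α + 1) := by
          gcongr
          exact Real.one_le_rpow hx1 (by linarith)
      _ = _ := by ring
  obtain ⟨h1, h2, h3⟩ := fracFun_spec (β := 1 + α) (A := max A 0) (C₀ := |u 1| + B' * 2 ^ α) (M := α + 1)
    (p := deriv u) hσ0 hσ1 hlam (by linarith) (le_max_right _ _) (by linarith) (by positivity) hu
    hd.continuousOn hpc hub
    (fun x hx => (hpb x hx).trans (by
      have hx1 : 1 ≤ 1 + x := by linarith
      have h4 : (1 : ℝ) ≤ 2 ^ α := Real.one_le_rpow one_le_two hα0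
      have h5 : B' ≤ |u 1| + B' * 2 ^ α := by nlinarith [abs_nonneg (u 1)]
      gcongr
      linarith))
    (fun x hx y hy => by
      have hball : ∀ z, |x - z| ≤ |x - y| → 0 < z := fun z hz => by
        refine ball_half_subset (x := x) ?_
        rw [Metric.mem_ball, dist_comm, Real.dist_eq] at hy ⊢
        exact hz.trans_lt hy
      refine abs_sub_sub_deriv_mul_le hα0 (le_max_right _ _) (fun z hz => hderiv z (hball z hz))
        fun z hz => ?_
      rw [abs_sub_comm]
      refine (hA x z hx (hball z hz)).trans ?_
      gcongr
      exact le_max_left _ _)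
  exact ⟨_, h1, h2, fun x hx => ⟨fun ε hε => hu.integrableOn_far_sub hlam0 hσ0 hσ1 hx hε,
    tendsto_fracFun hlam0 hσ0 hσ1 hx (h3 x hx).1 (h3 x hx).2⟩⟩

end Bessel

end

open Bessel in
theorem theorem2 (lam σ : ℝ) (hlam : 0 < lam) (hσ0 : 0 < σ) (hσ1 : σ < 1) :
    -- the integrals that define the kernel and the function converge absolutely
    (∀ x y : ℝ, 0 < x → 0 < y → x ≠ y →
      IntegrableOn (fun t => heatKernel lam t x y / t ^ (1 + σ)) (Ioi 0)) ∧
    (∀ x : ℝ, 0 < x →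
      (∀ t : ℝ, 0 < t → IntegrableOn (fun y => heatKernel lam t x y) (Ioi 0)) ∧
      IntegrableOn (fun t => (heatOne lam t x - 1) / t ^ (1 + σ)) (Ioi 0)) ∧
    -- the estimates
    (∃ C : ℝ, 0 < C ∧ ∀ x y : ℝ, 0 < x → 0 < y → x ≠ y →
      0 ≤ fracKernel lam σ x y ∧ fracKernel lam σ x y ≤ C / |x - y| ^ (1 + 2 * σ)) ∧
    (∃ C : ℝ, 0 < C ∧ ∀ x : ℝ, 0 < x → |fracB lam σ x| ≤ C / x ^ (2 * σ)) ∧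
    -- the pointwise formula for small powers
    (σ < 1 / 2 → 1 ≤ lam →
      ∀ (α : ℝ) (u : ℝ → ℝ), 2 * σ < α → α ≤ 1 → MemL σ u → MemHolderPlus α u →
        ∃ g : ℝ → ℝ, ContinuousOn g (Ioi 0) ∧ FracBesselIs lam σ u g ∧
          ∀ x : ℝ, 0 < x →
            IntegrableOn (fun y => (u x - u y) * fracKernel lam σ x y) (Ioi 0) ∧
            g x = (∫ y in Ioi (0 : ℝ), (u x - u y) * fracKernel lam σ x y)
              + u x * fracB lam σ x) ∧
    -- the pointwise formula for large powers, with a principal value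
    (1 / 2 ≤ σ → 2 ≤ lam →
      ∀ (α : ℝ) (u : ℝ → ℝ), 2 * σ - 1 < α → α ≤ 1 → MemL σ u →
        ContinuousOn u (Ici 0) → DifferentiableOn ℝ u (Ioi 0) → MemHolderPlus α (deriv u) →
        ∃ g : ℝ → ℝ, ContinuousOn g (Ioi 0) ∧ FracBesselIs lam σ u g ∧
          ∀ x : ℝ, 0 < x →
            (∀ ε : ℝ, 0 < ε → IntegrableOn (fun y => (u x - u y) * fracKernel lam σ x y)
              (Ioi 0 ∩ {y | ε < |x - y|})) ∧
            Tendsto (fun ε : ℝ =>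
              (∫ y in Ioi (0 : ℝ) ∩ {y | ε < |x - y|}, (u x - u y) * fracKernel lam σ x y)
                + u x * fracB lam σ x) (𝓝[>] 0) (𝓝 (g x))) := by
  refine ⟨(heatKernel_time_integral hlam hσ0).1, fun x hx => ⟨fun t ht => integrableOn_heatKernel hlam ht hx,
    (heatOne_time_integral hlam hσ0 hσ1).1 x hx⟩, ?_, ?_, fun hσ hl α u hα _ hu hH => ?_,
    fun hσ hl α u hα _ hu _ hd hH => ?_⟩
  · obtain ⟨C, hC0, hC⟩ := exists_fracKernel_le hlam hσ0 hσ1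
    refine ⟨C, hC0, fun x y hx hy hxy => ⟨fracKernel_nonneg hlam hσ0 hσ1 hx hy, ?_⟩⟩
    rw [div_eq_mul_inv, ← Real.rpow_neg (abs_nonneg _)]
    exact hC x y hx hy hxy
  · obtain ⟨C, hC0, hC⟩ := exists_abs_fracB_le hlam hσ0 hσ1
    refine ⟨C, hC0, fun x hx => ?_⟩
    rw [div_eq_mul_inv, ← Real.rpow_neg hx.le]
    exact hC x hx
  -- In each regime the bound on `λ` gives `2σ < λ`: here `2σ < 1 ≤ λ`, below `2σ < 2 ≤ λ`. Below,
  -- `σ ≥ 1/2` also makes `α` positive.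
  · exact fracBessel_of_memHolderPlus hσ0 hσ1 (by linarith) hα hu hH
  · exact fracBessel_of_deriv_memHolderPlus hσ0 hσ1 (by linarith) (by linarith) hα hu hd hH
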